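/- Throughout, $\log$ is the natural logarithm, the length of a path is its number of edges, and a red-blue coloured graph is a simple graph each of whose edges is coloured red or blue. A coloured subgraph $G_0$ of a graph $G$ is regarded as a set of coloured edges (it has no isolated vertices); $G\setminus G_0$ is the graph of the edges of $G$ not in $G_0$. A set of vertices touches an edge if exactly one end point of the edge lies in it. Let $G$ be a cubic graph of order $n$ (not necessarily connected) and let $C$ be a real number. A red-blue coloured subgraph $G_0\subseteq G$ is called $C$-extendable if: (E1) every vertex of degree at least $2$ in $G_0$ is incident with a red and with a blue edge of $G_0$; (E2) every connected component of $G_0$ has at most $C\sqrt{\log n}$ vertices, and any two distinct components are at distance at least $10$ in $G$; (E3) every cycle in $G$ which does not contain both a red and a blue edge from the same component of $G_0$ has two consecutive edges outside $G_0$; (E4) $G\setminus G_0$ has an edge-decomposition into graphs $H_1,H_2,H_3$, with $H_2$ and $H_3$ vertex-disjoint, such that $H_1$ is obtained from a finite simple graph all of whose vertices have degree $1$ or $3$ by subdividing each edge at most $C\sqrt{\log n}$ times; $H_2$ is a vertex-disjoint union of even cycles of length at most $C\sqrt{\log n}$, each of which touches at most two edges of $H_1$; and $H_3$ is a vertex-disjoint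 union of graphs obtained from the two-vertex multigraph with three parallel edges by subdividing each edge at most $C\sqrt{\log n}$ times. For a red-blue colouring of (all edges of) $G$ and $t\ge 1$, let $r(P_t)$ and $b(P_t)$ be the numbers of connected components of the red graph, respectively of the blue graph, that are paths of length $t$. **Lemma.** There is an absolute constant $K$ such that for every $C$ there is $n_0$ such that the following holds for every $n\ge n_0$. Let $G$ be a cubic graph of order $n$ and let $G_0$ be a $C$-extendable red-blue coloured subgraph of $G$. Then there is a red-blue colouring of $G$ such that: (Q1) every monochromatic component is a path of length at most $K\log n$; (Q2) there is no red path of length at most $(\log n)^{2/3}$ that intersects at least $100\sqrt{\log n}$ pairwise vertex-disjoint blue paths of length at least $100\sqrt{\log n}$, and similarly with the roles of red and blue reversed (none of these paths need be maximal); (Q3) $|r(P_t)-b(P_t)|\le n^{2/3}$ for every $t\ge 1$; (Q4) for every finite red-blue coloured graph $H$, if $G_0$ has at least $n^{0.99}$ components that are isomorphic to $H$ (as coloured graphs), then at least $n^{0.9}$ of these components appear in $G$ with the colours of all their edges unchanged. -/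

import Mathlib

/-- A red-blue edge-coloured simple graph with vertices in `V`: its red edges and its blue edges,
no edge having both colours. -/
structure ColouredGraph (V : Type*) where
  red : SimpleGraph V
  blue : SimpleGraph V
  disjoint : Disjoint red blue

namespace ColouredGraph

/-- The underlying graph: all coloured edges. -/
def graph {V : Type*} (A : ColouredGraph V) : SimpleGraph V := A.red ⊔ A.blue

/-- The connected component `c` of `A` is isomorphic, as a red-blue coloured graph, to `H`. -/
def ComponentIso {V W : Type*} (A : ColouredGraph V) (H : ColouredGraph W)
    (c : A.graph.ConnectedComponent) : Prop :=
  ∃ φ : c.supp ≃ W, ∀ x y : c.supp,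
    (A.red.Adj x y ↔ H.red.Adj (φ x) (φ y)) ∧ (A.blue.Adj x y ↔ H.blue.Adj (φ x) (φ y))

/-- All edges of the component `c` of `A` are present in `B`, with the same colours. -/
def Survives {V : Type*} (A B : ColouredGraph V) (c : A.graph.ConnectedComponent) : Prop :=
  ∀ x ∈ c.supp, ∀ y ∈ c.supp,
    (A.red.Adj x y → B.red.Adj x y) ∧ (A.blue.Adj x y → B.blue.Adj x y)

end ColouredGraph

/-- The component `c` of `F` is a path of length `t` (with `t` edges). -/
def IsPathComponent {V : Type*} (F : SimpleGraph V) (c : F.ConnectedComponent) (t : ℕ) : Prop :=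
  Nonempty (c.toSimpleGraph ≃g SimpleGraph.pathGraph (t + 1))

/-- The number of components of `F` which are paths of length `t`. -/
noncomputable def pathCount {V : Type*} (F : SimpleGraph V) (t : ℕ) : ℕ :=
  {c : F.ConnectedComponent | IsPathComponent F c t}.ncard

/-- `H` is obtained, up to isolated vertices, from the (multi)graph with vertex set `W`, edge set
`E` and end points `ends : E → Sym2 W` by replacing every edge by a path with at most `b` interior
vertices; these paths are internally disjoint from each other and from the old vertices. -/
def IsSubdivision {V W E : Type*} (H : SimpleGraph V) (ends : E → Sym2 W) (b : ℝ) : Prop :=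
  ∃ (f : W → V) (src tgt : E → W) (P : ∀ e, H.Walk (f (src e)) (f (tgt e))),
    Function.Injective f ∧
    (∀ e, ends e = s(src e, tgt e)) ∧
    (∀ e, (P e).IsPath ∧ ((P e).length : ℝ) ≤ b + 1) ∧
    (∀ e w, f w ∈ (P e).support → w ∈ ends e) ∧
    (∀ e e', e ≠ e' → ∀ x, x ∈ (P e).support → x ∈ (P e').support → x ∈ Set.range f) ∧
    (∀ e e', e ≠ e' → (P e).edges.Disjoint (P e').edges) ∧
    (∀ z, z ∈ H.edgeSet ↔ ∃ e, z ∈ (P e).edges)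

/-- The edges of `H` with exactly one end point in the vertex set `S`. -/
def touchedEdges {V : Type*} (H : SimpleGraph V) (S : Set V) : Set (Sym2 V) :=
  {e | e ∈ H.edgeSet ∧ (∃ x ∈ e, x ∈ S) ∧ ∃ y ∈ e, y ∉ S}

/-- `H₁` is a subdivision of a finite simple graph with all degrees `1` or `3`, each edge being
subdivided at most `b` times. -/
def IsShortSubdivision {V : Type*} (H₁ : SimpleGraph V) (b : ℝ) : Prop :=
  ∃ (m : ℕ) (F : SimpleGraph (Fin m)),
    (∀ w, (F.neighborSet w).ncard = 1 ∨ (F.neighborSet w).ncard = 3) ∧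
    IsSubdivision H₁ (fun e : F.edgeSet => (e : Sym2 (Fin m))) b

/-- `H₂` is a vertex-disjoint union of even cycles of length at most `b`, each of which touches at
most two edges of `H₁`. -/
def IsShortEvenCycles {V : Type*} (H₁ H₂ : SimpleGraph V) (b : ℝ) : Prop :=
  ∀ c : H₂.ConnectedComponent, c.supp.Nontrivial →
    (∃ k : ℕ, 3 ≤ k ∧ Even k ∧ (k : ℝ) ≤ b ∧
      Nonempty (c.toSimpleGraph ≃g SimpleGraph.cycleGraph k)) ∧
    (touchedEdges H₁ c.supp).ncard ≤ 2

/-- `H₃` is a vertex-disjoint union of subdivisions of edges of multiplicity three, each of the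
three edges being subdivided at most `b` times. -/
def IsShortThetas {V : Type*} (H₃ : SimpleGraph V) (b : ℝ) : Prop :=
  ∀ c : H₃.ConnectedComponent, c.supp.Nontrivial →
    IsSubdivision c.toSimpleGraph (fun _ : Fin 3 => (s(0, 1) : Sym2 (Fin 2))) b

/-- Extendable red-blue coloured subgraphs `A` of `G`, where `s` bounds the sizes (to be taken of
order `√(log n)`). The components of `A` are those having an edge. -/
structure Extendable {V : Type*} (G : SimpleGraph V) (A : ColouredGraph V) (s : ℝ) : Prop where
  le : A.graph ≤ G
  /-- Vertices of degree at least two in `A` are incident to both colours. -/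
  degree : ∀ v, 2 ≤ (A.graph.neighborSet v).ncard →
    1 ≤ (A.red.neighborSet v).ncard ∧ 1 ≤ (A.blue.neighborSet v).ncard
  /-- Components are small. -/
  size : ∀ c : A.graph.ConnectedComponent, c.supp.Nontrivial → (c.supp.ncard : ℝ) ≤ s
  /-- Distinct components are at distance at least ten in `G`. -/
  dist : ∀ c d : A.graph.ConnectedComponent, c.supp.Nontrivial → d.supp.Nontrivial → c ≠ d →
    ∀ x ∈ c.supp, ∀ y ∈ d.supp, 10 ≤ G.edist x y
  /-- Every cycle of `G` without a red and a blue edge from the same component of `A` has two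
  consecutive edges outside `A`. -/
  cycle : ∀ (u : V) (p : G.Walk u u), p.IsCycle →
    (¬ ∃ x y x' y', s(x, y) ∈ p.edges ∧ A.red.Adj x y ∧ s(x', y') ∈ p.edges ∧ A.blue.Adj x' y' ∧
      A.graph.Reachable x x') →
    ∃ x y z, x ≠ z ∧ s(x, y) ∈ p.edges ∧ s(y, z) ∈ p.edges ∧
      ¬ A.graph.Adj x y ∧ ¬ A.graph.Adj y z
  /-- The uncoloured edges decompose into a short subdivision of a simple graph with degrees `1`
  and `3`, short even cycles, and short subdivided triple edges. -/
  decomp : ∃ H₁ H₂ H₃ : SimpleGraph V,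
    H₁ ⊔ H₂ ⊔ H₃ = G \ A.graph ∧ Disjoint H₁ H₂ ∧ Disjoint H₁ H₃ ∧ Disjoint H₂ H₃ ∧
    Disjoint H₂.support H₃.support ∧
    IsShortSubdivision H₁ s ∧ IsShortEvenCycles H₁ H₂ s ∧ IsShortThetas H₃ s

/-- No path of `F` of length at most `l` intersects at least `m` pairwise vertex-disjoint paths of
`F'` of length at least `m'`. -/
def NoSpider {V : Type*} (F F' : SimpleGraph V) (l m m' : ℝ) : Prop :=
  ¬ ∃ (u v : V) (p : F.Walk u v) (k : ℕ) (a b : Fin k → V) (q : ∀ i, F'.Walk (a i) (b i)),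
    p.IsPath ∧ (p.length : ℝ) ≤ l ∧ m ≤ (k : ℝ) ∧
    (∀ i, (q i).IsPath ∧ m' ≤ ((q i).length : ℝ) ∧ ∃ x ∈ p.support, x ∈ (q i).support) ∧
    (∀ i j, i ≠ j → (q i).support.Disjoint (q j).support)

/-! The components of `G₀` are thinned out to "pieces" at pairwise distance more than 100 in `G`,
still including many components of every frequent type (`exists_separated`). Each piece keeps or
exchanges its colours according to a random bit. All other edges are coloured from random bits so
that every vertex sees both colours; since `G` is cubic, the red and the blue graph then have
maximum degree two.

The edges outside the pieces are split into directed cycles and a forest with a depth function.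
Local rules make certain edges opposite in colour to another edge at the same vertex, which stops
monochromatic paths from descending far in the forest. Along the directed cycles, bits are
identified so that the third edges at certain triples of consecutive vertices never all agree
(`exists_identification_nonconstant`), which stops monochromatic paths from following these cycles.
Hence a monochromatic walk of 20 edges without backtracking comes within distance 2 of a piece
(`exists_bitColouring`).

Consequently long monochromatic paths, and all monochromatic cycles, stay near a single piece. Such
a cycle either leaves the piece or is covered by (E3), so it has two consecutive edges that may be
recoloured, and one of the two can be flipped without creating a monochromatic cycle (`exists_flip`,
`exists_repair`). The paths left have fewer than 20 edges or lie in a region of `O(√(log n))`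
vertices, whence (Q1) and (Q2).

The repair commutes with exchanging the colours, so the difference of the red and the blue path
counts is an odd function of the bits. One bit influences only polylogarithmically many edges, so
the Poincaré inequality bounds the second moments, and Chebyshev's inequality with a union bound
over path lengths and frequent types gives (Q3) and (Q4) for one choice of bits
(`exists_forall_abs_le_of_odd`). -/

/-! ### Second moments of odd functions on the cube. -/

/-- **Poincaré inequality on the cube**, unnormalised. -/
theorem sum_sq_sub_sq_sum_le_of_flip (B : Type*) [Finite B] :
    ∀ [Fintype B] [DecidableEq B] (f : (B → Bool) → ℝ) (l : B → ℝ),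
      (∀ ω b, |f (Function.update ω b (!ω b)) - f ω| ≤ l b) →
      2 ^ Fintype.card B * ∑ ω, f ω ^ 2 - (∑ ω, f ω) ^ 2 ≤ 4 ^ Fintype.card B * ∑ b, l b ^ 2 := by
  induction B using Finite.induction_empty_option with
  | of_equiv e ih =>
    rename_i α β
    intro _ _ f l h
    classical
    let _ := Fintype.ofEquiv β e.symm
    have key := ih (fun ω => f (ω ∘ e.symm)) (l ∘ e) (fun ω a => by
      have h1 := h (ω ∘ e.symm) (e a)
      have h2 : Function.update ω a (!ω a) ∘ e.symm =
          Function.update (ω ∘ e.symm) (e a) (!(ω ∘ e.symm) (e a)) := by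
        funext x
        simp only [Function.comp_apply, Function.update_apply, e.symm_apply_apply]
        simp [Equiv.symm_apply_eq]
      simp only [h2]
      exact h1)
    have hc : Fintype.card α = Fintype.card β := Fintype.card_congr e
    have e1 : ∀ g : (β → Bool) → ℝ, ∑ ω : α → Bool, g (ω ∘ e.symm) = ∑ ω, g ω := fun g =>
      Fintype.sum_equiv (e.arrowCongr (Equiv.refl Bool)) _ _ (fun ω => rfl)
    rw [hc, e1 (fun ω => f ω ^ 2), e1 f, show ∑ b, (l ∘ e) b ^ 2 = ∑ b, l b ^ 2 from
      Fintype.sum_equiv e _ _ (fun _ => rfl)] at key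
    exact key
  | h_empty =>
    intro _ _ f l h
    simp
  | h_option ih =>
    rename_i α _
    intro _ _ f l h
    classical
    have hc : Fintype.card (Option α) = Fintype.card α + 1 := by
      simp [← Nat.card_eq_fintype_card, Finite.card_option]
    set N : ℝ := 2 ^ Fintype.card α with hN
    let E : (Option α → Bool) ≃ Bool × (α → Bool) := Equiv.piOptionEquivProd
    have hsum : ∀ g : (Option α → Bool) → ℝ,
        ∑ ω, g ω = ∑ ω : α → Bool, (g (E.symm (true, ω)) + g (E.symm (false, ω))) := by
      intro g
      rw [← E.symm.sum_comp, Fintype.sum_prod_type, Finset.sum_add_distrib]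
      simp
    have hupd : ∀ c (ω : α → Bool) a, E.symm (c, Function.update ω a (!ω a)) =
        Function.update (E.symm (c, ω)) (some a) (!(E.symm (c, ω)) (some a)) := by
      intro c ω a
      funext x
      cases x with
      | none => simp [E, Equiv.piOptionEquivProd]
      | some x => by_cases hx : x = a <;> simp [E, Equiv.piOptionEquivProd, hx]
    have hupd' : ∀ (ω : α → Bool), E.symm (true, ω) =
        Function.update (E.symm (false, ω)) none (!(E.symm (false, ω)) none) := by
      intro ω
      funext x
      cases x <;> simp [E, Equiv.piOptionEquivProd]
    set f1 := fun ω => f (E.symm (true, ω)) with hf1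
    set f0 := fun ω => f (E.symm (false, ω)) with hf0
    -- The variance splits over the last coordinate: induction treats `f1 + f0`, and by the
    -- parallelogram law what is lost is the sum of `(f1 - f0) ^ 2`, controlled by the influence of
    -- `none`.
    have hIH := ih (fun ω => f1 ω + f0 ω) (fun a => 2 * l (some a)) (by
      intro ω a
      have h1 := h (E.symm (true, ω)) (some a)
      have h0 := h (E.symm (false, ω)) (some a)
      rw [← hupd] at h1 h0
      calc |f1 (Function.update ω a (!ω a)) + f0 (Function.update ω a (!ω a)) - (f1 ω + f0 ω)|
          = |(f1 (Function.update ω a (!ω a)) - f1 ω) + (f0 (Function.update ω a (!ω a)) - f0 ω)| := by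
            congr 1; ring
        _ ≤ _ := (abs_add_le _ _).trans (by linarith))
    have hdiff : ∑ ω, (f1 ω - f0 ω) ^ 2 ≤ N * l none ^ 2 := by
      calc ∑ ω, (f1 ω - f0 ω) ^ 2 ≤ ∑ ω : α → Bool, l none ^ 2 := by
            refine Finset.sum_le_sum fun ω _ => ?_
            have h1 := h (E.symm (false, ω)) none
            rw [← hupd'] at h1
            exact sq_le_sq' (by linarith [(abs_le.mp h1).1]) (abs_le.mp h1).2
        _ = N * l none ^ 2 := by simp [hN]
    have e1 := hsum (fun ω => f ω ^ 2)
    have e2 := hsum f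
    have e3 : ∑ ω, (f1 ω + f0 ω) ^ 2 + ∑ ω, (f1 ω - f0 ω) ^ 2
        = 2 * ∑ ω, f ω ^ 2 := by
      rw [e1, Finset.mul_sum, ← Finset.sum_add_distrib]
      refine Finset.sum_congr rfl fun ω _ => ?_
      simp only [hf1, hf0]; ring
    have e4 : ∑ ω, f ω = ∑ ω, (f1 ω + f0 ω) := e2
    have h4 : (4 : ℝ) ^ Fintype.card α = N * N := by
      rw [hN, ← mul_pow]; norm_num
    have e5 : ∑ b, l b ^ 2 = l none ^ 2 + ∑ a, l (some a) ^ 2 := by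
      convert Fintype.sum_option (fun b => l b ^ 2)
    rw [hc, pow_succ (2 : ℝ) (Fintype.card α), pow_succ (4 : ℝ) (Fintype.card α), ← hN, h4, e4, e5]
    rw [← hN, h4] at hIH
    simp only [mul_pow, ← Finset.mul_sum] at hIH
    have hNpos : 0 < N := by positivity
    nlinarith [mul_le_mul_of_nonneg_left hdiff hNpos.le, mul_nonneg (mul_nonneg hNpos.le hNpos.le) (sq_nonneg (l none))]

/-- Second moment bound for odd functions on the cube. -/
theorem sum_sq_le_of_odd {B : Type*} [Fintype B] [DecidableEq B] (f : (B → Bool) → ℝ) (l : B → ℝ)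
    (hl : ∀ ω b, |f (Function.update ω b (!ω b)) - f ω| ≤ l b)
    (hodd : ∀ ω, f (fun b => !ω b) = - f ω) :
    ∑ ω, f ω ^ 2 ≤ 2 ^ Fintype.card B * ∑ b, l b ^ 2 := by
  have h0 : ∑ ω : B → Bool, f ω = 0 := by
    have e : ∑ ω : B → Bool, f (fun b => !ω b) = ∑ ω, f ω := by
      refine Fintype.sum_equiv (Equiv.arrowCongr (Equiv.refl B) Equiv.boolNot) _ _ (fun ω => ?_)
      rfl
    simp only [hodd, Finset.sum_neg_distrib] at e
    linarith
  have := sum_sq_sub_sq_sum_le_of_flip B f l hl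
  rw [h0] at this
  have h4 : (4 : ℝ) ^ Fintype.card B = 2 ^ Fintype.card B * 2 ^ Fintype.card B := by
    rw [← mul_pow]; norm_num
  rw [h4] at this
  have hp : (0 : ℝ) < 2 ^ Fintype.card B := by positivity
  have h5 : 2 ^ Fintype.card B * (∑ ω, f ω ^ 2) ≤
      2 ^ Fintype.card B * (2 ^ Fintype.card B * ∑ b, l b ^ 2) := by linarith
  exact le_of_mul_le_mul_left h5 hp

/-- If finitely many odd functions on the cube have small second moments, then they can be made
small simultaneously. -/
theorem exists_forall_abs_le_of_odd {B I : Type*} [Fintype B] [DecidableEq B]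
    (J : Finset I) (f : I → (B → Bool) → ℝ) (l : I → B → ℝ) (t : I → ℝ) (ht : ∀ i ∈ J, 0 < t i)
    (hl : ∀ i ∈ J, ∀ ω b, |f i (Function.update ω b (!ω b)) - f i ω| ≤ l i b)
    (hodd : ∀ i ∈ J, ∀ ω, f i (fun b => !ω b) = - f i ω)
    (hsum : ∑ i ∈ J, (∑ b, l i b ^ 2) / t i ^ 2 < 1) :
    ∃ ω, ∀ i ∈ J, |f i ω| ≤ t i := by
  by_contra hcon
  push Not at hcon
  have hp : (0 : ℝ) < 2 ^ Fintype.card B := by positivity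
  -- Chebyshev and the union bound: were every `ω` bad for some index, each inner sum would be at
  -- least 1.
  have h1 : (2 : ℝ) ^ Fintype.card B ≤ ∑ ω : B → Bool, ∑ i ∈ J, f i ω ^ 2 / t i ^ 2 := by
    calc (2 : ℝ) ^ Fintype.card B = ∑ ω : B → Bool, 1 := by simp
      _ ≤ _ := by
        refine Finset.sum_le_sum fun ω _ => ?_
        obtain ⟨i, hi, hlt⟩ := hcon ω
        refine le_trans ?_ (Finset.single_le_sum (f := fun i => f i ω ^ 2 / t i ^ 2)
          (fun i _ => by positivity) hi)
        have := ht i hi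
        rw [one_le_div (by positivity)]
        rw [← sq_abs (f i ω)]
        gcongr
  rw [Finset.sum_comm] at h1
  have h2 : ∑ i ∈ J, ∑ ω : B → Bool, f i ω ^ 2 / t i ^ 2 ≤
      2 ^ Fintype.card B * ∑ i ∈ J, (∑ b, l i b ^ 2) / t i ^ 2 := by
    rw [Finset.mul_sum]
    refine Finset.sum_le_sum fun i hi => ?_
    rw [← Finset.sum_div, ← mul_div_assoc]
    have := ht i hi
    gcongr
    exact sum_sq_le_of_odd (f i) (l i) (hl i hi) (hodd i hi)
  have h3 := h1.trans h2
  nlinarith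

/-! ### Graphs of maximum degree two and their path components. -/

namespace SimpleGraph

variable {V : Type*}

/-- All degrees of `F` are at most two. -/
def MaxDegTwo (F : SimpleGraph V) : Prop :=
  ∀ v a b c, F.Adj v a → F.Adj v b → F.Adj v c → a = b ∨ a = c ∨ b = c

theorem mem_supp_of_closed {F : SimpleGraph V} {S : Set V} (hS : ∀ x ∈ S, ∀ y, F.Adj x y → y ∈ S)
    {x y : V} (hx : x ∈ S) (h : F.Reachable x y) : y ∈ S := by
  obtain ⟨p⟩ := h
  induction p with
  | nil => exact hx
  | cons h p ih => exact ih (hS _ hx _ h)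

/-- In a graph of maximum degree two, a vertex adjacent to an interior vertex of a path lies on
that path. -/
theorem MaxDegTwo.mem_support_of_adj_getVert {F : SimpleGraph V} (hF : F.MaxDegTwo) {u v : V}
    {p : F.Walk u v} (hp : p.IsPath) {i : ℕ} (h0 : 0 < i) (hi : i < p.length) {y : V}
    (hy : F.Adj (p.getVert i) y) : y = p.getVert (i - 1) ∨ y = p.getVert (i + 1) := by
  have h1 : F.Adj (p.getVert i) (p.getVert (i + 1)) := p.adj_getVert_succ hi
  have h2 : F.Adj (p.getVert i) (p.getVert (i - 1)) := by
    have := p.adj_getVert_succ (i := i - 1) (by omega)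
    rw [Nat.sub_add_cancel h0] at this
    exact this.symm
  rcases hF _ _ _ _ h1 h2 hy with h | h | h
  · have := hp.getVert_injOn (by simp; omega) (by simp; omega) h
    omega
  · exact Or.inr h.symm
  · exact Or.inl h.symm

/-- In a finite graph of maximum degree two, every component is spanned by a path. -/
theorem MaxDegTwo.exists_isPath_support_eq [Finite V] {F : SimpleGraph V} (hF : F.MaxDegTwo)
    (c : F.ConnectedComponent) :
    ∃ (u v : V) (p : F.Walk u v), p.IsPath ∧ ∀ x, x ∈ p.support ↔ x ∈ c.supp := by
  classical
  have := Fintype.ofFinite V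
  obtain ⟨x0, hx0⟩ := c.nonempty_supp
  -- A longest path in the component spans it: its ends have no neighbour off the path by
  -- maximality, and its interior vertices have both neighbours on it already.
  let P : ℕ → Prop := fun n => ∃ (u v : V) (p : F.Walk u v), p.IsPath ∧ u ∈ c.supp ∧ p.length = n
  have hb : ∀ n, P n → n ≤ Fintype.card V := by
    rintro n ⟨u, v, p, hp, _, rfl⟩
    exact hp.length_lt.le
  obtain ⟨u, v, p, hp, hu, hlen⟩ : P (Nat.findGreatest P (Fintype.card V)) :=
    Nat.findGreatest_spec (m := 0) (Nat.zero_le _) ⟨x0, x0, Walk.nil, by simp, hx0, rfl⟩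
  have hmax : ∀ n, P n → n ≤ p.length := fun n hn => by
    rw [hlen]; exact Nat.le_findGreatest (hb n hn) hn
  refine ⟨u, v, p, hp, fun x => ⟨fun hx => ?_, fun hx => ?_⟩⟩
  · have h1 : F.Reachable u x := ⟨p.takeUntil x hx⟩
    rw [ConnectedComponent.mem_supp_iff] at hu ⊢
    rw [← hu]
    exact ConnectedComponent.sound h1.symm
  · have hr : F.Reachable u x := by
      rw [ConnectedComponent.mem_supp_iff] at hu hx
      exact ConnectedComponent.exact (hu.trans hx.symm)
    refine mem_supp_of_closed (S := {x | x ∈ p.support}) ?_ p.start_mem_support hr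
    intro y hy z hyz
    by_contra hz
    have hz' : z ∉ p.support := hz
    obtain ⟨i, rfl, hi⟩ := Walk.mem_support_iff_exists_getVert.mp hy
    rcases Nat.eq_zero_or_pos i with rfl | h0
    · simp only [Walk.getVert_zero] at hyz
      have hzc : z ∈ c.supp := by
        rw [ConnectedComponent.mem_supp_iff] at hu ⊢
        rw [← hu]
        exact ConnectedComponent.sound hyz.symm.reachable
      have := hmax _ ⟨z, v, Walk.cons hyz.symm p, hp.cons hz', hzc, rfl⟩
      simp at this
    · rcases hi.lt_or_eq with hi | rfl
      · rcases hF.mem_support_of_adj_getVert hp h0 hi hyz with rfl | rfl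
        · exact hz' (Walk.getVert_mem_support _ _)
        · exact hz' (Walk.getVert_mem_support _ _)
      · simp only [Walk.getVert_length] at hyz
        have := hmax _ ⟨u, z, p.concat hyz, hp.concat hz' hyz, hu, rfl⟩
        simp at this

/-- A chord of the spanning path would close a cycle, so acyclicity leaves only the edges of the
path. -/
theorem isPathComponent_of_isPath {F : SimpleGraph V} (hac : F.IsAcyclic)
    {c : F.ConnectedComponent} {u v : V} {p : F.Walk u v} (hp : p.IsPath)
    (hs : ∀ x, x ∈ p.support ↔ x ∈ c.supp) : IsPathComponent F c p.length := by
  let f : Fin (p.length + 1) → c := fun i => ⟨p.getVert i, (hs _).1 (p.getVert_mem_support _)⟩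
  have hf : Function.Bijective f := by
    constructor
    · intro i j hij
      have := hp.getVert_injOn (by simp; omega) (by simp; omega) (congrArg Subtype.val hij)
      exact Fin.ext this
    · rintro ⟨x, hx⟩
      obtain ⟨i, rfl, hi⟩ := Walk.mem_support_iff_exists_getVert.mp ((hs x).2 hx)
      exact ⟨⟨i, by omega⟩, rfl⟩
  have key : ∀ i j : ℕ, i < j → j ≤ p.length → (F.Adj (p.getVert i) (p.getVert j) ↔ i + 1 = j) := by
    intro i j hij hj
    constructor
    · intro h
      have h1 := hac.eq_snd_of_adj_start (hp.drop i) h (by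
        rw [Walk.mem_support_iff_exists_getVert]
        exact ⟨j - i, by rw [Walk.drop_getVert]; congr 1; omega, by rw [Walk.drop_length]; omega⟩)
      rw [Walk.snd, Walk.drop_getVert] at h1
      exact (hp.getVert_injOn (by simp; omega) (by simp; omega) h1).symm
    · rintro rfl
      exact p.adj_getVert_succ (by omega)
  refine ⟨RelIso.symm ⟨Equiv.ofBijective f hf, ?_⟩⟩
  intro i j
  rw [pathGraph_adj]
  change F.Adj (p.getVert i) (p.getVert j) ↔ _
  rcases lt_trichotomy i.val j.val with h | h | h
  · rw [key _ _ h (by omega)]; omega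
  · rw [h]; simp
  · rw [adj_comm, key _ _ h (by omega)]; omega

theorem IsPathComponent.ncard_supp {F : SimpleGraph V} {c : F.ConnectedComponent} {t : ℕ}
    (h : IsPathComponent F c t) : c.supp.ncard = t + 1 := by
  obtain ⟨φ⟩ := h
  have := Nat.card_congr φ.toEquiv
  rw [← Nat.card_coe_set_eq]
  exact this.trans (by simp)

theorem supp_eq_of_agree_on_supp {F F' : SimpleGraph V} {c : F.ConnectedComponent}
    (h : ∀ x ∈ c.supp, ∀ y, F.Adj x y ↔ F'.Adj x y) {x : V} (hx : x ∈ c.supp) :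
    (F'.connectedComponentMk x).supp = c.supp := by
  ext y
  have hc : ∀ z ∈ c.supp, ∀ w, F.Adj z w → w ∈ c.supp := by
    intro z hz w hzw
    rw [ConnectedComponent.mem_supp_iff] at hz ⊢
    rw [← hz]
    exact ConnectedComponent.sound hzw.symm.reachable
  constructor
  · intro hy
    have hr : F'.Reachable x y := (ConnectedComponent.exact hy).symm
    exact mem_supp_of_closed (F := F') (S := c.supp)
      (fun z hz w hzw => hc z hz w ((h z hz w).2 hzw)) hx hr
  · intro hy
    have hr : F.Reachable x y := by
      rw [ConnectedComponent.mem_supp_iff] at hx hy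
      exact ConnectedComponent.exact (hx.trans hy.symm)
    have : y ∈ c.supp ∩ (F'.connectedComponentMk x).supp := by
      refine mem_supp_of_closed (F := F) (S := c.supp ∩ (F'.connectedComponentMk x).supp)
        (fun z hz w hzw => ⟨hc z hz.1 w hzw, ?_⟩) ⟨hx, rfl⟩ hr
      have h1 := (h z hz.1 w).1 hzw
      have h2 := hz.2
      rw [ConnectedComponent.mem_supp_iff] at h2 ⊢
      rw [← h2]
      exact ConnectedComponent.sound h1.symm.reachable
    exact this.2

/-- Changing a graph at the vertices of `U` only affects the path counts by at most `|U|`. -/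
theorem pathCount_le_add_ncard [Finite V] {F F' : SimpleGraph V} (U : Set V)
    (h : ∀ x, x ∉ U → ∀ y, F.Adj x y ↔ F'.Adj x y) (t : ℕ) :
    pathCount F t ≤ pathCount F' t + U.ncard := by
  classical
  -- Components avoiding `U` are also components of `F'`; every other component is charged to one of
  -- its vertices in `U`.
  have : {c : F.ConnectedComponent | IsPathComponent F c t} ⊆
      {c : F.ConnectedComponent | IsPathComponent F c t ∧ ∀ x ∈ c.supp, x ∉ U} ∪
        F.connectedComponentMk '' U := by
    intro c hc
    by_cases hU : ∀ x ∈ c.supp, x ∉ U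
    · exact Or.inl ⟨hc, hU⟩
    · push Not at hU
      obtain ⟨x, hx, hxU⟩ := hU
      exact Or.inr ⟨x, hxU, hx⟩
  refine (Set.ncard_le_ncard this (Set.toFinite _)).trans ((Set.ncard_union_le _ _).trans ?_)
  refine add_le_add ?_ (Set.ncard_image_le (Set.toFinite _))
  have hex : ∀ c : F.ConnectedComponent, ∃ x, x ∈ c.supp := fun c => c.nonempty_supp
  choose r hr using hex
  refine Set.ncard_le_ncard_of_injOn (fun c => F'.connectedComponentMk (r c)) ?_ ?_ (Set.toFinite _)
  · rintro c ⟨hc, hU⟩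
    have hagree : ∀ x ∈ c.supp, ∀ y, F.Adj x y ↔ F'.Adj x y := fun x hx => h x (hU x hx)
    have e := supp_eq_of_agree_on_supp hagree (hr c)
    obtain ⟨φ⟩ := hc
    refine ⟨RelIso.trans ⟨Equiv.setCongr e, ?_⟩ φ⟩
    rintro ⟨x, hx⟩ ⟨y, hy⟩
    have hx : x ∈ c.supp := by rw [← e]; exact hx
    exact hagree x hx y
  · rintro c ⟨_, hU⟩ c' ⟨_, hU'⟩ hcc
    have e := supp_eq_of_agree_on_supp (fun x hx => h x (hU x hx)) (hr c)
    have e' := supp_eq_of_agree_on_supp (fun x hx => h x (hU' x hx)) (hr c')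
    have hcc' : F'.connectedComponentMk (r c) = F'.connectedComponentMk (r c') := hcc
    rw [hcc', e'] at e
    exact ConnectedComponent.supp_injective e.symm

/-- Three distinct vertices of degree at most one in a graph of maximum degree two are not all in
the same component. -/
theorem MaxDegTwo.not_reachable_three [Finite V] {F : SimpleGraph V} (hF : F.MaxDegTwo)
    {u x y : V} (hux : u ≠ x) (huy : u ≠ y) (hxy : x ≠ y)
    (hu : ∀ a b, F.Adj u a → F.Adj u b → a = b) (hx : ∀ a b, F.Adj x a → F.Adj x b → a = b)
    (hy : ∀ a b, F.Adj y a → F.Adj y b → a = b) (h1 : F.Reachable u x) (h2 : F.Reachable u y) :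
    False := by
  classical
  obtain ⟨p, hp⟩ := h1.exists_isPath
  -- A path from `u` to `x` already exhausts the component, and its interior vertices have degree
  -- two, so there is no room for a third end.
  have hend : ∀ z, (∀ a b, F.Adj z a → F.Adj z b → a = b) → z ∈ p.support → z = u ∨ z = x := by
    intro z hz hzs
    obtain ⟨i, rfl, hi⟩ := Walk.mem_support_iff_exists_getVert.mp hzs
    rcases Nat.eq_zero_or_pos i with rfl | h0
    · left; simp
    · rcases hi.lt_or_eq with hi | rfl
      · exfalso
        have h1 : F.Adj (p.getVert i) (p.getVert (i + 1)) := p.adj_getVert_succ hi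
        have h2 : F.Adj (p.getVert i) (p.getVert (i - 1)) := by
          have := p.adj_getVert_succ (i := i - 1) (by omega)
          rw [Nat.sub_add_cancel h0] at this
          exact this.symm
        have := hp.getVert_injOn (by simp; omega) (by simp; omega) (hz _ _ h1 h2)
        omega
      · right; simp
  have hlen : 0 < p.length := by
    by_contra h
    exact hux (Walk.eq_of_length_eq_zero (p := p) (by omega))
  have hcl : ∀ z ∈ {z | z ∈ p.support}, ∀ w, F.Adj z w → w ∈ {z | z ∈ p.support} := by
    intro z hz w hzw
    obtain ⟨i, rfl, hi⟩ := Walk.mem_support_iff_exists_getVert.mp hz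
    rcases Nat.eq_zero_or_pos i with rfl | h0
    · have h1 := p.adj_getVert_succ (i := 0) hlen
      simp only [Walk.getVert_zero] at h1 hzw
      rw [hu _ _ hzw h1]
      exact Walk.getVert_mem_support _ _
    · rcases hi.lt_or_eq with hi | rfl
      · rcases hF.mem_support_of_adj_getVert hp h0 hi hzw with rfl | rfl
        · exact Walk.getVert_mem_support _ _
        · exact Walk.getVert_mem_support _ _
      · have h1 := (p.adj_getVert_succ (i := p.length - 1) (by omega)).symm
        rw [Nat.sub_add_cancel h0] at h1
        simp only [Walk.getVert_length] at h1 hzw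
        rw [hx _ _ hzw h1]
        exact Walk.getVert_mem_support _ _
  have := mem_supp_of_closed hcl p.start_mem_support h2
  rcases hend y hy this with h | h
  · exact huy h.symm
  · exact hxy h.symm

end SimpleGraph

/-! ### Two-colourings of cubic graphs and the removal of monochromatic cycles. -/

namespace SimpleGraph

variable {V : Type*}

/-- The graph of the edges of `G` of colour `c`. -/
def mono (G : SimpleGraph V) (col : Sym2 V → Bool) (c : Bool) : SimpleGraph V where
  Adj u v := G.Adj u v ∧ col s(u, v) = c
  symm := ⟨fun u v h => ⟨h.1.symm, by rw [Sym2.eq_swap]; exact h.2⟩⟩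
  loopless := ⟨fun v h => G.loopless.irrefl v h.1⟩

/-- All vertices are incident to edges of both colours. -/
def BothColours (G : SimpleGraph V) (col : Sym2 V → Bool) : Prop :=
  ∀ v c, ∃ w, (G.mono col c).Adj v w

/-- All vertices have exactly three neighbours. -/
def IsCubic (G : SimpleGraph V) : Prop := ∀ v, (G.neighborSet v).ncard = 3

theorem mono_le (G : SimpleGraph V) (col : Sym2 V → Bool) (c : Bool) : G.mono col c ≤ G :=
  fun _ _ h => h.1

theorem IsCubic.mem_of_ne {G : SimpleGraph V} (hG : G.IsCubic) {v a b c d : V} (ha : G.Adj v a)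
    (hb : G.Adj v b) (hc : G.Adj v c) (hd : G.Adj v d) (hab : a ≠ b) (hac : a ≠ c) (hbc : b ≠ c) :
    d = a ∨ d = b ∨ d = c := by
  by_contra! h
  have hfin : (G.neighborSet v).Finite := Set.finite_of_ncard_ne_zero (by rw [hG v]; norm_num)
  have h1 : ({a, b, c, d} : Set V) ⊆ G.neighborSet v := by
    intro x hx
    simp only [Set.mem_insert_iff, Set.mem_singleton_iff] at hx
    rcases hx with rfl | rfl | rfl | rfl <;> assumption
  have h2 := Set.ncard_le_ncard h1 hfin
  rw [hG v] at h2
  have h3 : ({a, b, c, d} : Set V).ncard = 4 := by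
    rw [Set.ncard_insert_of_notMem, Set.ncard_insert_of_notMem, Set.ncard_pair]
    · exact h.2.2.symm
    · simp only [Set.mem_insert_iff, Set.mem_singleton_iff, not_or]; exact ⟨hbc, h.2.1.symm⟩
    · simp only [Set.mem_insert_iff, Set.mem_singleton_iff, not_or]; exact ⟨hab, hac, h.1.symm⟩
  omega

theorem IsCubic.exists_three {G : SimpleGraph V} (hG : G.IsCubic) (v : V) :
    ∃ a b c, a ≠ b ∧ a ≠ c ∧ b ≠ c ∧ G.Adj v a ∧ G.Adj v b ∧ G.Adj v c := by
  obtain ⟨a, b, c, h1, h2, h3, h⟩ := Set.ncard_eq_three.mp (hG v)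
  refine ⟨a, b, c, h1, h2, h3, ?_, ?_, ?_⟩ <;> rw [← mem_neighborSet, h] <;> simp

theorem IsCubic.exists_third {G : SimpleGraph V} (hG : G.IsCubic) (v a b : V) :
    ∃ c, G.Adj v c ∧ c ≠ a ∧ c ≠ b := by
  obtain ⟨x, y, z, h1, h2, h3, hx, hy, hz⟩ := hG.exists_three v
  by_cases hxa : x = a ∨ x = b
  · by_cases hya : y = a ∨ y = b
    · exact ⟨z, hz, by rintro rfl; grind, by rintro rfl; grind⟩
    · exact ⟨y, hy, by tauto, by tauto⟩
  · exact ⟨x, hx, by tauto, by tauto⟩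

/-- With two of the three edges in one colour, only one is left for the other. Thus the vertices of
a monochromatic cycle have degree at most one in the opposite colour. -/
theorem BothColours.eq_of_adj {G : SimpleGraph V} (hG : G.IsCubic) {col : Sym2 V → Bool}
    {v x y : V} {c : Bool} (hxy : x ≠ y) (hx : (G.mono col c).Adj v x)
    (hy : (G.mono col c).Adj v y) (a b : V) (ha : (G.mono col (!c)).Adj v a)
    (hb : (G.mono col (!c)).Adj v b) : a = b := by
  by_contra hab
  have h1 : ∀ {z w}, (G.mono col c).Adj v z → (G.mono col (!c)).Adj v w → z ≠ w := by
    rintro z w hz hw rfl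
    have := hz.2.symm.trans hw.2
    simp at this
  rcases hG.mem_of_ne hx.1 hy.1 ha.1 hb.1 hxy (h1 hx ha) (h1 hy ha) with h | h | h
  · exact h1 hx hb h.symm
  · exact h1 hy hb h.symm
  · exact hab h.symm

theorem BothColours.maxDegTwo {G : SimpleGraph V} (hG : G.IsCubic) {col : Sym2 V → Bool}
    (hv : G.BothColours col) (c : Bool) : (G.mono col c).MaxDegTwo := by
  intro v x y z hx hy hz
  by_contra! h
  obtain ⟨w, hw⟩ := hv v (!c)
  have h1 : ∀ z, (G.mono col c).Adj v z → w ≠ z := by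
    rintro z hz rfl
    have := hz.2.symm.trans hw.2
    simp at this
  rcases hG.mem_of_ne hx.1 hy.1 hz.1 hw.1 h.1 h.2.1 h.2.2 with h | h | h
  · exact h1 x hx h
  · exact h1 y hy h
  · exact h1 z hz h

/-- Every vertex of a cycle has two neighbours along the cycle. -/
theorem Walk.IsCycle.exists_two_edges {F : SimpleGraph V} {u : V} {p : F.Walk u u}
    (hp : p.IsCycle) {x : V} (hx : x ∈ p.support) :
    ∃ a b, a ≠ b ∧ s(x, a) ∈ p.edges ∧ s(x, b) ∈ p.edges := by
  classical
  have hq : (p.rotate x hx).IsCycle := hp.rotate hx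
  refine ⟨_, _, hq.snd_ne_penultimate, ?_, ?_⟩
  · rw [← (p.rotate_edges x hx).mem_iff]
    exact Walk.mk_start_snd_mem_edges hq.not_nil
  · rw [← (p.rotate_edges x hx).mem_iff, Sym2.eq_swap]
    exact Walk.mk_penultimate_end_mem_edges hq.not_nil

theorem Walk.IsCycle.exists_ne_edge {F : SimpleGraph V} {u : V} {p : F.Walk u u}
    (hp : p.IsCycle) {x y : V} (hx : x ∈ p.support) : ∃ a, a ≠ y ∧ s(x, a) ∈ p.edges := by
  obtain ⟨a, b, hab, ha, hb⟩ := hp.exists_two_edges hx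
  by_cases h : a = y
  · exact ⟨b, fun hb => hab (h.trans hb.symm), hb⟩
  · exact ⟨a, h, ha⟩

/-- Destroying a monochromatic cycle by changing the colour of one of two consecutive edges,
without creating any monochromatic cycle. -/
theorem BothColours.exists_flip [Finite V] [DecidableEq V] {G : SimpleGraph V} (hG : G.IsCubic)
    {col : Sym2 V → Bool} (hv : G.BothColours col) {c : Bool} {u : V}
    {p : (G.mono col c).Walk u u} (hp : p.IsCycle) {y x₁ x₂ : V} (hne : x₁ ≠ x₂)
    (h1 : s(y, x₁) ∈ p.edges) (h2 : s(y, x₂) ∈ p.edges) :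
    ∃ z, (z = x₁ ∨ z = x₂) ∧
      G.BothColours (Function.update col s(y, z) (!col s(y, z))) ∧
      ∀ (c' : Bool) (w : V) (q : (G.mono (Function.update col s(y, z) (!col s(y, z))) c').Walk w w),
        q.IsCycle → s(y, z) ∉ q.edges := by
  have a1 : (G.mono col c).Adj y x₁ := p.adj_of_mem_edges h1
  have a2 : (G.mono col c).Adj y x₂ := p.adj_of_mem_edges h2
  obtain ⟨x₁', n1, h1'⟩ := hp.exists_ne_edge (y := y) (p.snd_mem_support_of_mem_edges h1)
  obtain ⟨x₂', n2, h2'⟩ := hp.exists_ne_edge (y := y) (p.snd_mem_support_of_mem_edges h2)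
  have a1' : (G.mono col c).Adj x₁ x₁' := p.adj_of_mem_edges h1'
  have a2' : (G.mono col c).Adj x₂ x₂' := p.adj_of_mem_edges h2'
  -- In the opposite colour `y`, `x₁`, `x₂` all have degree at most one, so they do not share a
  -- component. Hence one of the two edges joins different components of that colour, and flipping
  -- it closes no cycle; both its ends keep an edge of colour `c`.
  have key : ∃ z z' z'', (z = x₁ ∨ z = x₂) ∧ z' ≠ z ∧ (G.mono col c).Adj y z ∧
      (G.mono col c).Adj y z' ∧ z'' ≠ y ∧ (G.mono col c).Adj z z'' ∧
      ¬ (G.mono col (!c)).Reachable y z := by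
    by_contra! hcon
    exact (BothColours.maxDegTwo hG hv (!c)).not_reachable_three a1.ne a2.ne hne
      (BothColours.eq_of_adj hG hne a1 a2) (BothColours.eq_of_adj hG n1.symm a1.symm a1')
      (BothColours.eq_of_adj hG n2.symm a2.symm a2')
      (hcon x₁ x₂ x₁' (Or.inl rfl) hne.symm a1 a2 n1 a1')
      (hcon x₂ x₁ x₂' (Or.inr rfl) hne a2 a1 n2 a2')
  obtain ⟨z, z', z'', hz, hz', b1, b2, hz'', b3, hnr⟩ := key
  refine ⟨z, hz, ?_, ?_⟩
  · have hother : ∀ {v w d}, (G.mono col d).Adj v w → s(v, w) ≠ s(y, z) →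
        (G.mono (Function.update col s(y, z) (!col s(y, z))) d).Adj v w := by
      intro v w d h hn
      exact ⟨h.1, by rw [Function.update_of_ne hn]; exact h.2⟩
    intro v d
    by_cases hdc : d = c
    · subst hdc
      by_cases hvy : v = y
      · exact ⟨z', by subst hvy; exact hother b2 (by simp [hz', b2.ne.symm])⟩
      · by_cases hvz : v = z
        · exact ⟨z'', by subst hvz; exact hother b3 (by simp [hz'', hvy])⟩
        · obtain ⟨w, hw⟩ := hv v d
          exact ⟨w, hother hw (by simp [hvy, hvz])⟩
    · obtain rfl : d = !c := by cases d <;> cases c <;> simp_all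
      obtain ⟨w, hw⟩ := hv v (!c)
      refine ⟨w, hother hw fun h => ?_⟩
      have e1 := hw.2
      rw [h, b1.2] at e1
      cases c <;> simp at e1
  · intro c' w q hq hmem
    have hadj : (G.mono (Function.update col s(y, z) (!col s(y, z))) c').Adj y z :=
      q.adj_of_mem_edges hmem
    have hc' : c' = !c := by
      have := hadj.2
      rw [Function.update_self, b1.2] at this
      exact this.symm
    subst hc'
    have := (adj_and_reachable_delete_edges_iff_exists_cycle.mpr ⟨w, q, hq, hmem⟩).2
    refine hnr (this.mono ?_)
    intro v x hvx
    rw [deleteEdges_adj] at hvx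
    refine ⟨hvx.1.1, ?_⟩
    have h3 := hvx.1.2
    rwa [Function.update_of_ne hvx.2] at h3

/-- If every monochromatic cycle inside `X` has two consecutive edges in `S`, then all these cycles
can be destroyed by changing colours of edges in `S`. -/
theorem BothColours.exists_repair [Finite V] {G : SimpleGraph V} (hG : G.IsCubic)
    (S : Set (Sym2 V)) (X : Set V) {col : Sym2 V → Bool} (hv : G.BothColours col)
    (hcyc : ∀ col' : Sym2 V → Bool, (∀ e, e ∉ S → col' e = col e) → G.BothColours col' →
      ∀ (c : Bool) (u : V) (p : (G.mono col' c).Walk u u), p.IsCycle → (∀ x ∈ p.support, x ∈ X) →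
        ∃ y x₁ x₂, x₁ ≠ x₂ ∧ s(y, x₁) ∈ p.edges ∧ s(y, x₂) ∈ p.edges ∧
          s(y, x₁) ∈ S ∧ s(y, x₂) ∈ S) :
    ∃ col' : Sym2 V → Bool, (∀ e, e ∉ S → col' e = col e) ∧ G.BothColours col' ∧
      ∀ (c : Bool) (u : V) (p : (G.mono col' c).Walk u u), p.IsCycle →
        ¬ ∀ x ∈ p.support, x ∈ X := by
  classical
  -- The induction is on the number of edges on bad cycles. A flipped edge leaves this set, and any
  -- cycle afterwards avoids it and hence was present before. Later flips start from changed
  -- colourings, which is why `hcyc` concerns every colouring agreeing with `col` off `S`.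
  let cyc : (Sym2 V → Bool) → Set (Sym2 V) := fun col' =>
    {e | ∃ (c : Bool) (u : V) (p : (G.mono col' c).Walk u u), p.IsCycle ∧
      (∀ x ∈ p.support, x ∈ X) ∧ e ∈ p.edges}
  have main : ∀ n (col' : Sym2 V → Bool), (cyc col').ncard = n → (∀ e, e ∉ S → col' e = col e) →
      G.BothColours col' → ∃ col' : Sym2 V → Bool, (∀ e, e ∉ S → col' e = col e) ∧
      G.BothColours col' ∧ ∀ (c : Bool) (u : V) (p : (G.mono col' c).Walk u u), p.IsCycle →
        ¬ ∀ x ∈ p.support, x ∈ X := by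
    intro n
    induction n using Nat.strong_induction_on with
    | _ n ih =>
      intro col' hn hag hval
      by_cases hbad : ∀ (c : Bool) (u : V) (p : (G.mono col' c).Walk u u), p.IsCycle →
        ¬ ∀ x ∈ p.support, x ∈ X
      · exact ⟨col', hag, hval, hbad⟩
      push Not at hbad
      obtain ⟨c, u, p, hp, hX⟩ := hbad
      obtain ⟨y, x₁, x₂, hne, h1, h2, s1, s2⟩ := hcyc col' hag hval c u p hp hX
      obtain ⟨z, hz, hval', hcy⟩ := hval.exists_flip hG hp hne h1 h2
      have hzS : s(y, z) ∈ S := by rcases hz with rfl | rfl <;> assumption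
      have hzp : s(y, z) ∈ p.edges := by rcases hz with rfl | rfl <;> assumption
      refine ih _ ?_ _ rfl ?_ hval'
      · rw [← hn]
        refine Set.ncard_lt_ncard ⟨?_, ?_⟩ (Set.toFinite _)
        · rintro e ⟨d, w, q, hq, hqX, he⟩
          have htr : ∀ e ∈ q.edges, e ∈ (G.mono col' d).edgeSet := by
            intro e he
            have hne : e ≠ s(y, z) := by rintro rfl; exact hcy _ _ q hq he
            have h3 := q.edges_subset_edgeSet he
            induction e with
            | _ a b =>
              refine ⟨h3.1, ?_⟩
              have := h3.2
              rwa [Function.update_of_ne hne] at this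
          exact ⟨d, w, q.transfer _ htr, hq.transfer htr, by simpa using hqX, by simpa using he⟩
        · intro hsub
          obtain ⟨d, w, q, hq, _, he⟩ := hsub ⟨c, u, p, hp, hX, hzp⟩
          exact hcy _ _ q hq he
      · intro e he
        rw [Function.update_of_ne (by rintro rfl; exact he hzS)]
        exact hag e he
  exact main _ col rfl (fun _ _ => rfl) hv

end SimpleGraph

/-! ### Decomposition into directed cycles and a forest. -/

namespace SimpleGraph

variable {V : Type*}

/-- The permutation `σ` decomposes into directed cycles of the graph `B`. -/
def IsCyclePerm (B : SimpleGraph V) (σ : Equiv.Perm V) : Prop :=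
  ∀ v, σ v ≠ v → B.Adj v (σ v) ∧ σ (σ v) ≠ v

/-- The edges of `B` that are not on the directed cycles of `σ`. -/
def offCycles (B : SimpleGraph V) (σ : Equiv.Perm V) : SimpleGraph V where
  Adj u v := B.Adj u v ∧ σ u ≠ v ∧ σ v ≠ u
  symm := ⟨fun _ _ h => ⟨h.1.symm, h.2.2, h.2.1⟩⟩
  loopless := ⟨fun v h => B.loopless.irrefl v h.1⟩

theorem IsCyclePerm.adj_symm_apply {B : SimpleGraph V} {σ : Equiv.Perm V} (h : B.IsCyclePerm σ)
    {v : V} (hv : σ v ≠ v) : B.Adj v (σ.symm v) ∧ σ.symm v ≠ v ∧ σ.symm v ≠ σ v := by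
  have h1 : σ (σ.symm v) ≠ σ.symm v := by
    rw [σ.apply_symm_apply]
    intro h2
    apply hv
    conv_lhs => rw [h2]
    exact σ.apply_symm_apply v
  have h2 := h _ h1
  rw [σ.apply_symm_apply] at h1 h2
  exact ⟨h2.1.symm, h1.symm, h2.2.symm⟩

/-- The cyclic shift of the vertex list serves; length at least three makes its square fixed-point
free on the cycle. -/
theorem Walk.IsCycle.exists_cyclePerm [Finite V] [DecidableEq V] {F : SimpleGraph V} {u : V}
    {p : F.Walk u u} (hp : p.IsCycle) :
    ∃ τ : Equiv.Perm V, F.IsCyclePerm τ ∧ ∀ v, τ v ≠ v ↔ v ∈ p.support := by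
  set l := p.support.tail with hl
  have hnd : l.Nodup := hp.support_nodup
  have hlen : l.length = p.length := by simp [hl]
  have h3 := hp.three_le_length
  have hget : ∀ i (hi : i < l.length), l[i] = p.getVert (i + 1) := by
    intro i hi
    simp [hl, Walk.support_getElem_eq_getVert]
  have hmem : ∀ v, v ∈ p.support ↔ v ∈ l := by
    intro v
    rw [Walk.mem_support_iff]
    constructor
    · rintro (rfl | h)
      · exact Walk.end_mem_tail_support hp.not_nil
      · exact h
    · exact Or.inr
  have happ : ∀ i (hi : i < l.length),
      l.formPerm l[i] = l[(i + 1) % l.length]'(Nat.mod_lt _ (by omega)) :=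
    fun i hi => List.formPerm_apply_getElem l hnd i hi
  have hne : ∀ v ∈ l, l.formPerm v ≠ v ∧ F.Adj v (l.formPerm v) ∧
      l.formPerm (l.formPerm v) ≠ v := by
    intro v hv
    obtain ⟨i, hi, rfl⟩ := List.mem_iff_getElem.mp hv
    have hadj : F.Adj l[i] (l.formPerm l[i]) := by
      rw [happ i hi, hget, hget]
      by_cases h : i + 1 < l.length
      · simp only [Nat.mod_eq_of_lt h]
        exact p.adj_getVert_succ (by omega)
      · have : i + 1 = l.length := by omega
        simp only [this, Nat.mod_self]
        rw [hlen, Walk.getVert_length]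
        simpa using p.adj_getVert_succ (i := 0) (by omega)
    refine ⟨hadj.ne', hadj, ?_⟩
    rw [happ i hi, happ _ (Nat.mod_lt _ (by omega)), Ne, hnd.getElem_inj_iff, Nat.mod_add_mod]
    intro h
    by_cases h' : i + 1 + 1 < l.length
    · rw [Nat.mod_eq_of_lt h'] at h; omega
    · rw [Nat.mod_eq_sub_mod (by omega), Nat.mod_eq_of_lt (by omega)] at h; omega
  refine ⟨l.formPerm, fun v hv => ?_, fun v => ?_⟩
  · have hvl : v ∈ l := by
      by_contra hvl
      exact hv (List.formPerm_apply_of_notMem hvl)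
    exact (hne v hvl).2
  · rw [hmem]
    constructor
    · intro hv
      by_contra hvl
      exact hv (List.formPerm_apply_of_notMem hvl)
    · exact fun hv => (hne v hv).1

/-- A subcubic graph is the union of disjoint directed cycles and a forest. -/
theorem exists_isCyclePerm_isAcyclic_offCycles [Finite V] {G B : SimpleGraph V} (hG : G.IsCubic)
    (hB : B ≤ G) : ∃ σ : Equiv.Perm V, B.IsCyclePerm σ ∧ (B.offCycles σ).IsAcyclic := by
  classical
  have := Fintype.ofFinite V
  obtain ⟨σ, hσ, hmax⟩ := Set.Finite.exists_maximalFor (fun σ : Equiv.Perm V => σ.support.card)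
    {σ | B.IsCyclePerm σ} (Set.toFinite _) ⟨1, fun v hv => absurd rfl hv⟩
  refine ⟨σ, hσ, fun u p hp => ?_⟩
  -- With `σ` moving as many vertices as possible, a cycle remaining in `offCycles` could be added
  -- to it: a moved vertex has two of its three edges on directed cycles, so it cannot have two more
  -- on the remaining cycle.
  have hfix : ∀ v ∈ p.support, σ v = v := by
    intro v hv
    by_contra hne
    obtain ⟨a, b, hab, ha, hb⟩ := hp.exists_two_edges hv
    have ha := p.adj_of_mem_edges ha
    have hb := p.adj_of_mem_edges hb
    have h1 := hσ.adj_symm_apply hne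
    have h2 : ∀ {c}, (B.offCycles σ).Adj v c → σ.symm v ≠ c := by
      rintro c hc rfl
      exact hc.2.2 (σ.apply_symm_apply v)
    rcases hG.mem_of_ne (hB (hσ v hne).1) (hB h1.1) (hB ha.1) (hB hb.1) h1.2.2.symm ha.2.1
      (h2 ha) with h | h | h
    · exact hb.2.1 h.symm
    · exact h2 hb h.symm
    · exact hab h.symm
  obtain ⟨τ, hτ, hsupp⟩ := hp.exists_cyclePerm
  have e1 : ∀ v ∈ p.support, (σ * τ) v = τ v := by
    intro v hv
    refine hfix _ ((hsupp _).1 fun h => ?_)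
    exact (hsupp v).2 hv (τ.injective h)
  have e2 : ∀ v, v ∉ p.support → (σ * τ) v = σ v := by
    intro v hv
    have : τ v = v := by
      by_contra h
      exact hv ((hsupp v).1 h)
    rw [Equiv.Perm.mul_apply, this]
  have hcyc : B.IsCyclePerm (σ * τ) := by
    intro v hv
    by_cases hvp : v ∈ p.support
    · rw [e1 v hvp] at hv ⊢
      have hvp' : τ v ∈ p.support := (hsupp _).1 fun h => hv (τ.injective h)
      rw [e1 _ hvp']
      exact ⟨(hτ v hv).1.1, (hτ v hv).2⟩
    · rw [e2 v hvp] at hv ⊢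
      have hvp' : σ v ∉ p.support := fun h => hv (σ.injective (hfix _ h))
      rw [e2 _ hvp']
      exact hσ v hv
  have hlt : σ.support.card < (σ * τ).support.card := by
    refine Finset.card_lt_card ⟨fun v hv => ?_, fun hsub => ?_⟩
    · rw [Equiv.Perm.mem_support] at hv ⊢
      rwa [e2 v fun h => hv (hfix v h)]
    · have h1 : u ∈ (σ * τ).support := by
        rw [Equiv.Perm.mem_support, e1 u p.start_mem_support]
        exact (hsupp u).2 p.start_mem_support
      exact (Equiv.Perm.mem_support.mp (hsub h1)) (hfix u p.start_mem_support)
  exact absurd (hmax hcyc hlt.le) (not_le.mpr hlt)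

/-- A depth function on a forest. -/
structure IsDepth (T : SimpleGraph V) (d : V → ℕ) : Prop where
  adj : ∀ {u v}, T.Adj u v → d u = d v + 1 ∨ d v = d u + 1
  unique : ∀ {u a b}, T.Adj u a → T.Adj u b → d a < d u → d b < d u → a = b
  exists_lower : ∀ {u}, 0 < d u → ∃ a, T.Adj u a ∧ d a < d u

/-- Depth is the distance to a chosen root of the component. A lower neighbour is the penultimate
vertex of a path from the root, and such paths are unique in a forest. -/
theorem IsAcyclic.exists_isDepth {T : SimpleGraph V} (hT : T.IsAcyclic) :
    ∃ d : V → ℕ, T.IsDepth d := by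
  classical
  let r : V → V := fun v => (T.connectedComponentMk v).out
  have hr : ∀ v, T.Reachable (r v) v := fun v =>
    ConnectedComponent.exact (T.connectedComponentMk v).out_eq
  have hra : ∀ {u v}, T.Adj u v → r v = r u := fun h => by
    simp only [r, ConnectedComponent.sound h.reachable]
  refine ⟨fun v => T.dist (r v) v, ?_, ?_, ?_⟩
  · intro u v h
    simp only [hra h]
    exact hT.dist_eq_dist_add_one_of_adj_of_reachable _ h (hr u)
  · intro u a b ha hb hda hdb
    simp only [hra ha] at hda
    simp only [hra hb] at hdb
    have key : ∀ c, T.Adj u c → T.dist (r u) c < T.dist (r u) u →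
        ∃ q : T.Walk (r u) u, q.IsPath ∧ q.penultimate = c := by
      intro c hc hd
      obtain ⟨q, hq, hlen⟩ := ((hr u).trans hc.reachable).exists_path_of_dist
      refine ⟨q.concat hc.symm, hq.concat (fun hmem => ?_) hc.symm, by simp⟩
      have h1 := dist_le (q.takeUntil u hmem)
      have h2 := q.length_takeUntil_le_length hmem
      omega
    obtain ⟨q, hq, h1⟩ := key a ha hda
    obtain ⟨q', hq', h2⟩ := key b hb hdb
    have := congrArg Subtype.val ((hT.subsingleton_path _ _).elim ⟨q, hq⟩ ⟨q', hq'⟩)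
    simp only at this
    rw [← h1, ← h2, this]
  · intro u hu
    obtain ⟨q, hq, hlen⟩ := (hr u).exists_path_of_dist
    have hpos : 0 < q.length := by rw [hlen]; exact hu
    have hnn : ¬ q.Nil := by
      rw [← Walk.length_eq_zero_iff]; omega
    have hadj : T.Adj u q.penultimate := (q.adj_penultimate hnn).symm
    refine ⟨q.penultimate, hadj, ?_⟩
    simp only [hra hadj]
    have h1 := dist_le q.dropLast
    have h2 : q.dropLast.length < q.length := by simp; omega
    omega

end SimpleGraph

/-! ### Systems of parity equations and non-constant triples. -/

/-- Solving the equations `c e = s e xor c (t e)` for a map `t` decreasing a rank: all values are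
determined by the values at the fixed points of `t`. -/
theorem exists_parity {X : Type*} (t : X → X) (rk : X → ℕ) (M : ℕ) (hM : ∀ e, rk e ≤ M)
    (hrk : ∀ e, t e ≠ e → rk (t e) < rk e) (s : X → Bool) :
    ∃ k : X → Bool, (∀ e, t e = e → k e = false) ∧
      (∀ e, t e ≠ e → k e = xor (s e) (k (t e))) ∧ (∀ e, t (t^[M] e) = t^[M] e) := by
  classical
  have hfix : ∀ n e, rk e ≤ n → t (t^[n] e) = t^[n] e := by
    intro n
    induction n with
    | zero =>
      intro e he
      by_contra h
      have := hrk e h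
      omega
    | succ n ih =>
      intro e he
      by_cases h : t e = e
      · rw [Function.iterate_fixed h, h]
      · rw [Function.iterate_succ_apply]
        exact ih _ (by have := hrk e h; omega)
  -- The `n`-th approximation is correct at rank at most `n`; the initial value `false` is the one
  -- prescribed at fixed points.
  let K : ℕ → X → Bool := fun n => n.rec (fun _ => false)
    (fun _ K e => if t e = e then false else xor (s e) (K (t e)))
  have hK : ∀ n e, K (n + 1) e = if t e = e then false else xor (s e) (K n (t e)) :=
    fun _ _ => rfl
  have hstab : ∀ n e, rk e ≤ n → K (n + 1) e = K n e := by
    intro n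
    induction n with
    | zero =>
      intro e he
      have h0 : t e = e := by
        by_contra h
        have := hrk e h
        omega
      rw [hK, if_pos h0]
      rfl
    | succ n ih =>
      intro e he
      rw [hK (n + 1) e, hK n e]
      split_ifs with h
      · rfl
      · rw [ih (t e) (by have := hrk e h; omega)]
  refine ⟨K M, fun e he => ?_, fun e he => ?_, fun e => hfix M e (hM e)⟩
  · rw [← hstab M e (hM e), hK, if_pos he]
  · conv_lhs => rw [← hstab M e (hM e), hK, if_neg he]

theorem ncard_iterate_fibre_le {X : Type*} [Finite X] (t : X → X) (q : ℕ)
    (h : ∀ x, {e | t e = x}.ncard ≤ q) (n : ℕ) (x : X) : {e | t^[n] e = x}.ncard ≤ q ^ n := by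
  classical
  have := Fintype.ofFinite X
  induction n generalizing x with
  | zero => simp
  | succ n ih =>
    have e1 : {e | t^[n + 1] e = x} = ⋃ y ∈ ({y | t^[n] y = x} : Set X), {e | t e = y} := by
      ext e; simp
    rw [e1]
    have h2 := ih x
    rw [Set.ncard_eq_toFinset_card'] at h2 ⊢
    have e2 : (⋃ y ∈ ({y | t^[n] y = x} : Set X), {e | t e = y}).toFinset =
        ({y | t^[n] y = x} : Set X).toFinset.biUnion fun y => {e | t e = y}.toFinset := by
      ext e; simp
    rw [e2, pow_succ]
    refine (Finset.card_biUnion_le_card_mul _ _ q fun y _ => ?_).trans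
      (Nat.mul_le_mul_right q h2)
    rw [← Set.ncard_eq_toFinset_card']
    exact h y

/-- A family of triples of signed variables such that each variable has at most two occurrences
can be made non-constant by identifying variables, with only logarithmically many variables in
each class. -/
theorem exists_identification_nonconstant {Q X : Type*} [Finite Q] [Finite X] (pos : Q → Fin 3 → X)
    (sg : Q → Fin 3 → Bool) (h2 : ∀ x, {p : Q × Fin 3 | pos p.1 p.2 = x}.ncard ≤ 2)
    (D : ℕ) (hD : 2 ^ D * Nat.card Q < 3 ^ D) :
    ∃ (ρ : X → X) (κ : X → Bool), (∀ x, {y | ρ y = x}.ncard ≤ 2 * D + 1) ∧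
      ∀ (ω : X → Bool) (q : Q), ∃ i j,
        xor (sg q i) (xor (κ (pos q i)) (ω (ρ (pos q i)))) ≠
        xor (sg q j) (xor (κ (pos q j)) (ω (ρ (pos q j)))) := by
  classical
  have := Fintype.ofFinite Q
  have := Fintype.ofFinite X
  -- Double counting of occurrences: three per triple, at most two per variable. This yields Hall's
  -- condition, hence an own variable for every triple, and also the decay of the layers `L`.
  have hcount : ∀ (S : Finset Q) (Y : Finset X), (∀ q ∈ S, ∀ i, pos q i ∈ Y) →
      3 * S.card ≤ 2 * Y.card := by
    intro S Y hSY
    have h1 : S ×ˢ (Finset.univ : Finset (Fin 3)) ⊆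
        Y.biUnion fun x => {p : Q × Fin 3 | pos p.1 p.2 = x}.toFinset := by
      intro p hp
      simp only [Finset.mem_product] at hp
      simp only [Finset.mem_biUnion, Set.mem_toFinset, Set.mem_ofPred_eq]
      exact ⟨_, hSY _ hp.1 p.2, rfl⟩
    have h3 := (Finset.card_le_card h1).trans (Finset.card_biUnion_le_card_mul _ _ 2 fun x _ => by
      rw [← Set.ncard_eq_toFinset_card']; exact h2 x)
    simp at h3
    omega
  obtain ⟨own, hinj, hown⟩ := (Finset.all_card_le_biUnion_card_iff_exists_injective
    (fun q => Finset.univ.image (pos q))).mp (fun S => by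
      have := hcount S (S.biUnion fun q => Finset.univ.image (pos q)) (fun q hq i => by
        rw [Finset.mem_biUnion]
        exact ⟨q, hq, by simp⟩)
      omega)
  have hoi : ∀ q, ∃ i, pos q i = own q := fun q => by simpa using hown q
  choose oi hoi using hoi
  -- Triples survive to the next layer when all their variables are owned by triples of the current
  -- layer. Sizes shrink by the factor 2/3, so layer `D` is empty.
  let L : ℕ → Finset Q := fun n => n.rec Finset.univ
    (fun _ S => S.filter fun q => ∀ i, pos q i ∈ S.image own)
  have hL : ∀ n, L (n + 1) = (L n).filter fun q => ∀ i, pos q i ∈ (L n).image own := fun _ => rfl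
  have hcard : ∀ n, 3 ^ n * (L n).card ≤ 2 ^ n * Nat.card Q := by
    intro n
    induction n with
    | zero => simp [L]
    | succ n ih =>
      have h1 := hcount (L (n + 1)) ((L n).image own) (fun q hq i => by
        rw [hL, Finset.mem_filter] at hq
        exact hq.2 i)
      rw [Finset.card_image_of_injective _ hinj] at h1
      rw [pow_succ, pow_succ]
      calc 3 ^ n * 3 * (L (n + 1)).card = 3 ^ n * (3 * (L (n + 1)).card) := by ring
        _ ≤ 3 ^ n * (2 * (L n).card) := Nat.mul_le_mul_left _ h1
        _ = 2 * (3 ^ n * (L n).card) := by ring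
        _ ≤ 2 * (2 ^ n * Nat.card Q) := Nat.mul_le_mul_left _ ih
        _ = _ := by ring
  have hLD : L D = ∅ := by
    by_contra h
    have h1 := Finset.card_pos.mpr (Finset.nonempty_iff_ne_empty.mpr h)
    have h3 := hcard D
    have : 3 ^ D * 1 ≤ 3 ^ D * (L D).card := Nat.mul_le_mul_left _ h1
    omega
  have hanti : Antitone L := antitone_nat_of_succ_le fun n => Finset.filter_subset _ _
  -- In the last layer containing it, a triple has a variable not owned in that layer. This
  -- reference variable is unowned or owned at a lower level, so expressing every own variable
  -- through its reference variable is not circular.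
  have hlev : ∀ q, ∃ n, n < D ∧ q ∈ L n ∧ ∃ i, pos q i ∉ (L n).image own := by
    intro q
    have hD' : D ∈ {n | q ∉ L n} := by
      change q ∉ L D
      rw [hLD]; simp
    have hn : q ∉ L (sInf {n | q ∉ L n}) := Nat.sInf_mem ⟨D, hD'⟩
    have hpos : 0 < sInf {n | q ∉ L n} := by
      rw [Nat.pos_iff_ne_zero]
      intro h0
      rw [h0] at hn
      simp [L] at hn
    have hmin : q ∈ L (sInf {n | q ∉ L n} - 1) := by
      by_contra h
      have : sInf {n | q ∉ L n} ≤ sInf {n | q ∉ L n} - 1 := Nat.sInf_le h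
      omega
    refine ⟨sInf {n | q ∉ L n} - 1, ?_, hmin, ?_⟩
    · have : sInf {n | q ∉ L n} ≤ D := Nat.sInf_le hD'
      omega
    · rw [← Nat.sub_add_cancel hpos, hL, Finset.mem_filter] at hn
      push Not at hn
      exact hn hmin
  choose lev hlevD hlevL ref href using hlev
  have hrefne : ∀ q, pos q (ref q) ≠ own q := fun q h =>
    href q (by rw [h]; exact Finset.mem_image_of_mem _ (hlevL q))
  let f : X → X := fun x => if h : ∃ q, own q = x then pos h.choose (ref h.choose) else x
  let rk : X → ℕ := fun x => if h : ∃ q, own q = x then lev h.choose + 1 else 0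
  -- The sign makes the own entry and the reference entry of the triple opposite, so the triple
  -- cannot be constant.
  let s : X → Bool := fun x => if h : ∃ q, own q = x then
    !(xor (sg h.choose (oi h.choose)) (sg h.choose (ref h.choose))) else false
  have hch : ∀ q (h : ∃ q', own q' = own q), h.choose = q := fun q h => hinj h.choose_spec
  have hf : ∀ q, f (own q) = pos q (ref q) := fun q => by
    have h : ∃ q', own q' = own q := ⟨q, rfl⟩
    simp only [f, dif_pos h, hch q h]
  have hrk : ∀ q, rk (own q) = lev q + 1 := fun q => by
    have h : ∃ q', own q' = own q := ⟨q, rfl⟩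
    simp only [rk, dif_pos h, hch q h]
  have hs : ∀ q, s (own q) = !(xor (sg q (oi q)) (sg q (ref q))) := fun q => by
    have h : ∃ q', own q' = own q := ⟨q, rfl⟩
    simp only [s, dif_pos h, hch q h]
  have hf' : ∀ x, f x ≠ x → ∃ q, own q = x := by
    intro x hx
    by_contra h
    exact hx (by simp only [f, dif_neg h])
  obtain ⟨k, hk0, hk1, hkf⟩ := exists_parity f rk D (by
      intro x
      by_cases h : ∃ q, own q = x
      · obtain ⟨q, rfl⟩ := h
        rw [hrk]
        exact hlevD q
      · simp only [rk, dif_neg h]; omega) (by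
      intro x hx
      obtain ⟨q, rfl⟩ := hf' x hx
      rw [hf, hrk]
      by_cases h : ∃ q', own q' = pos q (ref q)
      · obtain ⟨q', hq'⟩ := h
        rw [← hq', hrk]
        by_contra hlt
        apply href q
        rw [← hq']
        exact Finset.mem_image_of_mem _ (hanti (by omega) (hlevL q'))
      · simp only [rk, dif_neg h]; omega) s
  refine ⟨f^[D], k, ?_, ?_⟩
  · have hchild : ∀ y, {x | f x = y ∧ x ≠ y}.ncard ≤ 2 := by
      intro y
      have hsub : {x | f x = y ∧ x ≠ y} ⊆
          (fun p : Q × Fin 3 => own p.1) '' {p : Q × Fin 3 | pos p.1 p.2 = y} := by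
        rintro x ⟨hx, hxy⟩
        obtain ⟨q, rfl⟩ := hf' x (by rw [hx]; exact hxy.symm)
        exact ⟨(q, ref q), (hf q).symm.trans hx, rfl⟩
      exact (Set.ncard_le_ncard hsub (Set.toFinite _)).trans
        ((Set.ncard_image_le (Set.toFinite _)).trans (h2 y))
    -- An owned variable spends one of its two occurrences on its owner, leaving at most one child.
    -- So each class is a root with at most two descending chains of length at most `D`, which gives
    -- `2 * D + 1`.
    have hchild1 : ∀ y x x', f y ≠ y → f x = y → f x' = y → x ≠ y → x' ≠ y → x = x' := by
      intro y x x' hy hx hx' hxy hxy'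
      by_contra hne
      obtain ⟨q₀, rfl⟩ := hf' y hy
      obtain ⟨q, rfl⟩ := hf' x (by rw [hx]; exact hxy.symm)
      obtain ⟨q', rfl⟩ := hf' x' (by rw [hx']; exact hxy'.symm)
      rw [hf] at hx hx'
      have hsub : ({(q₀, oi q₀), (q, ref q), (q', ref q')} : Set (Q × Fin 3)) ⊆
          {p : Q × Fin 3 | pos p.1 p.2 = own q₀} := by
        rintro p (rfl | rfl | rfl)
        · exact hoi q₀
        · exact hx
        · exact hx'
      have h3 := (Set.ncard_le_ncard hsub (Set.toFinite _)).trans (h2 _)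
      rw [Set.ncard_eq_three.mpr ⟨(q₀, oi q₀), (q, ref q), (q', ref q'), ?_, ?_, ?_, rfl⟩] at h3
      · omega
      · intro h; exact hxy (congrArg (fun p => own p.1) h).symm
      · intro h; exact hxy' (congrArg (fun p => own p.1) h).symm
      · intro h; exact hne (congrArg (fun p => own p.1) h)
    intro y
    let S : ℕ → Set X := fun j => {x | f^[j + 1] x = y ∧ f^[j] x ≠ y}
    have hS : ∀ j, (S j).ncard ≤ 2 := by
      intro j
      induction j with
      | zero => exact hchild y
      | succ j ih =>
        refine le_trans (Set.ncard_le_ncard_of_injOn f (t := S j) ?_ ?_ (Set.toFinite _)) ih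
        · rintro x ⟨hx, hx'⟩
          rw [Function.iterate_succ_apply] at hx hx'
          exact ⟨hx, hx'⟩
        · rintro x ⟨hx, hx'⟩ x' ⟨hz, hz'⟩ hxx
          have hnf : ∀ x, f^[j + 1 + 1] x = y → f^[j + 1] x ≠ y → f x ≠ x ∧ f (f x) ≠ f x := by
            intro x h1 h3
            refine ⟨fun h => h3 ?_, fun h => h3 ?_⟩
            · rw [Function.iterate_fixed h] at h1 ⊢
              exact h1
            · rw [Function.iterate_succ_apply, Function.iterate_fixed h] at h1 ⊢
              exact h1
          exact hchild1 (f x) x x' (hnf x hx hx').2 rfl hxx.symm (hnf x hx hx').1.symm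
            (by rw [hxx]; exact (hnf x' hz hz').1.symm)
    have hcov : ∀ n, {x | f^[n] x = y} ⊆ {y} ∪ ⋃ j ∈ Finset.range n, S j := by
      intro n
      induction n with
      | zero => intro x hx; left; exact hx
      | succ n ih =>
        intro x hx
        by_cases h : f^[n] x = y
        · rcases ih h with h1 | h1
          · exact Or.inl h1
          · right
            simp only [Set.mem_iUnion, Finset.mem_range] at h1 ⊢
            obtain ⟨j, hj, h1⟩ := h1
            exact ⟨j, by omega, h1⟩
        · right
          simp only [Set.mem_iUnion, Finset.mem_range]
          exact ⟨n, by omega, hx, h⟩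
    have hle : ∀ n, (⋃ j ∈ Finset.range n, S j).ncard ≤ 2 * n := by
      intro n
      induction n with
      | zero => simp
      | succ n ih =>
        rw [Finset.range_add_one, Finset.set_biUnion_insert]
        have := Set.ncard_union_le (S n) (⋃ j ∈ Finset.range n, S j)
        have := hS n
        omega
    refine (Set.ncard_le_ncard (hcov D) (Set.toFinite _)).trans ((Set.ncard_union_le _ _).trans ?_)
    rw [Set.ncard_singleton]
    have := hle D
    omega
  · intro ω q
    refine ⟨oi q, ref q, ?_⟩
    have hne : f (own q) ≠ own q := by rw [hf]; exact hrefne q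
    have e1 := hk1 _ hne
    rw [hs, hf] at e1
    have e3 : f^[D] (own q) = f^[D] (pos q (ref q)) := by
      rw [← hkf (own q), ← Function.iterate_succ_apply' f D (own q), Function.iterate_succ_apply, hf]
    rw [hoi, e1, e3]
    cases sg q (oi q) <;> cases sg q (ref q) <;> cases k (pos q (ref q)) <;>
      cases ω (f^[D] (pos q (ref q))) <;> decide

/-! ### Frames: the local rules for the colouring. -/

namespace SimpleGraph

variable {V : Type*}

/-- The edges of the cubic graph `G` outside `A` are divided into directed cycles and a forest
with a depth function, and some neighbours of every vertex are selected. -/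
structure Frame (G A : SimpleGraph V) where
  σ : Equiv.Perm V
  d : V → ℕ
  /-- The third neighbour of a vertex of a directed cycle. -/
  nb : V → V
  fst : V → V
  snd : V → V
  par : V → V
  /-- A child on a directed cycle, if there is one. -/
  ex : V → V
  /-- A neighbour in `A`. -/
  anb : V → V
  cyc : (G \ A).IsCyclePerm σ
  depth : ((G \ A).offCycles σ).IsDepth d
  nb_spec : ∀ v, G.Adj v (nb v) ∧ nb v ≠ σ v ∧ nb v ≠ σ.symm v
  children_spec : ∀ u, σ u = u → (∀ w, ¬ A.Adj u w) → fst u ≠ snd u ∧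
    (((G \ A).offCycles σ).Adj u (fst u) ∧ d u < d (fst u)) ∧
    (((G \ A).offCycles σ).Adj u (snd u) ∧ d u < d (snd u))
  par_spec : ∀ u, 0 < d u → ((G \ A).offCycles σ).Adj u (par u) ∧ d (par u) < d u
  ex_spec : ∀ u y, ((G \ A).offCycles σ).Adj u y → d u < d y → σ y ≠ y →
    ((G \ A).offCycles σ).Adj u (ex u) ∧ d u < d (ex u)
  ex_mem : ∀ u, ((G \ A).offCycles σ).Adj u (ex u) → σ (ex u) ≠ ex u
  anb_spec : ∀ u w, A.Adj u w → A.Adj u (anb u)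

variable {G A : SimpleGraph V}

theorem offCycles_adj_of_fixed {B : SimpleGraph V} {σ : Equiv.Perm V} {u w : V} (hu : σ u = u)
    (h : B.Adj u w) : (B.offCycles σ).Adj u w := by
  refine ⟨h, by rw [hu]; exact h.ne, fun hw => h.ne ?_⟩
  exact σ.injective (hu.trans hw.symm)

/-- A vertex has only one lower neighbour. Repeatedly used: of two forest neighbours one is a child,
and a path that starts to descend keeps descending. -/
theorem IsDepth.exists_higher {T : SimpleGraph V} {d : V → ℕ} (hd : T.IsDepth d) {u a b : V}
    (hab : a ≠ b) (ha : T.Adj u a) (hb : T.Adj u b) : d u < d a ∨ d u < d b := by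
  by_contra! h
  have h1 := hd.adj ha
  have h2 := hd.adj hb
  exact hab (hd.unique ha hb (by omega) (by omega))

theorem nonempty_frame [Finite V] (hG : G.IsCubic) (A : SimpleGraph V) :
    Nonempty (Frame G A) := by
  classical
  obtain ⟨σ, hσ, hac⟩ := exists_isCyclePerm_isAcyclic_offCycles hG (sdiff_le : G \ A ≤ G)
  obtain ⟨d, hd⟩ := hac.exists_isDepth
  have h1 : ∀ v, ∃ w, G.Adj v w ∧ w ≠ σ v ∧ w ≠ σ.symm v := fun v => hG.exists_third v _ _
  have h2 : ∀ u, ∃ p : V × V, σ u = u → (∀ w, ¬ A.Adj u w) → p.1 ≠ p.2 ∧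
      (((G \ A).offCycles σ).Adj u p.1 ∧ d u < d p.1) ∧
      (((G \ A).offCycles σ).Adj u p.2 ∧ d u < d p.2) := by
    intro u
    by_cases h : σ u = u ∧ ∀ w, ¬ A.Adj u w
    · obtain ⟨a, b, c, hab, hac, hbc, ha, hb, hc⟩ := hG.exists_three u
      have hT : ∀ {w}, G.Adj u w → ((G \ A).offCycles σ).Adj u w := fun {w} hw =>
        offCycles_adj_of_fixed h.1 ⟨hw, h.2 w⟩
      have e1 := hd.exists_higher hab (hT ha) (hT hb)
      have e2 := hd.exists_higher hac (hT ha) (hT hc)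
      have e3 := hd.exists_higher hbc (hT hb) (hT hc)
      by_cases ea : d u < d a
      · by_cases eb : d u < d b
        · exact ⟨(a, b), fun _ _ => ⟨hab, ⟨hT ha, ea⟩, hT hb, eb⟩⟩
        · exact ⟨(a, c), fun _ _ => ⟨hac, ⟨hT ha, ea⟩, hT hc, by tauto⟩⟩
      · exact ⟨(b, c), fun _ _ => ⟨hbc, ⟨hT hb, by tauto⟩, hT hc, by tauto⟩⟩
    · exact ⟨(u, u), fun h1 h2 => absurd ⟨h1, h2⟩ h⟩
  have h3 : ∀ u, ∃ w, 0 < d u → ((G \ A).offCycles σ).Adj u w ∧ d w < d u := by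
    intro u
    by_cases h : 0 < d u
    · obtain ⟨w, hw⟩ := hd.exists_lower h
      exact ⟨w, fun _ => hw⟩
    · exact ⟨u, fun h' => absurd h' h⟩
  -- If no child is on a directed cycle, the default is `u` itself, which is not adjacent to `u` and
  -- so equals no child.
  have h4 : ∀ u, ∃ w, (∀ y, ((G \ A).offCycles σ).Adj u y → d u < d y → σ y ≠ y →
      ((G \ A).offCycles σ).Adj u w ∧ d u < d w) ∧
      (((G \ A).offCycles σ).Adj u w → σ w ≠ w) := by
    intro u
    by_cases h : ∃ y, ((G \ A).offCycles σ).Adj u y ∧ d u < d y ∧ σ y ≠ y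
    · obtain ⟨y, hy⟩ := h
      exact ⟨y, fun _ _ _ _ => ⟨hy.1, hy.2.1⟩, fun _ => hy.2.2⟩
    · exact ⟨u, fun y h1 h2 h3 => absurd ⟨y, h1, h2, h3⟩ h, fun h => absurd rfl h.ne⟩
  have h5 : ∀ u, ∃ w, ∀ x, A.Adj u x → A.Adj u w := by
    intro u
    by_cases h : ∃ y, A.Adj u y
    · obtain ⟨y, hy⟩ := h
      exact ⟨y, fun _ _ => hy⟩
    · exact ⟨u, fun x hx => absurd ⟨x, hx⟩ h⟩
  choose nb hnb using h1
  choose p hp using h2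
  choose par hpar using h3
  choose ex hex using h4
  choose anb hanb using h5
  exact ⟨⟨σ, d, nb, fun u => (p u).1, fun u => (p u).2, par, ex, anb, hσ, hd, hnb, hp, hpar,
    fun u => (hex u).1, fun u => (hex u).2, hanb⟩⟩

namespace Frame

variable (F : Frame G A)

/-- The forest of a frame. -/
def T : SimpleGraph V := (G \ A).offCycles F.σ

/-- The direction of the edges outside `A`: away from the roots of the forest, or along the
directed cycles. -/
def Dir (u y : V) : Prop := (F.T.Adj u y ∧ F.d u < F.d y) ∨ (F.σ u = y ∧ F.σ u ≠ u)

theorem Dir.adj {F : Frame G A} {u y : V} (h : F.Dir u y) : G.Adj u y ∧ ¬ A.Adj u y := by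
  rcases h with h | ⟨rfl, h⟩
  · exact h.1.1
  · exact (F.cyc u h).1

theorem Dir.not_symm {F : Frame G A} {u y : V} (h : F.Dir u y) : ¬ F.Dir y u := by
  rintro (h' | ⟨h1, h2⟩)
  · rcases h with h | ⟨h1, h2⟩
    · exact absurd h.2 (not_lt.mpr h'.2.le)
    · exact h'.1.2.2 h1
  · rcases h with h | ⟨rfl, h⟩
    · exact h.1.2.2 h1
    · exact (F.cyc u h).2 h1

theorem Dir.unique {F : Frame G A} {u y u' y' : V} (h : F.Dir u y) (h' : F.Dir u' y')
    (he : s(u, y) = s(u', y')) : u = u' ∧ y = y' := by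
  rcases Sym2.eq_iff.mp he with h1 | ⟨rfl, rfl⟩
  · exact h1
  · exact absurd h' h.not_symm

open Classical in
/-- The edge `uy` directed from `u` to `y` is given the colour opposite to that of the edge from `u`
to `target u y`, if this is different from `y`. -/
noncomputable def target (u y : V) : V :=
  -- The value `y` means that no rule is imposed. A cycle edge is opposed to the third edge at its
  -- tail. Near `A`, child edges are opposed to the `A`-edge if it is the only one; several
  -- `A`-edges already show both colours. At even depth one child edge is opposed to another. At odd
  -- depth child edges are opposed to the parent edge, except for one selected child on a directed
  -- cycle; this exception keeps the number of ports per root at two.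
  if F.σ u = y then F.nb u
  else if F.σ u ≠ u then y
  else if ∃ w, A.Adj u w then (if ∀ w, A.Adj u w → w = F.anb u then F.anb u else y)
  else if Even (F.d u) then (if y = F.snd u then F.fst u else y)
  else if y = F.ex u then y else F.par u

open Classical in
/-- The map on edges given by `target`. -/
noncomputable def tie (e : Sym2 V) : Sym2 V :=
  if h : ∃ p : V × V, F.Dir p.1 p.2 ∧ e = s(p.1, p.2) then
    s(h.choose.1, F.target h.choose.1 h.choose.2) else e

theorem tie_of_dir {u y : V} (h : F.Dir u y) : F.tie s(u, y) = s(u, F.target u y) := by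
  have hex : ∃ p : V × V, F.Dir p.1 p.2 ∧ s(u, y) = s(p.1, p.2) := ⟨(u, y), h, rfl⟩
  obtain ⟨h1, h2⟩ := hex.choose_spec.1.unique h hex.choose_spec.2.symm
  rw [tie, dif_pos hex, h1, h2]

theorem tie_of_not_dir {e : Sym2 V} (h : ∀ u y, F.Dir u y → e ≠ s(u, y)) : F.tie e = e := by
  rw [tie, dif_neg]
  rintro ⟨p, hp, he⟩
  exact h _ _ hp he

theorem tie_of_mem_edgeSet {e : Sym2 V} (h : e ∈ A.edgeSet) : F.tie e = e := by
  refine F.tie_of_not_dir fun u y hd he => hd.adj.2 ?_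
  rw [he] at h
  exact h

open Classical in
/-- A rank decreased by `tie`. -/
noncomputable def rank (e : Sym2 V) : ℕ :=
  -- The longest chain of ties is: cycle edge, child edge at an odd vertex, child edge at the even
  -- parent, fixed edge. Fixed edges of `A` lie lowest because edges near `A` may be tied to them.
  if ∃ u, F.σ u ≠ u ∧ e = s(u, F.σ u) then 4
  else if ∃ u y, F.Dir u y ∧ e = s(u, y) ∧ F.σ u = u ∧ (∀ w, ¬ A.Adj u w) ∧ ¬ Even (F.d u) ∧
    y ≠ F.ex u then 3
  else if F.tie e ≠ e then 2
  else if e ∈ A.edgeSet then 0 else 1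

theorem rank_le (e : Sym2 V) : F.rank e ≤ 4 := by
  unfold rank; split_ifs <;> omega

theorem par_dir {u : V} (h : 0 < F.d u) : F.Dir (F.par u) u :=
  Or.inl ⟨(F.par_spec u h).1.symm, (F.par_spec u h).2⟩

theorem nb_ne_cycle_edge {v w : V} (hw : F.σ w ≠ w) : s(v, F.nb v) ≠ s(w, F.σ w) := by
  intro h
  rcases Sym2.eq_iff.mp h with ⟨rfl, h⟩ | ⟨h1, h2⟩
  · exact (F.nb_spec v).2.1 h
  · exact (F.nb_spec v).2.2 (by rw [h2, h1, F.σ.symm_apply_apply])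

theorem T_ne_cycle_edge {u y w : V} (h : F.T.Adj u y) : s(u, y) ≠ s(w, F.σ w) := by
  intro he
  rcases Sym2.eq_iff.mp he with ⟨rfl, h1⟩ | ⟨h1, h2⟩
  · exact h.2.1 h1.symm
  · exact h.2.2 (by rw [h1, h2])

theorem target_T {u y : V} (h : F.T.Adj u y) (hu : F.σ u ≠ u) : F.target u y = y := by
  unfold target
  rw [if_neg h.2.1, if_pos hu]

/-- Third edges are never cycle edges. From an odd vertex the tie leads to an edge below its parent,
which has even depth. At an even vertex, or at a vertex with a single `A`-edge, the tie ends at a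
fixed edge. -/
theorem rank_tie_lt {e : Sym2 V} (h : F.tie e ≠ e) : F.rank (F.tie e) < F.rank e := by
  classical
  obtain ⟨u, y, hd, rfl⟩ : ∃ u y, F.Dir u y ∧ e = s(u, y) := by
    by_contra! hcon
    exact h (F.tie_of_not_dir hcon)
  by_cases hσ : F.σ u = y ∧ F.σ u ≠ u
  · obtain ⟨rfl, hu⟩ := hσ
    have e1 : F.rank s(u, F.σ u) = 4 := by
      unfold rank; rw [if_pos ⟨u, hu, rfl⟩]
    have e2 : F.tie s(u, F.σ u) = s(u, F.nb u) := by
      rw [F.tie_of_dir hd, target, if_pos rfl]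
    rw [e1, e2]
    unfold rank
    rw [if_neg]
    · split_ifs <;> omega
    · rintro ⟨w, hw, he⟩
      exact F.nb_ne_cycle_edge hw he
  · have hT : F.T.Adj u y ∧ F.d u < F.d y := by
      rcases hd with h | h
      · exact h
      · exact absurd h hσ
    have hne4 : ∀ {a b}, F.T.Adj a b → ¬ ∃ w, F.σ w ≠ w ∧ s(a, b) = s(w, F.σ w) := by
      rintro a b hab ⟨w, _, he⟩
      exact F.T_ne_cycle_edge hab he
    have htie := F.tie_of_dir hd
    have hge : 2 ≤ F.rank s(u, y) := by
      unfold rank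
      rw [if_pos h]
      split_ifs <;> omega
    by_cases hu : F.σ u = u
    swap
    · rw [F.target_T hT.1 hu] at htie
      exact absurd htie h
    have hne : F.σ u ≠ y := hT.1.2.1
    by_cases hA : ∃ w, A.Adj u w
    · have htar : F.target u y = F.anb u ∨ F.target u y = y := by
        unfold target
        rw [if_neg hne, if_neg (not_not.mpr hu), if_pos hA]
        split_ifs <;> simp
      rcases htar with h1 | h1
      · rw [h1] at htie
        obtain ⟨w, hw⟩ := hA
        have hadj := F.anb_spec u w hw
        refine lt_of_lt_of_le ?_ hge
        rw [htie]
        unfold rank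
        have hnd : ∀ a b, F.Dir a b → s(u, F.anb u) ≠ s(a, b) := by
          intro a b hab he
          have : s(a, b) ∈ A.edgeSet := by rw [← he]; exact hadj
          exact hab.adj.2 this
        rw [if_neg, if_neg, if_neg, if_pos]
        · omega
        · exact hadj
        · rw [not_not]; exact F.tie_of_not_dir hnd
        · rintro ⟨a, b, hab, he, _⟩
          exact hnd a b hab he
        · rintro ⟨a, ha, he⟩
          exact hnd a _ (Or.inr ⟨rfl, ha⟩) he
      · rw [h1] at htie
        exact absurd htie h
    · push Not at hA
      by_cases hev : Even (F.d u)
      · have htar : F.target u y = if y = F.snd u then F.fst u else y := by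
          unfold target
          rw [if_neg hne, if_neg (not_not.mpr hu), if_neg (by simpa using hA), if_pos hev]
        by_cases hy : y = F.snd u
        · rw [if_pos hy] at htar
          rw [htar] at htie
          obtain ⟨h1, h2, h3⟩ := F.children_spec u hu hA
          have hdir : F.Dir u (F.fst u) := Or.inl h2
          refine lt_of_lt_of_le ?_ hge
          rw [htie]
          have hfix : F.tie s(u, F.fst u) = s(u, F.fst u) := by
            rw [F.tie_of_dir hdir]
            unfold target
            rw [if_neg h2.1.2.1, if_neg (not_not.mpr hu), if_neg (by simpa using hA), if_pos hev,
              if_neg h1]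
          unfold rank
          rw [if_neg (hne4 h2.1), if_neg, if_neg (not_not.mpr hfix)]
          · split_ifs <;> omega
          · rintro ⟨a, b, hab, he, _, _, h5, _⟩
            rw [(hdir.unique hab he).1] at hev
            exact h5 hev
        · rw [htar, if_neg hy] at htie
          exact absurd htie h
      · have htar : F.target u y = if y = F.ex u then y else F.par u := by
          unfold target
          rw [if_neg hne, if_neg (not_not.mpr hu), if_neg (by simpa using hA), if_neg hev]
        by_cases hy : y = F.ex u
        · rw [htar, if_pos hy] at htie
          exact absurd htie h
        · rw [htar, if_neg hy] at htie
          have hpos : 0 < F.d u := Nat.pos_of_ne_zero (by rintro h0; rw [h0] at hev; simp at hev)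
          have hp := F.par_spec u hpos
          have e3 : F.rank s(u, y) = 3 := by
            unfold rank
            rw [if_neg (hne4 hT.1), if_pos ⟨u, y, hd, rfl, hu, hA, hev, hy⟩]
          rw [e3, htie]
          unfold rank
          rw [if_neg (hne4 hp.1), if_neg]
          · split_ifs <;> omega
          · rintro ⟨a, b, hab, he, _, _, h5, _⟩
            have h6 := (F.par_dir hpos).unique hab (by rw [← he, Sym2.eq_swap])
            rw [← h6.1] at h5
            have h7 := F.depth.adj hp.1
            have h8 := hp.2
            have h9 : F.d u = F.d (F.par u) + 1 := by omega
            rw [h9] at hev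
            simp only [Nat.even_add_one, not_not] at hev
            exact h5 hev

end Frame

end SimpleGraph

/-! ### Ports of the directed cycles and their roots. -/

namespace SimpleGraph

variable {V : Type*} {G A : SimpleGraph V}

/-- A set of vertices containing all vertices at distance at most two from the edges of `A`. -/
def IsGuard (G A : SimpleGraph V) (W : Set V) : Prop :=
  ∀ v, v ∉ W → (∀ w, ¬ A.Adj v w) ∧
    ∀ u, G.Adj v u → (∀ w, ¬ A.Adj u w) ∧ ∀ p, G.Adj u p → ∀ w, ¬ A.Adj p w

namespace Frame

variable (F : Frame G A)

/-- The edge of the forest at a vertex of a directed cycle. -/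
def port (v : V) : Sym2 V := s(v, F.nb v)

theorem T_adj_of_adj {u w : V} (hA : ∀ w, ¬ A.Adj u w) (h : G.Adj u w) (h1 : w ≠ F.σ u)
    (h2 : w ≠ F.σ.symm u) : F.T.Adj u w :=
  ⟨⟨h, hA w⟩, h1.symm, fun h3 => h2 (by rw [← h3, F.σ.symm_apply_apply])⟩

theorem eq_nb_of_adj (hG : G.IsCubic) {v w : V} (hv : F.σ v ≠ v) (h : G.Adj v w)
    (h1 : w ≠ F.σ v) (h2 : w ≠ F.σ.symm v) : w = F.nb v := by
  have e := F.cyc.adj_symm_apply hv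
  obtain ⟨n1, n2, n3⟩ := F.nb_spec v
  rcases hG.mem_of_ne (F.cyc v hv).1.1 e.1.1 n1 h e.2.2.symm n2.symm n3.symm with h | h | h
  · exact absurd h h1
  · exact absurd h h2
  · exact h

theorem eq_nb_of_T (hG : G.IsCubic) {v w : V} (hv : F.σ v ≠ v) (h : F.T.Adj v w) :
    w = F.nb v :=
  F.eq_nb_of_adj hG hv h.1.1 h.2.1.symm (by
    rintro rfl; exact h.2.2 (F.σ.apply_symm_apply v))

theorem T_adj_nb {v : V} (hA : ∀ w, ¬ A.Adj v w) : F.T.Adj v (F.nb v) :=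
  F.T_adj_of_adj hA (F.nb_spec v).1 (F.nb_spec v).2.1 (F.nb_spec v).2.2

/-- The vertex `v` is on a directed cycle, and equal to `y` or an unselected child of `y`. -/
def Slot (y v : V) : Prop :=
  F.σ v ≠ v ∧ (v = y ∨ (F.σ y = y ∧ ¬ Even (F.d y) ∧ F.T.Adj y v ∧ F.d y < F.d v ∧ v ≠ F.ex y))

/-- At odd depth `y` has a parent and a selected child, so cubicity leaves room for only one
unselected child; such a `y` is itself off the directed cycles, so the two alternatives exclude each
other. -/
theorem Slot.unique {F : Frame G A} (hG : G.IsCubic) {y v v' : V} (h : F.Slot y v)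
    (h' : F.Slot y v') : v = v' := by
  obtain ⟨h0, h⟩ := h
  obtain ⟨h0', h'⟩ := h'
  rcases h with rfl | ⟨a1, a2, a3, a4, a5⟩
  · rcases h' with rfl | h'
    · rfl
    · exact absurd h'.1 h0
  · rcases h' with rfl | ⟨b1, b2, b3, b4, b5⟩
    · exact absurd a1 h0'
    · by_contra hne
      have hpos : 0 < F.d y := Nat.pos_of_ne_zero (by rintro h0; rw [h0] at a2; simp at a2)
      have hp := F.par_spec y hpos
      have he := F.ex_spec y v a3 a4 h0
      rcases hG.mem_of_ne a3.1.1 b3.1.1 he.1.1.1 hp.1.1.1 hne a5 b5 with h | h | h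
      · rw [h] at hp; omega
      · rw [h] at hp; omega
      · rw [h] at hp; omega

theorem tie_iterate_four_of_tie {e e' : Sym2 V} (h : F.tie e = e') (h' : F.tie e' = e') :
    F.tie^[4] e = e' := by
  rw [Function.iterate_succ_apply, h, Function.iterate_fixed h']

theorem tie_iterate_four_of_tie_tie {e e' e'' : Sym2 V} (h : F.tie e = e') (h' : F.tie e' = e'')
    (h'' : F.tie e'' = e'') : F.tie^[4] e = e'' := by
  rw [Function.iterate_succ_apply, h, Function.iterate_succ_apply, h', Function.iterate_fixed h'']

open Classical in
theorem target_even {u y : V} (h : F.T.Adj u y) (hu : F.σ u = u) (hA : ∀ w, ¬ A.Adj u w)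
    (he : Even (F.d u)) : F.target u y = if y = F.snd u then F.fst u else y := by
  unfold target
  rw [if_neg h.2.1, if_neg (not_not.mpr hu), if_neg (by simpa using hA), if_pos he]

open Classical in
theorem target_odd {u y : V} (h : F.T.Adj u y) (hu : F.σ u = u) (hA : ∀ w, ¬ A.Adj u w)
    (he : ¬ Even (F.d u)) : F.target u y = if y = F.ex u then y else F.par u := by
  unfold target
  rw [if_neg h.2.1, if_neg (not_not.mpr hu), if_neg (by simpa using hA), if_neg he]

theorem tie_eq_self {u y : V} (h : F.Dir u y) (ht : F.target u y = y) :
    F.tie s(u, y) = s(u, y) := by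
  rw [F.tie_of_dir h, ht]

open Classical in
theorem even_top {u y : V} (h : F.T.Adj u y) (hlt : F.d u < F.d y) (hu : F.σ u = u)
    (hA : ∀ w, ¬ A.Adj u w) (he : Even (F.d u)) :
    F.tie^[4] s(u, y) = s(u, if y = F.snd u then F.fst u else y) := by
  have hd : F.Dir u y := Or.inl ⟨h, hlt⟩
  have ht := F.target_even h hu hA he
  have h1 := F.tie_of_dir hd
  rw [ht] at h1
  obtain ⟨c1, c2, c3⟩ := F.children_spec u hu hA
  by_cases hy : y = F.snd u
  · rw [if_pos hy] at h1 ⊢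
    refine F.tie_iterate_four_of_tie h1 (F.tie_eq_self (Or.inl c2) ?_)
    rw [F.target_even c2.1 hu hA he, if_neg c1]
  · rw [if_neg hy] at h1 ⊢
    exact Function.iterate_fixed h1 4

/-- The position of the root of a port. -/
theorem exists_root_port {W : Set V} (hW : IsGuard G A W) {v : V} (hv : F.σ v ≠ v) (hvW : v ∉ W) :
    ∃ u₀ y₀, F.Dir u₀ y₀ ∧ F.tie^[4] (F.port v) = s(u₀, y₀) ∧
      ((F.σ u₀ ≠ u₀ ∧ v = u₀) ∨ F.Slot y₀ v ∨ (F.σ u₀ = u₀ ∧ F.Slot (F.snd u₀) v)) := by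
  obtain ⟨hA, hA'⟩ := hW v hvW
  have hT := F.T_adj_nb hA
  by_cases hd : F.d v < F.d (F.nb v)
  · have hdir : F.Dir v (F.nb v) := Or.inl ⟨hT, hd⟩
    exact ⟨v, F.nb v, hdir, Function.iterate_fixed (F.tie_eq_self hdir (F.target_T hT hv)) 4,
      Or.inl ⟨hv, rfl⟩⟩
  obtain ⟨u, hu⟩ : ∃ u, u = F.nb v := ⟨_, rfl⟩
  rw [← hu] at hT hd
  have hlt : F.d u < F.d v := by
    have := F.depth.adj hT
    omega
  obtain ⟨hAu, hAu'⟩ := hA' u hT.1.1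
  have hport : F.port v = s(u, v) := by rw [port, ← hu, Sym2.eq_swap]
  rw [hport]
  have hdir : F.Dir u v := Or.inl ⟨hT.symm, hlt⟩
  by_cases hus : F.σ u = u
  swap
  · exact ⟨u, v, hdir, Function.iterate_fixed (F.tie_eq_self hdir (F.target_T hT.symm hus)) 4,
      Or.inr (Or.inl ⟨hv, Or.inl rfl⟩)⟩
  by_cases hev : Even (F.d u)
  · have h4 := F.even_top hT.symm hlt hus hAu hev
    by_cases hvs : v = F.snd u
    · rw [if_pos hvs] at h4
      exact ⟨u, F.fst u, Or.inl (F.children_spec u hus hAu).2.1, h4,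
        Or.inr (Or.inr ⟨hus, hv, Or.inl hvs⟩)⟩
    · rw [if_neg hvs] at h4
      exact ⟨u, v, hdir, h4, Or.inr (Or.inl ⟨hv, Or.inl rfl⟩)⟩
  · have ht := F.target_odd hT.symm hus hAu hev
    by_cases hve : v = F.ex u
    · rw [if_pos hve] at ht
      exact ⟨u, v, hdir, Function.iterate_fixed (F.tie_eq_self hdir ht) 4,
        Or.inr (Or.inl ⟨hv, Or.inl rfl⟩)⟩
    · rw [if_neg hve] at ht
      have hslot : F.Slot u v := ⟨hv, Or.inr ⟨hus, hev, hT.symm, hlt, hve⟩⟩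
      have hpos : 0 < F.d u := Nat.pos_of_ne_zero (by rintro h0; rw [h0] at hev; simp at hev)
      have hp := F.par_spec u hpos
      have h1 := F.tie_of_dir hdir
      rw [ht, Sym2.eq_swap (a := u) (b := F.par u)] at h1
      have hdp : F.Dir (F.par u) u := F.par_dir hpos
      -- The parent of an odd vertex has even depth, so at most one more tie reaches the root. Since
      -- `v` lies outside the guard, neither `u` nor its parent touches `A`.
      by_cases hps : F.σ (F.par u) = F.par u
      swap
      · exact ⟨F.par u, u, hdp, F.tie_iterate_four_of_tie h1
          (F.tie_eq_self hdp (F.target_T hp.1.symm hps)), Or.inr (Or.inl hslot)⟩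
      · have hAp := hAu' _ hp.1.1.1
        have hevp : Even (F.d (F.par u)) := by
          have h7 := F.depth.adj hp.1
          have h8 := hp.2
          have h9 : F.d u = F.d (F.par u) + 1 := by omega
          rw [h9] at hev
          simpa only [Nat.even_add_one, not_not] using hev
        have ht2 := F.target_even hp.1.symm hps hAp hevp
        have h2 := F.tie_of_dir hdp
        rw [ht2] at h2
        obtain ⟨c1, c2, c3⟩ := F.children_spec _ hps hAp
        by_cases hy : u = F.snd (F.par u)
        · rw [if_pos hy] at h2
          refine ⟨F.par u, F.fst (F.par u), Or.inl c2, F.tie_iterate_four_of_tie_tie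
            h1 h2 (F.tie_eq_self (Or.inl c2) ?_),
            Or.inr (Or.inr ⟨hps, by rw [← hy]; exact hslot⟩)⟩
          rw [F.target_even c2.1 hps hAp hevp, if_neg c1]
        · rw [if_neg hy] at h2
          exact ⟨F.par u, u, hdp, F.tie_iterate_four_of_tie h1 h2,
            Or.inr (Or.inl hslot)⟩

/-- A port rooted at the edge from `u₀` to `y₀` belongs to `u₀` on a directed cycle, to the slot of
`y₀`, or, with `u₀` off the cycles, to the slot of its second child. The first and third cases
exclude each other and each slot holds one vertex. This is the bound on occurrences needed for
`exists_identification_nonconstant`. -/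
theorem ncard_ports_le_two [Finite V] (hG : G.IsCubic) {W : Set V} (hW : IsGuard G A W)
    (x : Sym2 V) : {v | F.σ v ≠ v ∧ v ∉ W ∧ F.tie^[4] (F.port v) = x}.ncard ≤ 2 := by
  by_cases hne : ∃ v, F.σ v ≠ v ∧ v ∉ W ∧ F.tie^[4] (F.port v) = x
  swap
  · push Not at hne
    have : {v | F.σ v ≠ v ∧ v ∉ W ∧ F.tie^[4] (F.port v) = x} = ∅ := by
      ext v
      simp only [Set.mem_ofPred_eq, Set.mem_empty_iff_false, iff_false]
      rintro ⟨h1, h2, h3⟩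
      exact hne v h1 h2 h3
    rw [this]; simp
  · obtain ⟨v₁, h1, h2, h3⟩ := hne
    obtain ⟨u₀, y₀, hdir, hx, -⟩ := F.exists_root_port hW h1 h2
    rw [h3] at hx
    have hsub : {v | F.σ v ≠ v ∧ v ∉ W ∧ F.tie^[4] (F.port v) = x} ⊆
        {v | (F.σ u₀ ≠ u₀ ∧ v = u₀) ∨ (F.σ u₀ = u₀ ∧ F.Slot (F.snd u₀) v)} ∪
          {v | F.Slot y₀ v} := by
      rintro v ⟨a1, a2, a3⟩
      obtain ⟨u', y', hdir', hx', h⟩ := F.exists_root_port hW a1 a2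
      rw [a3, hx] at hx'
      obtain ⟨rfl, rfl⟩ := hdir.unique hdir' hx'
      rcases h with h | h | h
      · exact Or.inl (Or.inl h)
      · exact Or.inr h
      · exact Or.inl (Or.inr h)
    refine (Set.ncard_le_ncard hsub (Set.toFinite _)).trans ((Set.ncard_union_le _ _).trans ?_)
    refine add_le_add (b := 1) (d := 1) ?_ ?_
    · rw [Set.ncard_le_one (Set.toFinite _)]
      rintro a (⟨ha, rfl⟩ | ⟨ha, ha'⟩) b (⟨hb, rfl⟩ | ⟨hb, hb'⟩)
      · rfl
      · exact absurd hb ha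
      · exact absurd ha hb
      · exact ha'.unique hG hb'
    · rw [Set.ncard_le_one (Set.toFinite _)]
      intro a ha b hb
      exact Slot.unique hG ha hb

theorem root_port_notMem {W : Set V} (hW : IsGuard G A W) {v : V} (hv : F.σ v ≠ v) (hvW : v ∉ W) :
    F.tie^[4] (F.port v) ∉ A.edgeSet := by
  obtain ⟨u₀, y₀, hdir, hx, -⟩ := F.exists_root_port hW hv hvW
  rw [hx]
  exact hdir.adj.2

/-- A maximal family of disjoint directed paths with three vertices outside `W`. -/
theorem exists_triples [Finite V] (σ : Equiv.Perm V) (W : Set V)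
    (hσ : ∀ v, σ v ≠ v → σ (σ v) ≠ v) :
    ∃ Q : Set V, (∀ q ∈ Q, σ q ≠ q ∧ ∀ i < 3, σ^[i] q ∉ W) ∧
      (∀ q ∈ Q, ∀ q' ∈ Q, ∀ i < 3, ∀ j < 3, σ^[i] q = σ^[j] q' → q = q' ∧ i = j) ∧
      ∀ v, σ v ≠ v → (∀ i < 7, σ^[i] v ∉ W) → ∃ m ≤ 4, σ^[m] v ∈ Q := by
  obtain ⟨Q, ⟨hQ1, hQ2⟩, hmax⟩ := Set.Finite.exists_maximal (s := {Q : Set V |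
      (∀ q ∈ Q, σ q ≠ q ∧ ∀ i < 3, σ^[i] q ∉ W) ∧
      (∀ q ∈ Q, ∀ q' ∈ Q, ∀ i < 3, ∀ j < 3, σ^[i] q = σ^[j] q' → q = q' ∧ i = j)})
    (Set.toFinite _) ⟨∅, by simp⟩
  refine ⟨Q, hQ1, hQ2, fun v hv hvW => ?_⟩
  by_contra! hcon
  have hmoved : ∀ n, σ (σ^[n] v) ≠ σ^[n] v := by
    intro n
    induction n with
    | zero => exact hv
    | succ n ih =>
      rw [Function.iterate_succ_apply']
      exact fun h => ih (σ.injective h)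
  have hinj : ∀ n, Function.Injective (σ^[n]) := fun n => σ.injective.iterate n
  -- The middle three of the seven vertices form a triple that must meet a member of the maximal
  -- family, and any triple meeting it lies within the seven.
  set q₀ := σ^[2] v with hq₀
  have hq0 : ∀ i, σ^[i] q₀ = σ^[i + 2] v := fun i => by
    rw [hq₀, Function.iterate_add_apply]
  have hself : ∀ i < 3, ∀ j < 3, σ^[i] q₀ = σ^[j] q₀ → i = j := by
    have h1 := hmoved 2
    have h2 := hσ _ h1
    rw [← hq₀] at h1 h2
    intro i hi j hj h
    interval_cases i <;> interval_cases j <;> simp only [Function.iterate_succ_apply',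
      Function.iterate_zero, id] at h ⊢
    · exact absurd h.symm h1
    · exact absurd h.symm h2
    · exact absurd h h1
    · exact absurd (σ.injective h.symm) h1
    · exact absurd h h2
    · exact absurd (σ.injective h) h1
  have hcross : ∀ q ∈ Q, ∀ i < 3, ∀ j < 3, σ^[i] q ≠ σ^[j] q₀ := by
    intro q hq i hi j hj h
    apply hcon (j + 2 - i) (by omega)
    rw [hq0, show j + 2 = i + (j + 2 - i) by omega, Function.iterate_add_apply] at h
    rw [← hinj i h]
    exact hq
  have hins : insert q₀ Q ∈ {Q : Set V | (∀ q ∈ Q, σ q ≠ q ∧ ∀ i < 3, σ^[i] q ∉ W) ∧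
      (∀ q ∈ Q, ∀ q' ∈ Q, ∀ i < 3, ∀ j < 3, σ^[i] q = σ^[j] q' → q = q' ∧ i = j)} := by
    refine ⟨?_, ?_⟩
    · rintro q (rfl | hq)
      · exact ⟨hmoved 2, fun i hi => by rw [hq0]; exact hvW _ (by omega)⟩
      · exact hQ1 q hq
    · rintro q (rfl | hq) q' (rfl | hq') i hi j hj h
      · exact ⟨rfl, hself i hi j hj h⟩
      · exact absurd h.symm (hcross q' hq' j hj i hi)
      · exact absurd h (hcross q hq i hi j hj)
      · exact hQ2 q hq q' hq' i hi j hj h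
  have := hmax hins (Set.subset_insert _ _) (Set.mem_insert _ _)
  exact hcon 2 (by omega) this

end Frame

end SimpleGraph

/-! ### Monochromatic walks in colourings obeying the rules. -/

namespace SimpleGraph

variable {V : Type*} {G A : SimpleGraph V}

namespace Frame

variable (F : Frame G A)

/-- The colouring `col` obeys the rules of the frame. -/
def Obeys (col : Sym2 V → Bool) : Prop := ∀ e, F.tie e ≠ e → col e ≠ col (F.tie e)

theorem Obeys.ne {F : Frame G A} {col : Sym2 V → Bool} (h : F.Obeys col) {u y : V}
    (hd : F.Dir u y) (ht : F.target u y ≠ y) : col s(u, y) ≠ col s(u, F.target u y) := by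
  have h1 := F.tie_of_dir hd
  have h2 := h s(u, y) (by rw [h1]; exact fun he => ht (Sym2.congr_right.mp he))
  rwa [h1] at h2

theorem exists_mono_of_ne {G : SimpleGraph V} {col : Sym2 V → Bool} {v a b : V} (ha : G.Adj v a)
    (hb : G.Adj v b) (h : col s(v, a) ≠ col s(v, b)) (c : Bool) : ∃ w, (G.mono col c).Adj v w := by
  by_cases hc : col s(v, a) = c
  · exact ⟨a, ha, hc⟩
  · refine ⟨b, hb, ?_⟩
    revert h hc
    cases col s(v, a) <;> cases col s(v, b) <;> cases c <;> simp

/-- Each kind of vertex has an edge to which a non-trivial rule applies, or two `A`-edges, where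
`hdeg` takes over. At odd depth it is the edge to the neighbour other than the parent and the
selected child. -/
theorem Obeys.bothColours {F : Frame G A} (hG : G.IsCubic) (hA : A ≤ G) {col : Sym2 V → Bool}
    (h : F.Obeys col)
    (hdeg : ∀ v x y, A.Adj v x → A.Adj v y → x ≠ y →
      ∃ x' y', A.Adj v x' ∧ A.Adj v y' ∧ col s(v, x') ≠ col s(v, y')) :
    G.BothColours col := by
  intro u c
  suffices hs : ∃ a b, G.Adj u a ∧ G.Adj u b ∧ col s(u, a) ≠ col s(u, b) by
    obtain ⟨a, b, ha, hb, hne⟩ := hs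
    exact exists_mono_of_ne ha hb hne c
  by_cases hu : F.σ u = u
  swap
  · have hd : F.Dir u (F.σ u) := Or.inr ⟨rfl, hu⟩
    have ht : F.target u (F.σ u) = F.nb u := by unfold target; rw [if_pos rfl]
    have hn := F.nb_spec u
    have := h.ne hd (by rw [ht]; exact hn.2.1)
    rw [ht] at this
    exact ⟨_, _, hd.adj.1, hn.1, this⟩
  by_cases hAu : ∃ w, A.Adj u w
  · obtain ⟨w, hw⟩ := hAu
    by_cases hone : ∀ w, A.Adj u w → w = F.anb u
    · have hanb := F.anb_spec u w hw
      obtain ⟨a, ha, ha1, -⟩ := hG.exists_third u (F.anb u) (F.anb u)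
      obtain ⟨b, hb, hb1, hb2⟩ := hG.exists_third u (F.anb u) a
      have haT : F.T.Adj u a := offCycles_adj_of_fixed hu ⟨ha, fun h' => ha1 (hone _ h')⟩
      have hbT : F.T.Adj u b := offCycles_adj_of_fixed hu ⟨hb, fun h' => hb1 (hone _ h')⟩
      have key : ∀ y, F.T.Adj u y → F.d u < F.d y →
          ∃ a b, G.Adj u a ∧ G.Adj u b ∧ col s(u, a) ≠ col s(u, b) := by
        intro y hy hlt
        have hd : F.Dir u y := Or.inl ⟨hy, hlt⟩
        have ht : F.target u y = F.anb u := by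
          unfold target
          rw [if_neg hy.2.1, if_neg (not_not.mpr hu), if_pos ⟨w, hw⟩, if_pos hone]
        have hne : F.anb u ≠ y := by
          rintro rfl
          exact hd.adj.2 hanb
        have := h.ne hd (by rw [ht]; exact hne)
        rw [ht] at this
        exact ⟨_, _, hy.1.1, hA hanb, this⟩
      rcases F.depth.exists_higher hb2.symm haT hbT with hlt | hlt
      · exact key a haT hlt
      · exact key b hbT hlt
    · push Not at hone
      obtain ⟨x, hx, hne⟩ := hone
      obtain ⟨x', y', hx', hy', hcol⟩ := hdeg u x _ hx (F.anb_spec u w hw) hne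
      exact ⟨x', y', hA hx', hA hy', hcol⟩
  push Not at hAu
  by_cases hev : Even (F.d u)
  · obtain ⟨c1, c2, c3⟩ := F.children_spec u hu hAu
    have ht := F.target_even c3.1 hu hAu hev
    rw [if_pos rfl] at ht
    have := h.ne (Or.inl c3) (by rw [ht]; exact c1)
    rw [ht] at this
    exact ⟨_, _, c3.1.1.1, c2.1.1.1, this⟩
  · have hpos : 0 < F.d u := Nat.pos_of_ne_zero (by rintro h0; rw [h0] at hev; simp at hev)
    have hp := F.par_spec u hpos
    obtain ⟨y, hy, hy1, hy2⟩ := hG.exists_third u (F.par u) (F.ex u)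
    have hyT : F.T.Adj u y := offCycles_adj_of_fixed hu ⟨hy, hAu y⟩
    have hlt : F.d u < F.d y := by
      rcases F.depth.exists_higher hy1 hyT hp.1 with h1 | h1
      · exact h1
      · omega
    have ht := F.target_odd hyT hu hAu hev
    rw [if_neg hy2] at ht
    have := h.ne (Or.inl ⟨hyT, hlt⟩) (by rw [ht]; exact hy1.symm)
    rw [ht] at this
    exact ⟨_, _, hy, hp.1.1.1, this⟩

theorem Obeys.port_ne {F : Frame G A} {col : Sym2 V → Bool} (h : F.Obeys col) {v : V}
    (hv : F.σ v ≠ v) : col s(v, F.σ v) ≠ col (F.port v) := by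
  have ht : F.target v (F.σ v) = F.nb v := by unfold target; rw [if_pos rfl]
  have := h.ne (Or.inr ⟨rfl, hv⟩) (by rw [ht]; exact (F.nb_spec v).2.1)
  rwa [ht] at this

/-- Monochromatic paths do not descend four times in the forest. -/
theorem Obeys.not_descending {F : Frame G A} (hG : G.IsCubic) {col : Sym2 V → Bool}
    (h : F.Obeys col) {c : Bool} (x : ℕ → V)
    (hA : ∀ i ≤ 4, ∀ w, ¬ A.Adj (x i) w)
    (hT : ∀ i < 4, F.T.Adj (x i) (x (i + 1)) ∧ F.d (x i) < F.d (x (i + 1)) ∧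
      col s(x i, x (i + 1)) = c) : False := by
  have hd : ∀ i < 4, F.d (x (i + 1)) = F.d (x i) + 1 := by
    intro i hi
    have h1 := hT i hi
    have h2 := F.depth.adj h1.1
    omega
  -- A vertex on a directed cycle has only one forest edge, so the path cannot pass through it.
  have hfix : ∀ i, 1 ≤ i → i ≤ 3 → F.σ (x i) = x i := by
    intro i h1 h3
    by_contra hne
    have e1 := F.eq_nb_of_T hG hne (hT i (by omega)).1
    have e2 := (hT (i - 1) (by omega)).1.symm
    rw [Nat.sub_add_cancel h1] at e2
    have e3 := F.eq_nb_of_T hG hne e2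
    have e4 := hd i (by omega)
    have e5 := hd (i - 1) (by omega)
    rw [Nat.sub_add_cancel h1] at e5
    rw [e1] at e4
    rw [e3] at e5
    omega
  -- One of `x 1`, `x 2` has odd depth. Its successor on the path is off the directed cycles, so it
  -- is not the selected child, and the rule opposes the edge to it to the parent edge.
  have key : ∀ i, i ≤ 1 → ¬ Even (F.d (x (i + 1))) → False := by
    intro i hi hodd
    have hA1 := hA (i + 1) (by omega)
    have t1 := hT i (by omega)
    have t2 := hT (i + 1) (by omega)
    have hne : x (i + 1 + 1) ≠ F.ex (x (i + 1)) := by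
      intro he
      have h1 := t2.1
      rw [he] at h1
      have h2 := F.ex_mem _ h1
      rw [← he] at h2
      exact h2 (hfix _ (by omega) (by omega))
    have ht := F.target_odd t2.1 (hfix _ (by omega) (by omega)) hA1 hodd
    rw [if_neg hne] at ht
    have hp := F.par_spec (x (i + 1)) (by have := hd i (by omega); omega)
    have hpe : F.par (x (i + 1)) = x i := F.depth.unique hp.1 t1.1.symm hp.2 t1.2.1
    rw [hpe] at ht
    have h1 := h.ne (Or.inl ⟨t2.1, t2.2.1⟩) (by
      rw [ht]
      intro he
      have := hd i (by omega)
      have := hd (i + 1) (by omega)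
      rw [← he] at this
      omega)
    rw [ht, t2.2.2, Sym2.eq_swap, t1.2.2] at h1
    exact h1 rfl
  by_cases hev : Even (F.d (x 1))
  · refine key 1 le_rfl ?_
    rw [hd 1 (by omega)]
    simpa [Nat.even_add_one] using hev
  · exact key 0 (by omega) hev

/-- Monochromatic walks without backtracking that avoid `W` are short. -/
theorem Obeys.exists_mem_guard {F : Frame G A} (hG : G.IsCubic) {col : Sym2 V → Bool}
    (h : F.Obeys col) {W : Set V} (hW : IsGuard G A W)
    (htriple : ∀ v, F.σ v ≠ v → (∀ i < 7, F.σ^[i] v ∉ W) →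
      ∃ i < 7, ∃ j < 7, col (F.port (F.σ^[i] v)) ≠ col (F.port (F.σ^[j] v)))
    {c : Bool} (v : ℕ → V) (hv : ∀ i < 20, (G.mono col c).Adj (v i) (v (i + 1)))
    (hnb : ∀ i < 19, v i ≠ v (i + 2)) : ∃ i ≤ 20, v i ∈ W := by
  by_contra! hvW
  have hA : ∀ i ≤ 20, ∀ w, ¬ A.Adj (v i) w := fun i hi => (hW _ (hvW i hi)).1
  have hport : ∀ w, F.σ w ≠ w → col s(w, F.σ w) = c → col (F.port w) = !c := by
    intro w hw hc
    have h1 := h.port_ne hw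
    rw [hc] at h1
    revert h1
    cases c <;> cases col (F.port w) <;> simp
  have hrun : ∀ w, F.σ w ≠ w → (∀ i < 7, F.σ^[i] w ∉ W ∧
      col s(F.σ^[i] w, F.σ^[i + 1] w) = c) → False := by
    intro w hw hi
    have hmoved : ∀ n, F.σ (F.σ^[n] w) ≠ F.σ^[n] w := by
      intro n
      induction n with
      | zero => exact hw
      | succ n ih =>
        rw [Function.iterate_succ_apply']
        exact fun h => ih (F.σ.injective h)
    obtain ⟨i, h1, j, h2, hne⟩ := htriple w hw fun i h7 => (hi i h7).1
    have e : ∀ i < 7, col (F.port (F.σ^[i] w)) = !c := by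
      intro i h7
      refine hport _ (hmoved i) ?_
      rw [← Function.iterate_succ_apply' F.σ i w]
      exact (hi i h7).2
    rw [e i h1, e j h2] at hne
    exact hne rfl
  have hne : ∀ i < 20, v i ≠ v (i + 1) := fun i hi => (hv i hi).1.ne
  -- A walk leaving along a cycle edge of colour `c` did not arrive by the port, which has the other
  -- colour. So forward cycle steps form an initial segment of the walk; by `hBB`, backward ones
  -- form a final segment.
  have hFF : ∀ i < 19, F.σ (v (i + 1)) = v (i + 2) → F.σ (v i) = v (i + 1) := by
    intro i hi hF
    have hs : F.σ (v (i + 1)) ≠ v (i + 1) := by rw [hF]; exact (hne (i + 1) (by omega)).symm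
    have hp := hport _ hs (by rw [hF]; exact (hv (i + 1) (by omega)).2)
    have h1 := hv i (by omega)
    by_contra hcon
    have h2 := F.eq_nb_of_adj hG hs h1.1.symm (by rw [hF]; exact hnb i hi) (by
      intro h2
      apply hcon
      rw [h2, F.σ.apply_symm_apply])
    rw [port, ← h2, Sym2.eq_swap, h1.2] at hp
    cases c <;> simp at hp
  have hBB : ∀ i < 19, F.σ (v (i + 1)) = v i → F.σ (v (i + 2)) = v (i + 1) := by
    intro i hi hB
    have hs : F.σ (v (i + 1)) ≠ v (i + 1) := by rw [hB]; exact hne i (by omega)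
    have hp := hport _ hs (by rw [hB, Sym2.eq_swap]; exact (hv i (by omega)).2)
    have h1 := hv (i + 1) (by omega)
    by_contra hcon
    have h2 := F.eq_nb_of_adj hG hs h1.1 (by rw [hB]; exact (hnb i hi).symm) (by
      intro h2
      apply hcon
      rw [h2, F.σ.apply_symm_apply])
    rw [port, ← h2, h1.2] at hp
    cases c <;> simp at hp
  -- Seven forward steps in a row would make seven consecutive ports all of colour `!c`, against
  -- `htriple`. Together with `hB13` this leaves forest edges between `v 6` and `v 14`.
  have hF6 : F.σ (v 6) ≠ v 7 := by
    intro h6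
    have hall : ∀ j ≤ 6, F.σ (v (6 - j)) = v (6 - j + 1) := by
      intro j
      induction j with
      | zero => intro _; exact h6
      | succ j ih =>
        intro hj
        have := hFF (6 - (j + 1)) (by omega)
        rw [show 6 - (j + 1) + 1 = 6 - j by omega, show 6 - (j + 1) + 2 = 6 - j + 1 by omega] at this
        rw [show 6 - (j + 1) + 1 = 6 - j by omega]
        exact this (ih (by omega))
    have hit : ∀ i ≤ 7, F.σ^[i] (v 0) = v i := by
      intro i
      induction i with
      | zero => intro _; rfl
      | succ i ih =>
        intro hi
        rw [Function.iterate_succ_apply', ih (by omega)]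
        have := hall (6 - i) (by omega)
        rwa [show 6 - (6 - i) = i by omega] at this
    refine hrun (v 0) ?_ fun i hi => ?_
    · have := hit 1 (by omega)
      rw [Function.iterate_one] at this
      rw [this]
      exact (hne 0 (by omega)).symm
    · rw [hit i (by omega), hit (i + 1) (by omega)]
      exact ⟨hvW i (by omega), (hv i (by omega)).2⟩
  have hB13 : F.σ (v 14) ≠ v 13 := by
    intro h13
    have hall : ∀ j ≤ 6, F.σ (v (13 + j + 1)) = v (13 + j) := by
      intro j
      induction j with
      | zero => intro _; exact h13
      | succ j ih =>
        intro hj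
        exact hBB (13 + j) (by omega) (ih (by omega))
    have hit : ∀ i ≤ 7, F.σ^[i] (v 20) = v (20 - i) := by
      intro i
      induction i with
      | zero => intro _; rfl
      | succ i ih =>
        intro hi
        rw [Function.iterate_succ_apply', ih (by omega)]
        have := hall (6 - i) (by omega)
        rwa [show 13 + (6 - i) + 1 = 20 - i by omega, show 13 + (6 - i) = 20 - (i + 1) by omega]
          at this
    refine hrun (v 20) ?_ fun i hi => ?_
    · have := hit 1 (by omega)
      rw [Function.iterate_one] at this
      rw [this]
      exact hne 19 (by omega)
    · rw [hit i (by omega), hit (i + 1) (by omega)]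
      refine ⟨hvW _ (by omega), ?_⟩
      have := (hv (20 - (i + 1)) (by omega)).2
      rwa [show 20 - (i + 1) + 1 = 20 - i by omega, Sym2.eq_swap] at this
  have hFlt : ∀ j, 6 + j < 20 → F.σ (v (6 + j)) ≠ v (6 + j + 1) := by
    intro j
    induction j with
    | zero => intro _; exact hF6
    | succ j ih =>
      intro hj hcon
      exact ih (by omega) (hFF (6 + j) (by omega) hcon)
  have hBlt : ∀ j ≤ 13, F.σ (v (13 - j + 1)) ≠ v (13 - j) := by
    intro j
    induction j with
    | zero => intro _; exact hB13
    | succ j ih =>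
      intro hj hcon
      apply ih (by omega)
      have := hBB (13 - (j + 1)) (by omega) hcon
      rwa [show 13 - (j + 1) + 2 = 13 - j + 1 by omega, show 13 - (j + 1) + 1 = 13 - j by omega]
        at this
  have hT : ∀ i, 6 ≤ i → i ≤ 13 → F.T.Adj (v i) (v (i + 1)) := by
    intro i h6 h13
    refine ⟨⟨(hv i (by omega)).1, hA i (by omega) _⟩, ?_, ?_⟩
    · have := hFlt (i - 6) (by omega)
      rwa [show 6 + (i - 6) = i by omega] at this
    · have := hBlt (13 - i) (by omega)
      rwa [show 13 - (13 - i) = i by omega] at this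
  have hdown : ∀ i, 6 ≤ i → i + 1 ≤ 13 → F.d (v i) < F.d (v (i + 1)) →
      F.d (v (i + 1)) < F.d (v (i + 2)) := by
    intro i h6 h13 hlt
    rcases F.depth.exists_higher (hnb i (by omega)) (hT i h6 (by omega)).symm
      (hT (i + 1) (by omega) (by omega)) with h1 | h1
    · omega
    · exact h1
  -- In the forest the walk goes up and then down. According to the direction of the step from `v
  -- 9`, it descends from `v 9` to `v 13`, or the reversed walk descends from `v 10` to `v 6`.
  by_cases h9 : F.d (v 9) < F.d (v 10)
  · have h10 := hdown 9 (by omega) (by omega) h9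
    have h11 := hdown 10 (by omega) (by omega) h10
    have h12 := hdown 11 (by omega) (by omega) h11
    refine h.not_descending hG (c := c) (fun i => v (9 + i)) (fun i hi => hA _ (by omega)) ?_
    intro i hi
    refine ⟨hT (9 + i) (by omega) (by omega), ?_, (hv (9 + i) (by omega)).2⟩
    interval_cases i <;> assumption
  · have hup : ∀ i, 6 ≤ i → i + 1 ≤ 13 → F.d (v (i + 2)) < F.d (v (i + 1)) →
        F.d (v (i + 1)) < F.d (v i) := by
      intro i h6 h13 hlt
      have h1 := F.depth.adj (hT i h6 (by omega))
      by_contra hcon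
      have := hdown i h6 h13 (by omega)
      omega
    have h9' : F.d (v 10) < F.d (v 9) := by
      have h1 : F.d (v 9) = F.d (v 10) + 1 ∨ F.d (v 10) = F.d (v 9) + 1 :=
        F.depth.adj (hT 9 (by omega) (by omega))
      omega
    have h8 := hup 8 (by omega) (by omega) h9'
    have h7 := hup 7 (by omega) (by omega) h8
    have h6 := hup 6 (by omega) (by omega) h7
    refine h.not_descending hG (c := c) (fun i => v (10 - i)) (fun i hi => hA _ (by omega)) ?_
    intro i hi
    have e : 10 - i = 10 - (i + 1) + 1 := by omega
    refine ⟨?_, ?_, ?_⟩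
    · have := (hT (10 - (i + 1)) (by omega) (by omega)).symm
      rwa [← e] at this
    · interval_cases i <;> assumption
    · have := (hv (10 - (i + 1)) (by omega)).2
      rwa [← e, Sym2.eq_swap] at this

end Frame

end SimpleGraph

/-! ### The random colouring before repair. -/

namespace SimpleGraph

variable {V : Type*} {G A : SimpleGraph V}

namespace Frame

variable (F : Frame G A)

theorem tie_eq_or (e : Sym2 V) : F.tie e = e ∨ ∃ u y z, F.Dir u y ∧ e = s(u, y) ∧
    F.tie e = s(u, z) := by
  by_cases h : ∃ u y, F.Dir u y ∧ e = s(u, y)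
  · obtain ⟨u, y, hd, rfl⟩ := h
    exact Or.inr ⟨u, y, _, hd, rfl, F.tie_of_dir hd⟩
  · push Not at h
    exact Or.inl (F.tie_of_not_dir h)

/-- Tied edges share an end: besides `x` itself there are at most three edges at each end of `x`. -/
theorem ncard_tie_fibre_le [Finite V] (hG : G.IsCubic) (x : Sym2 V) :
    {e | F.tie e = x}.ncard ≤ 7 := by
  induction x with
  | _ a b =>
    have hsub : {e | F.tie e = s(a, b)} ⊆
        {s(a, b)} ∪ ((fun w => s(a, w)) '' G.neighborSet a ∪ (fun w => s(b, w)) '' G.neighborSet b) := by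
      intro e he
      have he : F.tie e = s(a, b) := he
      rcases F.tie_eq_or e with h | ⟨u, y, z, hd, rfl, h⟩
      · left; rw [← he, h]; rfl
      · right
        rw [he] at h
        rcases Sym2.eq_iff.mp h with ⟨rfl, rfl⟩ | ⟨rfl, rfl⟩
        · exact Or.inl ⟨y, hd.adj.1, rfl⟩
        · exact Or.inr ⟨y, hd.adj.1, rfl⟩
    refine (Set.ncard_le_ncard hsub (Set.toFinite _)).trans ((Set.ncard_union_le _ _).trans ?_)
    rw [Set.ncard_singleton]
    have h1 := Set.ncard_union_le ((fun w => s(a, w)) '' G.neighborSet a)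
      ((fun w => s(b, w)) '' G.neighborSet b)
    have h2 := Set.ncard_image_le (f := fun w => s(a, w)) (Set.toFinite (G.neighborSet a))
    have h3 := Set.ncard_image_le (f := fun w => s(b, w)) (Set.toFinite (G.neighborSet b))
    rw [hG] at h2 h3
    omega

end Frame

/-- The colouring given by the random bits `ω`, where the edge `e` uses the bit of `β e`. -/
def bitColouring (β : Sym2 V → Sym2 V) (k : Sym2 V → Bool) (ω : Sym2 V → Bool) : Sym2 V → Bool :=
  fun e => xor (k e) (ω (β e))

/-- The existence of a random colouring of a cubic graph, extending a random colouring of `A`, in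
which every bit is used by few edges, and every monochromatic path avoiding the surroundings of
`A` is short. -/
theorem exists_bitColouring [Finite V] (hG : G.IsCubic) (hA : A ≤ G) (a : Sym2 V → Bool)
    (e₀ : Sym2 V → Sym2 V)
    (hdeg : ∀ v x y, A.Adj v x → A.Adj v y → x ≠ y →
      ∃ x' y', A.Adj v x' ∧ A.Adj v y' ∧ a s(v, x') ≠ a s(v, y') ∧ e₀ s(v, x') = e₀ s(v, y'))
    {W : Set V} (hW : IsGuard G A W) (M D : ℕ) (hM : ∀ b, {e ∈ A.edgeSet | e₀ e = b}.ncard ≤ M)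
    (hD : 2 ^ D * Nat.card V < 3 ^ D) :
    ∃ (β : Sym2 V → Sym2 V) (k : Sym2 V → Bool),
      (∀ e ∈ A.edgeSet, β e = e₀ e ∧ k e = a e) ∧
      (∀ b, {e | β e = b}.ncard ≤ (M + (2 * D + 1)) * 7 ^ 4) ∧
      ∀ ω, G.BothColours (bitColouring β k ω) ∧
        ∀ (c : Bool) (v : ℕ → V),
          (∀ i < 20, (G.mono (bitColouring β k ω) c).Adj (v i) (v (i + 1))) →
          (∀ i < 19, v i ≠ v (i + 2)) → ∃ i ≤ 20, v i ∈ W := by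
  classical
  obtain ⟨F⟩ := nonempty_frame hG A
  obtain ⟨k, hk0, hk1, hfix⟩ := exists_parity F.tie F.rank 4 F.rank_le
    (fun e => F.rank_tie_lt) (fun _ => true)
  obtain ⟨Q, hQ1, hQ2, hQ3⟩ := Frame.exists_triples F.σ W (fun v hv => (F.cyc v hv).2)
  have hmoved : ∀ {v}, F.σ v ≠ v → ∀ n, F.σ (F.σ^[n] v) ≠ F.σ^[n] v := by
    intro v hv n
    induction n with
    | zero => exact hv
    | succ n ih =>
      rw [Function.iterate_succ_apply']
      exact fun h => ih (F.σ.injective h)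
  let pos : Q → Fin 3 → Sym2 V := fun q i => F.tie^[4] (F.port (F.σ^[i] q.1))
  obtain ⟨ρ, κ, hρ, hnae⟩ := exists_identification_nonconstant pos
    (fun q i => k (F.port (F.σ^[i] q.1))) (fun x => by
      refine le_trans (Set.ncard_le_ncard_of_injOn (fun p => F.σ^[p.2] p.1.1) ?_ ?_ (Set.toFinite _))
        (F.ncard_ports_le_two hG hW x)
      · rintro ⟨q, i⟩ hp
        exact ⟨hmoved (hQ1 q q.2).1 i, (hQ1 q q.2).2 i i.2, hp⟩
      · rintro ⟨q, i⟩ - ⟨q', i'⟩ - h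
        obtain ⟨h1, h2⟩ := hQ2 q q.2 q' q'.2 i i.2 i' i'.2 h
        exact Prod.ext (Subtype.ext h1) (Fin.ext h2)) D
    (lt_of_le_of_lt (Nat.mul_le_mul_left _ (Finite.card_subtype_le _)) hD)
  set r : Sym2 V → Sym2 V := fun e => F.tie^[4] e with hr
  -- An edge takes the bit of its root: that of the piece if the root is in `A`, otherwise that of
  -- the class of identified roots. In `k'` the parity along the chain of ties is added to the sign
  -- of the root.
  let β : Sym2 V → Sym2 V := fun e => if r e ∈ A.edgeSet then e₀ (r e) else ρ (r e)
  let k' : Sym2 V → Bool := fun e => xor (k e) (if r e ∈ A.edgeSet then a (r e) else κ (r e))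
  have hrA : ∀ e ∈ A.edgeSet, r e = e := fun e he =>
    Function.iterate_fixed (F.tie_of_mem_edgeSet he) 4
  have hAedge : ∀ e ∈ A.edgeSet, β e = e₀ e ∧ k' e = a e := by
    intro e he
    simp only [β, k', hrA e he, if_pos he, hk0 e (F.tie_of_mem_edgeSet he), Bool.false_xor,
      and_self]
  refine ⟨β, k', hAedge, fun b => ?_, fun ω => ?_⟩
  · have := Fintype.ofFinite V
    have hsub : {e | β e = b} ⊆
        ⋃ x ∈ ({x ∈ A.edgeSet | e₀ x = b} ∪ {x | ρ x = b} : Set (Sym2 V)), {e | r e = x} := by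
      intro e he
      have he : (if r e ∈ A.edgeSet then e₀ (r e) else ρ (r e)) = b := he
      simp only [Set.mem_iUnion]
      refine ⟨r e, ?_, rfl⟩
      split_ifs at he with h
      · exact Or.inl ⟨h, he⟩
      · exact Or.inr he
    refine (Set.ncard_le_ncard hsub (Set.toFinite _)).trans ?_
    have hcard := Set.ncard_union_le {x ∈ A.edgeSet | e₀ x = b} {x | ρ x = b}
    have h1 := hM b
    have h2 := hρ b
    set Z := ({x ∈ A.edgeSet | e₀ x = b} ∪ {x | ρ x = b} : Set (Sym2 V))
    have e2 : (⋃ x ∈ Z, {e | r e = x}).toFinset =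
        Z.toFinset.biUnion fun x => {e | r e = x}.toFinset := by
      ext e; simp
    rw [Set.ncard_eq_toFinset_card', e2]
    refine (Finset.card_biUnion_le_card_mul _ _ (7 ^ 4) fun x _ => ?_).trans
      (Nat.mul_le_mul_right _ ?_)
    · rw [← Set.ncard_eq_toFinset_card']
      exact ncard_iterate_fibre_le F.tie 7 (F.ncard_tie_fibre_le hG) 4 x
    · rw [← Set.ncard_eq_toFinset_card']
      omega
  · have hob : F.Obeys (bitColouring β k' ω) := by
      intro e he
      have hre : r e = r (F.tie e) := by
        exact ((hfix e).symm.trans (Function.iterate_succ_apply' F.tie 4 e).symm).trans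
          (Function.iterate_succ_apply F.tie 4 e)
      have h1 := hk1 e he
      simp only [bitColouring, β, k', hre, h1]
      cases k (F.tie e) <;>
        cases (if r (F.tie e) ∈ A.edgeSet then a (r (F.tie e)) else κ (r (F.tie e))) <;>
        cases (ω (if r (F.tie e) ∈ A.edgeSet then e₀ (r (F.tie e)) else ρ (r (F.tie e)))) <;>
        simp
    refine ⟨hob.bothColours hG hA fun v x y hx hy hxy => ?_, fun c v hv hnb => ?_⟩
    · obtain ⟨x', y', hx', hy', h1, h2⟩ := hdeg v x y hx hy hxy
      refine ⟨x', y', hx', hy', ?_⟩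
      obtain ⟨e1, e2⟩ := hAedge s(v, x') hx'
      obtain ⟨e3, e4⟩ := hAedge s(v, y') hy'
      simp only [bitColouring, e1, e2, e3, e4, h2]
      revert h1
      cases a s(v, x') <;> cases a s(v, y') <;> cases ω (e₀ s(v, y')) <;> simp
    · refine hob.exists_mem_guard hG hW ?_ v hv hnb
      intro v hv hvW
      obtain ⟨m, hm, hmQ⟩ := hQ3 v hv hvW
      obtain ⟨i, j, hij⟩ := hnae ω ⟨F.σ^[m] v, hmQ⟩
      have e : ∀ i : Fin 3, bitColouring β k' ω (F.port (F.σ^[i + m] v)) =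
          xor (k (F.port (F.σ^[i] (F.σ^[m] v))))
            (xor (κ (pos ⟨F.σ^[m] v, hmQ⟩ i)) (ω (ρ (pos ⟨F.σ^[m] v, hmQ⟩ i)))) := by
        intro i
        -- Ports outside the guard have roots outside `A`, so their bits come from `ρ` and `κ` and
        -- non-constancy applies.
        have h1 := F.root_port_notMem hW (hmoved (hmoved hv m) i) ((hQ1 _ hmQ).2 i i.2)
        simp only [bitColouring, β, k', hr, pos, Function.iterate_add_apply]
        rw [if_neg h1, if_neg h1, Bool.xor_assoc]
      refine ⟨i + m, by omega, j + m, by omega, ?_⟩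
      rw [e i, e j]
      exact hij

end SimpleGraph

/-! ### Pieces, and the confinement of monochromatic paths and cycles. -/

namespace SimpleGraph

variable {V : Type*} {G : SimpleGraph V}

/-- The vertices at distance at most `r` from `S`. -/
def nearSet (G : SimpleGraph V) (S : Set V) (r : ℕ) : Set V :=
  {v | ∃ x ∈ S, ∃ p : G.Walk x v, p.length ≤ r}

theorem nearSet_mono {S : Set V} {r r' : ℕ} (h : r ≤ r') : G.nearSet S r ⊆ G.nearSet S r' := by
  rintro v ⟨x, hx, p, hp⟩
  exact ⟨x, hx, p, hp.trans h⟩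

theorem subset_nearSet (S : Set V) (r : ℕ) : S ⊆ G.nearSet S r :=
  fun x hx => ⟨x, hx, Walk.nil, by simp⟩

theorem mem_nearSet_of_walk {S : Set V} {r : ℕ} {v w : V} (hv : v ∈ G.nearSet S r)
    (q : G.Walk v w) : w ∈ G.nearSet S (r + q.length) := by
  obtain ⟨x, hx, p, hp⟩ := hv
  exact ⟨x, hx, p.append q, by rw [Walk.length_append]; omega⟩

theorem mem_nearSet_of_adj {S : Set V} {r : ℕ} {v w : V} (hv : v ∈ G.nearSet S r)
    (h : G.Adj v w) : w ∈ G.nearSet S (r + 1) := by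
  simpa using mem_nearSet_of_walk hv h.toWalk

theorem ncard_biUnion_le [Finite V] {α : Type*} [Finite α] (S : Set α) (f : α → Set V) (n : ℕ)
    (h : ∀ x ∈ S, (f x).ncard ≤ n) : (⋃ x ∈ S, f x).ncard ≤ S.ncard * n := by
  classical
  have := Fintype.ofFinite V
  have := Fintype.ofFinite α
  have e : (⋃ x ∈ S, f x).toFinset = S.toFinset.biUnion fun x => (f x).toFinset := by
    ext e; simp
  rw [Set.ncard_eq_toFinset_card', e, Set.ncard_eq_toFinset_card' S]
  refine Finset.card_biUnion_le_card_mul _ _ n fun x hx => ?_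
  rw [← Set.ncard_eq_toFinset_card']
  exact h x (by simpa using hx)

theorem IsCubic.ncard_nearSet_le [Finite V] (hG : G.IsCubic) (S : Set V) (r : ℕ) :
    (G.nearSet S r).ncard ≤ S.ncard * 4 ^ r := by
  induction r with
  | zero =>
    have : G.nearSet S 0 ⊆ S := by
      rintro v ⟨x, hx, p, hp⟩
      rwa [← Walk.eq_of_length_eq_zero (p := p) (by omega)]
    simpa using Set.ncard_le_ncard this (Set.toFinite _)
  | succ r ih =>
    have hsub : G.nearSet S (r + 1) ⊆
        G.nearSet S r ∪ ⋃ v ∈ G.nearSet S r, G.neighborSet v := by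
      rintro v ⟨x, hx, p, hp⟩
      by_cases h0 : p.Nil
      · left
        exact ⟨x, hx, p, by rw [Walk.length_eq_zero_iff.mpr h0]; omega⟩
      · right
        simp only [Set.mem_iUnion]
        have hl : p.dropLast.length = p.length - 1 := by simp
        exact ⟨p.penultimate, ⟨x, hx, p.dropLast, by omega⟩, p.adj_penultimate h0⟩
    have h1 := ncard_biUnion_le (G.nearSet S r) (fun v => G.neighborSet v) 3 fun v _ => (hG v).le
    have h2 := (Set.ncard_le_ncard hsub (Set.toFinite _)).trans (Set.ncard_union_le _ _)
    rw [pow_succ, ← mul_assoc]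
    omega

/-- Pairwise distant pieces of a partial colouring of the graph `G`. -/
structure Pieces (G : SimpleGraph V) (ι : Type*) where
  D : ι → Set V
  A : SimpleGraph V
  /-- The colours of the edges in `A`. -/
  a : Sym2 V → Bool
  le : A ≤ G
  adj_mem : ∀ {u v}, A.Adj u v → ∃ i, u ∈ D i ∧ v ∈ D i
  exists_adj : ∀ i, ∃ u v, u ∈ D i ∧ v ∈ D i ∧ A.Adj u v
  deg : ∀ v x y, A.Adj v x → A.Adj v y → x ≠ y →
    ∃ x' y', A.Adj v x' ∧ A.Adj v y' ∧ a s(v, x') ≠ a s(v, y')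
  sep : ∀ {i j x y}, x ∈ D i → y ∈ D j → ∀ p : G.Walk x y, p.length ≤ 100 → i = j
  cyc : ∀ i u (p : G.Walk u u), p.IsCycle → (∀ x ∈ p.support, x ∈ D i) →
    (∀ e ∈ p.edges, ∀ e' ∈ p.edges, e ∈ A.edgeSet → e' ∈ A.edgeSet → a e = a e') →
    ∃ x y z, x ≠ z ∧ s(x, y) ∈ p.edges ∧ s(y, z) ∈ p.edges ∧ ¬ A.Adj x y ∧ ¬ A.Adj y z

/-- Non-backtracking monochromatic walks with twenty edges meet `W`. -/
def Meets (G : SimpleGraph V) (col : Sym2 V → Bool) (W : Set V) : Prop :=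
  ∀ (c : Bool) (v : ℕ → V), (∀ i < 20, (G.mono col c).Adj (v i) (v (i + 1))) →
    (∀ i < 19, v i ≠ v (i + 2)) → ∃ i ≤ 20, v i ∈ W

theorem Meets.congr {col col' : Sym2 V → Bool} {W : Set V} (h : G.Meets col W)
    (hc : ∀ x y, x ∉ W → y ∉ W → col' s(x, y) = col s(x, y)) : G.Meets col' W := by
  intro c v hv hnb
  by_contra! hW
  obtain ⟨i, hi, hiW⟩ := h c v (fun i hi => ⟨(hv i hi).1, by
    rw [← hc _ _ (hW i (by omega)) (hW (i + 1) (by omega))]; exact (hv i hi).2⟩) hnb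
  exact hW i hi hiW

/-- Running round the cycle for ever gives windows of 20 steps even when the cycle is shorter than
that. -/
theorem Walk.IsCycle.exists_seq {F : SimpleGraph V} {u : V} {p : F.Walk u u} (hp : p.IsCycle) :
    ∃ v : ℕ → V, (∀ k, F.Adj (v k) (v (k + 1))) ∧ (∀ k, v k ≠ v (k + 2)) ∧
      ∀ x, x ∈ p.support ↔ ∃ k, v k = x := by
  have h3 := hp.three_le_length
  have hlt : ∀ k, k % p.length < p.length := fun k => Nat.mod_lt _ (by omega)
  refine ⟨fun k => p.getVert (k % p.length), fun k => ?_, fun k h => ?_, fun x => ⟨fun hx => ?_, ?_⟩⟩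
  · change F.Adj (p.getVert (k % p.length)) (p.getVert ((k + 1) % p.length))
    have hadj := p.adj_getVert_succ (hlt k)
    by_cases h : k % p.length + 1 < p.length
    · rwa [show (k + 1) % p.length = k % p.length + 1 by
        rw [← Nat.mod_add_mod, Nat.mod_eq_of_lt h]]
    · have h' : k % p.length + 1 = p.length := by have := hlt k; omega
      rw [show (k + 1) % p.length = 0 by rw [← Nat.mod_add_mod, h', Nat.mod_self],
        Walk.getVert_zero]
      rwa [h', Walk.getVert_length] at hadj
  · have h1 := hp.getVert_injOn' (by have := hlt k; simp; omega)
      (by have := hlt (k + 2); simp; omega) h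
    have h2 : (k + 2) % p.length = (k % p.length + 2) % p.length := (Nat.mod_add_mod _ _ _).symm
    rw [h2] at h1
    have h4 := hlt k
    generalize k % p.length = j at h1 h4
    by_cases h' : j + 2 < p.length
    · rw [Nat.mod_eq_of_lt h'] at h1; omega
    · rw [Nat.mod_eq_sub_mod (by omega), Nat.mod_eq_of_lt (by omega)] at h1; omega
  · obtain ⟨i, rfl, hi⟩ := Walk.mem_support_iff_exists_getVert.mp hx
    rcases hi.lt_or_eq with hi | rfl
    · exact ⟨i, congrArg p.getVert (Nat.mod_eq_of_lt hi)⟩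
    · exact ⟨0, by simp⟩
  · rintro ⟨k, rfl⟩
    exact Walk.getVert_mem_support _ _

theorem exists_walk_of_seq {v : ℕ → V} {k l : ℕ} (hkl : k ≤ l)
    (h : ∀ m, k ≤ m → m < l → G.Adj (v m) (v (m + 1))) :
    ∃ p : G.Walk (v k) (v l), p.length = l - k := by
  induction l, hkl using Nat.le_induction with
  | base => exact ⟨Walk.nil, by simp⟩
  | succ l hkl ih =>
    obtain ⟨p, hp⟩ := ih fun m h1 h2 => h m h1 (by omega)
    exact ⟨p.concat (h l hkl (by omega)), by rw [Walk.length_concat, hp]; omega⟩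

namespace Pieces

variable {ι : Type*} (P : Pieces G ι)

/-- The surroundings of a piece. -/
def zone (i : ι) : Set V := G.nearSet (P.D i) 2

/-- A larger neighbourhood of a piece. -/
def region (i : ι) : Set V := G.nearSet (P.D i) 22

/-- The union of the zones. -/
def guard : Set V := ⋃ i, P.zone i

/-- The edges that may be changed near a piece. -/
def free (i : ι) : Set (Sym2 V) :=
  {e | e ∈ G.edgeSet ∧ e ∉ P.A.edgeSet ∧ ∃ x ∈ e, x ∈ P.zone i}

theorem zone_subset_region (i : ι) : P.zone i ⊆ P.region i := nearSet_mono (by omega)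

theorem eq_of_near {i j : ι} {r r' : ℕ} {v w : V} (hv : v ∈ G.nearSet (P.D i) r)
    (hw : w ∈ G.nearSet (P.D j) r') (q : G.Walk v w) (h : r + r' + q.length ≤ 100) : i = j := by
  obtain ⟨x, hx, p, hp⟩ := hv
  obtain ⟨y, hy, p', hp'⟩ := hw
  refine P.sep hx hy (p.append (q.append p'.reverse)) ?_
  rw [Walk.length_append, Walk.length_append, Walk.length_reverse]
  omega

theorem eq_of_mem {i j : ι} {r r' : ℕ} {v : V} (hv : v ∈ G.nearSet (P.D i) r)
    (hw : v ∈ G.nearSet (P.D j) r') (h : r + r' ≤ 100) : i = j :=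
  P.eq_of_near hv hw Walk.nil (by simpa using h)

theorem isGuard : IsGuard G P.A P.guard := by
  have key : ∀ v r, r ≤ 2 → (∀ i, v ∉ G.nearSet (P.D i) r) → ∀ w, ¬ P.A.Adj v w := by
    intro v r _ h w hw
    obtain ⟨i, hi, -⟩ := P.adj_mem hw
    exact h i (subset_nearSet _ _ hi)
  intro v hv
  have hv2 : ∀ i, v ∉ G.nearSet (P.D i) 2 := fun i hi => hv (Set.mem_iUnion.mpr ⟨i, hi⟩)
  refine ⟨key v 2 le_rfl hv2, fun u hu => ?_⟩
  have hu1 : ∀ i, u ∉ G.nearSet (P.D i) 1 := fun i hi => hv2 i (mem_nearSet_of_adj hi hu.symm)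
  refine ⟨key u 1 (by omega) hu1, fun p hp => ?_⟩
  exact key p 0 (by omega) fun i hi => hu1 i (mem_nearSet_of_adj hi hp.symm)

/-- One step cannot lead from one region to another, because the pieces are more than 100 apart. -/
theorem exists_region_of_seq {v : ℕ → V} {N : ℕ} (hv : ∀ k < N, G.Adj (v k) (v (k + 1)))
    (h : ∀ k ≤ N, ∃ i, v k ∈ P.region i) : ∃ i, ∀ k ≤ N, v k ∈ P.region i := by
  obtain ⟨i, hi⟩ := h 0 (by omega)
  refine ⟨i, fun k => ?_⟩
  induction k with
  | zero => exact fun _ => hi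
  | succ k ih =>
    intro hk
    obtain ⟨j, hj⟩ := h (k + 1) hk
    obtain rfl := P.eq_of_near (ih (by omega)) hj (hv k (by omega)).toWalk (by simp)
    exact hj

/-- All vertices of a long non-backtracking monochromatic walk are close to the same piece. -/
theorem exists_region {col : Sym2 V → Bool} (hcol : G.Meets col P.guard) {c : Bool} {v : ℕ → V}
    {N : ℕ} (hN : 20 ≤ N) (hv : ∀ k < N, (G.mono col c).Adj (v k) (v (k + 1)))
    (hnb : ∀ k, k + 1 < N → v k ≠ v (k + 2)) :
    ∃ i, (∀ k ≤ N, v k ∈ P.region i) ∧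
      ∀ k, k + 20 ≤ N → ∃ m, k ≤ m ∧ m ≤ k + 20 ∧ v m ∈ P.zone i := by
  have hwin : ∀ k, k + 20 ≤ N → ∃ m, k ≤ m ∧ m ≤ k + 20 ∧ v m ∈ P.guard := by
    intro k hk
    obtain ⟨i, hi, hiW⟩ := hcol c (fun i => v (k + i)) (fun i hi => hv _ (by omega))
      (fun i hi => hnb (k + i) (by omega))
    exact ⟨k + i, by omega, by omega, hiW⟩
  have hG : ∀ k < N, G.Adj (v k) (v (k + 1)) := fun k hk => (hv k hk).1
  -- Each vertex lies in a window of 20 steps meeting a zone, hence within 20 + 2 of a piece; this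
  -- is the radius of the regions.
  obtain ⟨i, hi⟩ := P.exists_region_of_seq hG (by
    intro k hk
    obtain ⟨k₀, h1, h2, h3⟩ : ∃ k₀, k₀ ≤ k ∧ k ≤ k₀ + 20 ∧ k₀ + 20 ≤ N :=
      ⟨min k (N - 20), by omega, by omega, by omega⟩
    obtain ⟨m, m1, m2, hm⟩ := hwin k₀ h3
    obtain ⟨i, hi⟩ := Set.mem_iUnion.mp hm
    refine ⟨i, ?_⟩
    rcases le_total m k with h | h
    · obtain ⟨p, hp⟩ := exists_walk_of_seq h (fun j _ _ => hG j (by omega))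
      exact nearSet_mono (by omega) (mem_nearSet_of_walk hi p)
    · obtain ⟨p, hp⟩ := exists_walk_of_seq h (fun j _ _ => hG j (by omega))
      exact nearSet_mono (by rw [Walk.length_reverse]; omega) (mem_nearSet_of_walk hi p.reverse))
  refine ⟨i, hi, fun k hk => ?_⟩
  obtain ⟨m, m1, m2, hm⟩ := hwin k hk
  obtain ⟨j, hj⟩ := Set.mem_iUnion.mp hm
  obtain rfl := P.eq_of_mem (hi m (by omega)) hj (by omega)
  exact ⟨m, m1, m2, hj⟩

theorem exists_region_of_isCycle {col : Sym2 V → Bool} (hcol : G.Meets col P.guard) {c : Bool}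
    {u : V} {p : (G.mono col c).Walk u u} (hp : p.IsCycle) :
    ∃ i, (∀ x ∈ p.support, x ∈ P.region i) ∧ ∃ x ∈ p.support, x ∈ P.zone i := by
  obtain ⟨v, hv, hnb, hs⟩ := hp.exists_seq
  have key := fun N (hN : 20 ≤ N) =>
    P.exists_region hcol hN (fun k _ => hv k) (fun k _ => hnb k)
  obtain ⟨i, hi, hz⟩ := key 20 le_rfl
  obtain ⟨m, -, -, hm⟩ := hz 0 (by omega)
  refine ⟨i, fun x hx => ?_, v m, (hs _).2 ⟨m, rfl⟩, hm⟩
  obtain ⟨k, rfl⟩ := (hs x).1 hx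
  obtain ⟨j, hj, -⟩ := key (20 + k) (by omega)
  obtain rfl := P.eq_of_mem (hi 0 (by omega)) (hj 0 (by omega)) (by omega)
  exact hj k (by omega)

theorem mem_free {i : ι} {x y : V} (h : G.Adj x y) (hx : x ∈ P.zone i) (hD : x ∉ P.D i) :
    s(x, y) ∈ P.free i := by
  refine ⟨h, fun hA => hD ?_, x, by simp, hx⟩
  obtain ⟨j, hj, -⟩ := P.adj_mem (u := x) (v := y) hA
  obtain rfl := P.eq_of_mem hx (subset_nearSet (G := G) _ 0 hj) (by omega)
  exact hj

/-- A monochromatic cycle near a piece has two consecutive edges that may be changed. -/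
theorem exists_two_free {col : Sym2 V → Bool} {i : ι} {b : Bool}
    (hcol : ∀ x y, x ∈ P.D i → P.A.Adj x y → col s(x, y) = xor (P.a s(x, y)) b) {c : Bool} {u : V}
    {p : (G.mono col c).Walk u u} (hp : p.IsCycle) (hz : ∃ x ∈ p.support, x ∈ P.zone i) :
    ∃ y x₁ x₂, x₁ ≠ x₂ ∧ s(y, x₁) ∈ p.edges ∧ s(y, x₂) ∈ p.edges ∧
      s(y, x₁) ∈ P.free i ∧ s(y, x₂) ∈ P.free i := by
  classical
  -- At a vertex of the zone outside the piece both cycle edges are free. A cycle inside the piece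
  -- is monochromatic for `P.a` up to the bit `b`, so `P.cyc` supplies two consecutive edges outside
  -- `P.A`. A cycle that is partly inside crosses the boundary at a vertex of the first kind.
  suffices hs : (∃ y ∈ p.support, y ∈ P.zone i ∧ y ∉ P.D i) ∨ ∀ x ∈ p.support, x ∈ P.D i by
    rcases hs with ⟨y, hy, hyz, hyD⟩ | hall
    · obtain ⟨x₁, x₂, hne, h1, h2⟩ := hp.exists_two_edges hy
      exact ⟨y, x₁, x₂, hne, h1, h2, P.mem_free (p.adj_of_mem_edges h1).1 hyz hyD,
        P.mem_free (p.adj_of_mem_edges h2).1 hyz hyD⟩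
    · obtain ⟨x, y, z, hne, h1, h2, n1, n2⟩ := P.cyc i u (p.mapLe (mono_le G col c))
        ((Walk.isCycle_mapLe _).mpr hp) (by simpa using hall) (by
          have key : ∀ e ∈ p.edges, e ∈ P.A.edgeSet → xor (P.a e) b = c := by
            intro e he heA
            induction e with
            | _ x y =>
              rw [← hcol x y (hall x (p.fst_mem_support_of_mem_edges he)) heA]
              exact (p.adj_of_mem_edges he).2
          intro e he e' he' heA heA'
          rw [Walk.edges_mapLe_eq_edges] at he he'
          have h1 := key e he heA
          have h2 := key e' he' heA'
          rw [← h2] at h1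
          simpa using h1)
      rw [Walk.edges_mapLe_eq_edges] at h1 h2
      have hy := hall y (p.fst_mem_support_of_mem_edges h2)
      have hyz : y ∈ P.zone i := subset_nearSet _ _ hy
      refine ⟨y, x, z, hne, by rwa [Sym2.eq_swap], h2, ?_, ?_⟩
      · exact ⟨(p.adj_of_mem_edges h1).1.symm, fun h => n1 h.symm, y, by simp, hyz⟩
      · exact ⟨(p.adj_of_mem_edges h2).1, n2, y, by simp, hyz⟩
  by_cases hout : ∀ x ∈ p.support, x ∈ P.D i
  · exact Or.inr hout
  left
  push Not at hout
  obtain ⟨w, hw, hwD⟩ := hout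
  by_cases hin : ∃ x ∈ p.support, x ∈ P.D i
  · obtain ⟨x, hx, hxD⟩ := hin
    have hw' : w ∈ (p.rotate x hx).support := by simpa using hw
    obtain ⟨d, hd, hd1, hd2⟩ :=
      ((p.rotate x hx).takeUntil w hw').exists_boundary_dart (P.D i) hxD hwD
    have hd3 : d.snd ∈ (p.rotate x hx).support :=
      Walk.support_takeUntil_subset_support _ _ (Walk.dart_snd_mem_support_of_mem_darts _ hd)
    refine ⟨d.snd, by simpa using hd3, ?_, hd2⟩
    exact nearSet_mono (by omega)
      (mem_nearSet_of_adj (subset_nearSet (G := G) _ 0 hd1) d.adj.1)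
  · push Not at hin
    obtain ⟨x, hx, hxz⟩ := hz
    exact ⟨x, hx, hxz, hin x hx⟩

end Pieces

end SimpleGraph

/-! ### Local repair commuting with the exchange of colours. -/

namespace SimpleGraph

variable {V : Type*} {G : SimpleGraph V}

namespace Pieces

variable {ι : Type*} (P : Pieces G ι)

/-- The edges meeting the region of a piece. -/
def edgesAt (i : ι) : Set (Sym2 V) := {e | e ∈ G.edgeSet ∧ ∃ x ∈ e, x ∈ P.region i}

/-- Both colours are present at all vertices of the region of a piece, and there is no
monochromatic cycle in this region. -/
def LocallyGood (i : ι) (col : Sym2 V → Bool) : Prop :=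
  (∀ v ∈ P.region i, ∀ c, ∃ w, (G.mono col c).Adj v w) ∧
    ∀ (c : Bool) (u : V) (p : (G.mono col c).Walk u u), p.IsCycle →
      ¬ ∀ x ∈ p.support, x ∈ P.region i

/-- This locality allows the repairs at different pieces to be carried out independently. -/
theorem LocallyGood.congr {P : Pieces G ι} {i : ι} {col col' : Sym2 V → Bool}
    (h : P.LocallyGood i col) (hc : ∀ e ∈ P.edgesAt i, col e = col' e) :
    P.LocallyGood i col' := by
  refine ⟨fun v hv c => ?_, fun c u p hp hX => ?_⟩
  · obtain ⟨w, hw⟩ := h.1 v hv c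
    exact ⟨w, hw.1, by rw [← hc _ ⟨hw.1, v, by simp, hv⟩]; exact hw.2⟩
  · have htr : ∀ e ∈ p.edges, e ∈ (G.mono col c).edgeSet := by
      intro e he
      induction e with
      | _ x y =>
        have hadj := p.adj_of_mem_edges he
        exact ⟨hadj.1, by
          rw [hc _ ⟨hadj.1, x, by simp, hX x (p.fst_mem_support_of_mem_edges he)⟩]
          exact hadj.2⟩
    exact h.2 c u (p.transfer _ htr) (hp.transfer htr) (by simpa using hX)

theorem LocallyGood.not {P : Pieces G ι} {i : ι} {col : Sym2 V → Bool}
    (h : P.LocallyGood i col) : P.LocallyGood i (fun e => !col e) := by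
  refine ⟨fun v hv c => ?_, fun c u p hp hX => ?_⟩
  · obtain ⟨w, hw⟩ := h.1 v hv (!c)
    exact ⟨w, hw.1, by simp [hw.2]⟩
  · have htr : ∀ e ∈ p.edges, e ∈ (G.mono col (!c)).edgeSet := by
      intro e he
      induction e with
      | _ x y =>
        have hadj := p.adj_of_mem_edges he
        exact ⟨hadj.1, by rw [← hadj.2]; simp⟩
    exact h.2 (!c) u (p.transfer _ htr) (hp.transfer htr) (by simpa using hX)

open Classical in
/-- Recolouring the free edges near a piece. -/
noncomputable def patch (i : ι) (κ ψ : Sym2 V → Bool) : Sym2 V → Bool :=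
  fun e => if e ∈ P.free i then ψ e else κ e

open Classical in
/-- Forgetting the colours far from a piece. -/
noncomputable def restr (i : ι) (κ : Sym2 V → Bool) : Sym2 V → Bool :=
  fun e => if e ∈ P.edgesAt i then κ e else false

open Classical in
/-- A choice of new colours for the free edges near a piece. -/
noncomputable def preFix (i : ι) (κ : Sym2 V → Bool) : Sym2 V → Bool :=
  if h : ∃ ψ, P.LocallyGood i (P.patch i κ ψ) then h.choose else κ

/-- A coloured edge of a piece. -/
noncomputable def rep (i : ι) : Sym2 V :=
  s((P.exists_adj i).choose, (P.exists_adj i).choose_spec.choose)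

theorem rep_spec (i : ι) : ∃ u v, P.rep i = s(u, v) ∧ u ∈ P.D i ∧ v ∈ P.D i ∧ P.A.Adj u v :=
  ⟨_, _, rfl, (P.exists_adj i).choose_spec.choose_spec⟩

theorem rep_mem_edgesAt (i : ι) : P.rep i ∈ P.edgesAt i := by
  obtain ⟨u, v, h, hu, hv, hA⟩ := P.rep_spec i
  rw [h]
  exact ⟨P.le hA, u, by simp, subset_nearSet _ _ hu⟩

theorem eq_of_mem_D {i j : ι} {x : V} (hi : x ∈ P.D i) (hj : x ∈ P.D j) : i = j :=
  P.sep hi hj Walk.nil (by simp)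

theorem rep_injective : Function.Injective P.rep := by
  intro i j hij
  obtain ⟨u, v, h, hu, hv, hA⟩ := P.rep_spec i
  obtain ⟨u', v', h', hu', hv', hA'⟩ := P.rep_spec j
  rw [h, h'] at hij
  rcases Sym2.eq_iff.mp hij with ⟨rfl, rfl⟩ | ⟨rfl, rfl⟩
  · exact P.eq_of_mem_D hu hu'
  · exact P.eq_of_mem_D hu hv'

open Classical in
/-- An odd choice of new colours for the free edges near a piece, depending only on the colours of
the edges meeting its region. -/
noncomputable def fix (i : ι) (κ : Sym2 V → Bool) : Sym2 V → Bool :=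
  -- A colouring and its complement differ at `rep i`. The arbitrary choice is made for the one with
  -- value `true` there and transported to the other by complementing.
  if κ (P.rep i) then P.preFix i (P.restr i κ)
  else fun e => !P.preFix i (P.restr i fun e => !κ e) e

theorem fix_congr {i : ι} {κ κ' : Sym2 V → Bool} (h : ∀ e ∈ P.edgesAt i, κ e = κ' e) :
    P.fix i κ = P.fix i κ' := by
  have h1 : P.restr i κ = P.restr i κ' := by
    funext e
    unfold restr
    split_ifs with he
    · exact h e he
    · rfl
  have h2 : (P.restr i fun e => !κ e) = P.restr i fun e => !κ' e := by
    funext e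
    unfold restr
    split_ifs with he
    · simp only [h e he]
    · rfl
  unfold fix
  rw [h1, h2, h _ (P.rep_mem_edgesAt i)]

theorem fix_not (i : ι) (κ : Sym2 V → Bool) (e : Sym2 V) :
    P.fix i (fun e => !κ e) e = !P.fix i κ e := by
  unfold fix
  by_cases h : κ (P.rep i) = true
  · simp [h]
  · simp [h]

theorem fix_spec {i : ι} {κ : Sym2 V → Bool} (h : ∃ ψ, P.LocallyGood i (P.patch i κ ψ)) :
    P.LocallyGood i (P.patch i κ (P.fix i κ)) := by
  classical
  have hpc : ∀ {κ κ' ψ : Sym2 V → Bool}, (∀ e ∈ P.edgesAt i, κ e = κ' e) →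
      P.LocallyGood i (P.patch i κ ψ) → P.LocallyGood i (P.patch i κ' ψ) := by
    intro κ κ' ψ hk hg
    refine hg.congr fun e he => ?_
    unfold patch
    split_ifs
    · rfl
    · exact hk e he
  have hr : ∀ κ : Sym2 V → Bool, ∀ e ∈ P.edgesAt i, κ e = P.restr i κ e := by
    intro κ e he
    unfold restr
    rw [if_pos he]
  have hpre : ∀ κ, (∃ ψ, P.LocallyGood i (P.patch i κ ψ)) →
      P.LocallyGood i (P.patch i κ (P.preFix i (P.restr i κ))) := by
    rintro κ ⟨ψ, hψ⟩
    have hex : ∃ ψ, P.LocallyGood i (P.patch i (P.restr i κ) ψ) := ⟨ψ, hpc (hr κ) hψ⟩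
    have := hex.choose_spec
    unfold preFix
    rw [dif_pos hex]
    exact hpc (fun e he => (hr κ e he).symm) this
  have hnot : ∀ κ ψ : Sym2 V → Bool, (fun e => !P.patch i κ ψ e) =
      P.patch i (fun e => !κ e) (fun e => !ψ e) := by
    intro κ ψ
    funext e
    unfold patch
    split_ifs <;> rfl
  unfold fix
  by_cases hk : κ (P.rep i) = true
  · rw [if_pos hk]
    exact hpre κ h
  · rw [if_neg hk]
    obtain ⟨ψ, hψ⟩ := h
    have h1 := hpre (fun e => !κ e) ⟨fun e => !ψ e, by rw [← hnot]; exact hψ.not⟩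
    have h2 := h1.not
    rw [hnot] at h2
    simpa only [Bool.not_not] using h2

open Classical in
/-- The colouring obtained by recolouring near all pieces. -/
noncomputable def repaired (κ : Sym2 V → Bool) : Sym2 V → Bool :=
  fun e => if h : ∃ i, e ∈ P.free i then P.fix h.choose κ e else κ e

theorem eq_of_mem_edge {i j : ι} {r r' : ℕ} {e : Sym2 V} (he : e ∈ G.edgeSet)
    (hi : ∃ x ∈ e, x ∈ G.nearSet (P.D i) r) (hj : ∃ x ∈ e, x ∈ G.nearSet (P.D j) r')
    (h : r + r' + 1 ≤ 100) : i = j := by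
  obtain ⟨x, hx, hxi⟩ := hi
  obtain ⟨y, hy, hyj⟩ := hj
  by_cases hxy : x = y
  · subst hxy
    exact P.eq_of_mem hxi hyj (by omega)
  · rw [(Sym2.mem_and_mem_iff hxy).mp ⟨hx, hy⟩] at he
    exact P.eq_of_near hxi hyj (Adj.toWalk he)
      (by have : (Adj.toWalk he).length = 1 := rfl; omega)

theorem repaired_of_mem {κ : Sym2 V → Bool} {i : ι} {e : Sym2 V} (he : e ∈ P.free i) :
    P.repaired κ e = P.fix i κ e := by
  have hex : ∃ i, e ∈ P.free i := ⟨i, he⟩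
  have h := hex.choose_spec
  have : hex.choose = i := P.eq_of_mem_edge he.1 h.2.2 he.2.2 (by omega)
  unfold repaired
  rw [dif_pos hex, this]

theorem repaired_of_notMem {κ : Sym2 V → Bool} {e : Sym2 V} (he : ∀ i, e ∉ P.free i) :
    P.repaired κ e = κ e := by
  unfold repaired
  rw [dif_neg (by push Not; exact he)]

theorem repaired_not (κ : Sym2 V → Bool) (e : Sym2 V) :
    P.repaired (fun e => !κ e) e = !P.repaired κ e := by
  by_cases h : ∃ i, e ∈ P.free i
  · obtain ⟨i, hi⟩ := h
    rw [P.repaired_of_mem hi, P.repaired_of_mem hi, P.fix_not]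
  · push Not at h
    rw [P.repaired_of_notMem h, P.repaired_of_notMem h]

theorem repaired_of_adj {κ : Sym2 V → Bool} {x y : V} (h : P.A.Adj x y) :
    P.repaired κ s(x, y) = κ s(x, y) :=
  P.repaired_of_notMem fun _ hi => hi.2.1 h

theorem patch_eq_repaired {κ : Sym2 V → Bool} {i : ι} {e : Sym2 V} (he : e ∈ P.edgesAt i) :
    P.patch i κ (P.fix i κ) e = P.repaired κ e := by
  unfold patch
  split_ifs with h
  · rw [P.repaired_of_mem h]
  · rw [P.repaired_of_notMem]
    intro j hj
    obtain rfl := P.eq_of_mem_edge he.1 he.2 hj.2.2 (by omega)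
    exact h hj

theorem notMem_free {x y : V} (hx : x ∉ P.guard) (hy : y ∉ P.guard) (i : ι) :
    s(x, y) ∉ P.free i := by
  rintro ⟨-, -, z, hz, hzi⟩
  have hzg : z ∈ P.guard := Set.mem_iUnion.mpr ⟨i, hzi⟩
  rcases Sym2.mem_iff.mp hz with rfl | rfl
  · exact hx hzg
  · exact hy hzg

/-- `exists_repair` shows that a good recolouring exists near each piece, so the chosen ones are
good. Recolouring does not touch edges with both ends outside the guard, so every monochromatic
cycle afterwards would still lie in one region, where there is none. -/
theorem repaired_spec [Finite V] (hG : G.IsCubic) {κ : Sym2 V → Bool} (hκ : G.BothColours κ)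
    (hm : G.Meets κ P.guard)
    (hA : ∀ i, ∃ b, ∀ x y, x ∈ P.D i → P.A.Adj x y → κ s(x, y) = xor (P.a s(x, y)) b) :
    G.BothColours (P.repaired κ) ∧ (∀ c, (G.mono (P.repaired κ) c).IsAcyclic) ∧
      G.Meets (P.repaired κ) P.guard := by
  have hex : ∀ i, ∃ ψ, P.LocallyGood i (P.patch i κ ψ) := by
    intro i
    obtain ⟨col, h1, h2, h3⟩ := hκ.exists_repair hG (P.free i) (P.region i) (by
      intro col' hag hv c u p hp hX
      have hm' : G.Meets col' P.guard := hm.congr fun x y hx hy =>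
        hag _ (P.notMem_free hx hy i)
      obtain ⟨j, hj, hz⟩ := P.exists_region_of_isCycle hm' hp
      obtain rfl : i = j :=
        P.eq_of_mem (hX u p.start_mem_support) (hj u p.start_mem_support) (by omega)
      obtain ⟨b, hb⟩ := hA i
      refine P.exists_two_free (b := b) (fun x y hx hxy => ?_) hp hz
      rw [hag _ fun hf => hf.2.1 hxy]
      exact hb x y hx hxy)
    have hpatch : P.patch i κ col = col := by
      funext e
      unfold patch
      split_ifs with he
      · rfl
      · exact (h1 e he).symm
    exact ⟨col, by rw [hpatch]; exact ⟨fun v _ c => h2 v c, h3⟩⟩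
  have hgood : ∀ i, P.LocallyGood i (P.repaired κ) := fun i =>
    (P.fix_spec (hex i)).congr fun e he => P.patch_eq_repaired he
  have hmeet : G.Meets (P.repaired κ) P.guard := hm.congr fun x y hx hy =>
    P.repaired_of_notMem (P.notMem_free hx hy)
  refine ⟨fun v c => ?_, fun c u p hp => ?_, hmeet⟩
  · by_cases hv : ∃ i, v ∈ P.region i
    · obtain ⟨i, hi⟩ := hv
      exact (hgood i).1 v hi c
    · push Not at hv
      obtain ⟨w, hw⟩ := hκ v c
      refine ⟨w, hw.1, ?_⟩
      rw [P.repaired_of_notMem]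
      · exact hw.2
      · rintro i ⟨-, -, z, hz, hzi⟩
        rcases Sym2.mem_iff.mp hz with rfl | rfl
        · exact hv i (P.zone_subset_region i hzi)
        · exact hv i (nearSet_mono (by omega) (mem_nearSet_of_adj hzi hw.1.symm))
  · obtain ⟨i, hi, -⟩ := P.exists_region_of_isCycle hmeet hp
    exact (hgood i).2 c u p hp hi

theorem _root_.SimpleGraph.IsCubic.ncard_edges_le [Finite V] (hG : G.IsCubic) (S : Set V) :
    {e | e ∈ G.edgeSet ∧ ∃ x ∈ e, x ∈ S}.ncard ≤ S.ncard * 3 := by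
  have hsub : {e | e ∈ G.edgeSet ∧ ∃ x ∈ e, x ∈ S} ⊆
      ⋃ x ∈ S, (fun w => s(x, w)) '' G.neighborSet x := by
    rintro e ⟨he, x, hx, hxS⟩
    simp only [Set.mem_iUnion]
    obtain ⟨y, rfl⟩ := hx
    exact ⟨x, hxS, y, he, rfl⟩
  refine (Set.ncard_le_ncard hsub (Set.toFinite _)).trans (ncard_biUnion_le _ _ 3 fun x _ => ?_)
  exact (Set.ncard_image_le (Set.toFinite _)).trans (hG x).le

/-- The repair near a piece depends only on edges meeting its region, and an edge meets at most one
region. So a changed edge alters itself and at most `K` free edges. -/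
theorem ncard_repaired_ne_le [Finite V] (κ κ' : Sym2 V → Bool) (K : ℕ)
    (hK : ∀ i, (P.free i).ncard ≤ K) :
    {e | e ∈ G.edgeSet ∧ P.repaired κ e ≠ P.repaired κ' e}.ncard ≤
      {e | e ∈ G.edgeSet ∧ κ e ≠ κ' e}.ncard * (1 + K) := by
  set Δ := {e | e ∈ G.edgeSet ∧ κ e ≠ κ' e} with hΔ
  have hsub : {e | e ∈ G.edgeSet ∧ P.repaired κ e ≠ P.repaired κ' e} ⊆
      Δ ∪ ⋃ e ∈ Δ, {e' | ∃ i, e ∈ P.edgesAt i ∧ e' ∈ P.free i} := by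
    rintro e ⟨he, hne⟩
    by_cases h : ∃ i, e ∈ P.free i
    · obtain ⟨i, hi⟩ := h
      rw [P.repaired_of_mem hi, P.repaired_of_mem hi] at hne
      right
      have : ∃ e' ∈ P.edgesAt i, κ e' ≠ κ' e' := by
        by_contra! hcon
        rw [P.fix_congr hcon] at hne
        exact hne rfl
      obtain ⟨e', h1, h2⟩ := this
      simp only [Set.mem_iUnion]
      exact ⟨e', ⟨h1.1, h2⟩, i, h1, hi⟩
    · push Not at h
      rw [P.repaired_of_notMem h, P.repaired_of_notMem h] at hne
      exact Or.inl ⟨he, hne⟩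
  refine (Set.ncard_le_ncard hsub (Set.toFinite _)).trans ((Set.ncard_union_le _ _).trans ?_)
  rw [mul_add, mul_one]
  refine Nat.add_le_add_left (ncard_biUnion_le _ _ K fun e _ => ?_) _
  by_cases h : ∃ i, e ∈ P.edgesAt i
  · obtain ⟨i, hi⟩ := h
    refine (Set.ncard_le_ncard ?_ (Set.toFinite _)).trans (hK i)
    rintro e' ⟨j, hj, he'⟩
    obtain rfl := P.eq_of_mem_edge hi.1 hi.2 hj.2 (by omega)
    exact he'
  · have : {e' | ∃ i, e ∈ P.edgesAt i ∧ e' ∈ P.free i} = ∅ := by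
      ext e'
      simp only [Set.mem_ofPred_eq, Set.mem_empty_iff_false, iff_false]
      rintro ⟨i, hi, -⟩
      exact h ⟨i, hi⟩
    rw [this]; simp

/-- The random colouring of a cubic graph with given pieces: the pieces keep or exchange their
colours according to independent bits. -/
theorem exists_random_colouring [Finite V] (hG : G.IsCubic) (s D : ℕ)
    (hs : ∀ i, (P.D i).ncard ≤ s) (hD : 2 ^ D * Nat.card V < 3 ^ D) :
    ∃ (χ : (Sym2 V → Bool) → Sym2 V → Bool) (B : Set (Sym2 V)),
      B.ncard ≤ Nat.card V * 3 ∧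
      (∀ ω, G.BothColours (χ ω) ∧ (∀ c, (G.mono (χ ω) c).IsAcyclic) ∧ G.Meets (χ ω) P.guard) ∧
      (∀ ω e, χ (fun b => !ω b) e = !χ ω e) ∧
      (∀ ω i x y, x ∈ P.D i → P.A.Adj x y → χ ω s(x, y) = xor (P.a s(x, y)) (ω (P.rep i))) ∧
      ∀ ω ω' b, (∀ b', b' ≠ b → ω b' = ω' b') →
        {e | e ∈ G.edgeSet ∧ χ ω e ≠ χ ω' e}.ncard ≤
          (s * 3 + (2 * D + 1)) * 7 ^ 4 * (1 + s * 16 * 3) ∧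
        (b ∉ B → {e | e ∈ G.edgeSet ∧ χ ω e ≠ χ ω' e} = ∅) := by
  classical
  -- All coloured edges of a piece share the bit indexed by its representative edge, so a piece is
  -- kept or exchanged as a whole.
  let e₀ : Sym2 V → Sym2 V := fun e => if h : ∃ i, ∃ x ∈ e, x ∈ P.D i then P.rep h.choose else e
  have hmem : ∀ {u v i}, u ∈ P.D i → P.A.Adj u v → v ∈ P.D i := by
    intro u v i hu huv
    obtain ⟨j, hj, hj'⟩ := P.adj_mem huv
    rwa [P.eq_of_mem_D hu hj]
  have he₀ : ∀ {x y i}, x ∈ P.D i → P.A.Adj x y → e₀ s(x, y) = P.rep i := by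
    intro x y i hx hxy
    have hex : ∃ i, ∃ z ∈ s(x, y), z ∈ P.D i := ⟨i, x, by simp, hx⟩
    have : hex.choose = i := by
      obtain ⟨z, hz, hzi⟩ := hex.choose_spec
      rcases Sym2.mem_iff.mp hz with rfl | rfl
      · exact P.eq_of_mem_D hzi hx
      · exact P.eq_of_mem_D hzi (hmem hx hxy)
    simp only [e₀]
    rw [dif_pos hex, this]
  have hM : ∀ b, {e ∈ P.A.edgeSet | e₀ e = b}.ncard ≤ s * 3 := by
    intro b
    by_cases hb : ∃ i, P.rep i = b
    · obtain ⟨i, rfl⟩ := hb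
      refine le_trans (Set.ncard_le_ncard ?_ (Set.toFinite _))
        ((hG.ncard_edges_le (P.D i)).trans (Nat.mul_le_mul_right 3 (hs i)))
      rintro e ⟨he, hei⟩
      induction e with
      | _ x y =>
        obtain ⟨j, hj, -⟩ := P.adj_mem (u := x) (v := y) he
        rw [he₀ hj he] at hei
        rw [← P.rep_injective hei]
        exact ⟨P.le he, x, by simp, hj⟩
    · have : {e ∈ P.A.edgeSet | e₀ e = b} = ∅ := by
        ext e
        simp only [Set.mem_ofPred_eq, Set.mem_empty_iff_false, iff_false]
        rintro ⟨he, hei⟩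
        induction e with
        | _ x y =>
          obtain ⟨j, hj, -⟩ := P.adj_mem (u := x) (v := y) he
          exact hb ⟨j, by rw [← hei, he₀ hj he]⟩
      rw [this]; simp
  obtain ⟨β, k, hβA, hβ, hχ⟩ := exists_bitColouring hG P.le P.a e₀ (by
      intro v x y hx hy hxy
      obtain ⟨x', y', hx', hy', hne⟩ := P.deg v x y hx hy hxy
      obtain ⟨i, hi, -⟩ := P.adj_mem hx
      exact ⟨x', y', hx', hy', hne, by rw [he₀ hi hx', he₀ hi hy']⟩)
    P.isGuard (s * 3) D hM hD
  have hcolA : ∀ ω i x y, x ∈ P.D i → P.A.Adj x y →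
      bitColouring β k ω s(x, y) = xor (P.a s(x, y)) (ω (P.rep i)) := by
    intro ω i x y hx hxy
    obtain ⟨h1, h2⟩ := hβA s(x, y) hxy
    rw [bitColouring, h1, h2, he₀ hx hxy]
  have hK : ∀ i, (P.free i).ncard ≤ s * 16 * 3 := by
    intro i
    have hsub : P.free i ⊆ {e | e ∈ G.edgeSet ∧ ∃ x ∈ e, x ∈ P.zone i} :=
      fun e he => ⟨he.1, he.2.2⟩
    refine (Set.ncard_le_ncard hsub (Set.toFinite _)).trans ((hG.ncard_edges_le _).trans ?_)
    refine Nat.mul_le_mul_right 3 ((hG.ncard_nearSet_le _ 2).trans ?_)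
    exact Nat.mul_le_mul_right _ (hs i)
  -- Only bits used by some edge matter, at most one per edge of `G`.
  refine ⟨fun ω => P.repaired (bitColouring β k ω), β '' G.edgeSet, ?_, fun ω => ?_, fun ω e => ?_,
    fun ω i x y hx hxy => ?_, fun ω ω' b hω => ?_⟩
  · refine (Set.ncard_image_le (Set.toFinite _)).trans ?_
    have := hG.ncard_edges_le Set.univ
    rw [Set.ncard_univ] at this
    refine le_trans (Set.ncard_le_ncard ?_ (Set.toFinite _)) this
    intro e he
    induction e with
    | _ x y => exact ⟨he, x, by simp, trivial⟩
  · exact P.repaired_spec hG (hχ ω).1 (hχ ω).2 fun i => ⟨_, hcolA ω i⟩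
  · have : bitColouring β k (fun b => !ω b) = fun e => !bitColouring β k ω e := by
      funext e
      simp [bitColouring]
    simp only [this]
    exact P.repaired_not _ e
  · simp only
    rw [P.repaired_of_adj hxy, hcolA ω i x y hx hxy]
  · have hsub : {e | e ∈ G.edgeSet ∧ bitColouring β k ω e ≠ bitColouring β k ω' e} ⊆
        {e | e ∈ G.edgeSet ∧ β e = b} := by
      rintro e ⟨he, hne⟩
      refine ⟨he, ?_⟩
      by_contra hb
      exact hne (by simp only [bitColouring, hω _ hb])
    have hle := P.ncard_repaired_ne_le (bitColouring β k ω) (bitColouring β k ω') _ hK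
    refine ⟨hle.trans (Nat.mul_le_mul_right _ ?_), fun hb => ?_⟩
    · refine le_trans (Set.ncard_le_ncard (hsub.trans ?_) (Set.toFinite _)) (hβ b)
      exact fun e he => he.2
    · have h0 : {e | e ∈ G.edgeSet ∧ bitColouring β k ω e ≠ bitColouring β k ω' e} = ∅ := by
        refine Set.eq_empty_of_subset_empty fun e he => hb ?_
        exact ⟨e, he.1, (hsub he).2⟩
      rw [h0] at hle
      simp only [Set.ncard_empty, zero_mul, Nat.le_zero] at hle
      exact (Set.ncard_eq_zero (Set.toFinite _)).mp hle

end Pieces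

end SimpleGraph

/-! ### Selecting separated components of every frequent type. -/

namespace SimpleGraph

theorem ncard_frequent_mul_le {α β : Type*} [Finite α] [Finite β] (q : α → β) (N : ℕ) :
    {b | N ≤ {c | q c = b}.ncard}.ncard * N ≤ Nat.card α := by
  classical
  have := Fintype.ofFinite α
  have := Fintype.ofFinite β
  rw [Set.ncard_eq_toFinset_card', ← smul_eq_mul]
  refine (Finset.card_nsmul_le_sum _ (fun b => (Finset.univ.filter fun c => q c = b).card) N ?_).trans
    ?_
  · intro b hb
    have hb : N ≤ {c | q c = b}.ncard := by simpa using hb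
    rw [Set.ncard_eq_toFinset_card'] at hb
    refine hb.trans (le_of_eq ?_)
    congr 1
    ext c; simp
  · rw [Nat.card_eq_fintype_card, ← Finset.card_univ]
    exact (Finset.sum_card_fiberwise_eq_card_filter Finset.univ _ q).le.trans
      (Finset.card_filter_le _ _)

/-- Many pairwise non-conflicting elements from each frequent class. -/
theorem exists_separated {α β : Type*} [Finite α] [Finite β] (q : α → β) (conf : α → α → Prop)
    (hrefl : ∀ c, conf c c) (hsymm : ∀ c d, conf c d → conf d c) (m Δ N : ℕ)
    (hΔ : ∀ c, {d | conf c d}.ncard ≤ Δ) (hbig : Nat.card α * m * Δ < N * N) :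
    ∃ S : Set α, (∀ c ∈ S, ∀ d ∈ S, conf c d → c = d) ∧
      ∀ b, N ≤ {c | q c = b}.ncard → m ≤ {c | c ∈ S ∧ q c = b}.ncard := by
  classical
  set F : Set β := {b | N ≤ {c | q c = b}.ncard} with hF
  -- Capping each class at `m` keeps `S` small. If a frequent class stayed below `m`, maximality
  -- would make all its `N` members conflict with `S`, so `N ≤ |S| * Δ ≤ |F| * m * Δ`; but `|F| * N`
  -- is at most the size of `α`, contradicting `hbig`.
  obtain ⟨S, ⟨hS1, hS2, hS3⟩, hmax⟩ := Set.Finite.exists_maximal (s := {S : Set α |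
      (∀ c ∈ S, q c ∈ F) ∧ (∀ c ∈ S, ∀ d ∈ S, conf c d → c = d) ∧
      ∀ b, {c | c ∈ S ∧ q c = b}.ncard ≤ m}) (Set.toFinite _) ⟨∅, by simp⟩
  refine ⟨S, hS2, fun b hb => ?_⟩
  by_contra! hlt
  have hconf : ∀ d, q d = b → ∃ c ∈ S, conf c d := by
    intro d hd
    by_contra! hcon
    have hdS : d ∉ S := fun h => hcon d h (hrefl d)
    refine hdS (hmax (y := insert d S) ⟨?_, ?_, ?_⟩ (Set.subset_insert _ _)
      (Set.mem_insert _ _))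
    · rintro c (rfl | hc)
      · rw [hd]; exact hb
      · exact hS1 c hc
    · rintro c (rfl | hc) c' (rfl | hc') h
      · rfl
      · exact absurd (hsymm _ _ h) (hcon c' hc')
      · exact absurd h (hcon c hc)
      · exact hS2 c hc c' hc' h
    · intro b'
      by_cases hbb : b' = b
      · subst hbb
        have : {c | c ∈ insert d S ∧ q c = b'} ⊆ insert d {c | c ∈ S ∧ q c = b'} := by
          rintro c ⟨rfl | hc, hq⟩
          · exact Set.mem_insert _ _
          · exact Set.mem_insert_of_mem _ ⟨hc, hq⟩
        refine (Set.ncard_le_ncard this (Set.toFinite _)).trans ((Set.ncard_insert_le _ _).trans ?_)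
        omega
      · have : {c | c ∈ insert d S ∧ q c = b'} ⊆ {c | c ∈ S ∧ q c = b'} := by
          rintro c ⟨rfl | hc, hq⟩
          · exact absurd (hq.symm.trans hd) hbb
          · exact ⟨hc, hq⟩
        exact (Set.ncard_le_ncard this (Set.toFinite _)).trans (hS3 b')
  have h1 : N ≤ S.ncard * Δ := by
    refine hb.trans ((Set.ncard_le_ncard ?_ (Set.toFinite _)).trans
      (ncard_biUnion_le S (fun c => {d | conf c d}) Δ fun c _ => hΔ c))
    intro d hd
    obtain ⟨c, hc, hcd⟩ := hconf d hd
    simp only [Set.mem_iUnion]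
    exact ⟨c, hc, hcd⟩
  have h2 : S.ncard ≤ F.ncard * m := by
    refine (Set.ncard_le_ncard ?_ (Set.toFinite _)).trans
      (ncard_biUnion_le F (fun b => {c | c ∈ S ∧ q c = b}) m fun b _ => hS3 b)
    intro c hc
    simp only [Set.mem_iUnion]
    exact ⟨q c, hS1 c hc, hc, rfl⟩
  have h3 := ncard_frequent_mul_le q N
  have h4 : N * N ≤ Nat.card α * m * Δ := by
    calc N * N ≤ S.ncard * Δ * N := Nat.mul_le_mul_right _ h1
      _ ≤ F.ncard * m * Δ * N := Nat.mul_le_mul_right _ (Nat.mul_le_mul_right _ h2)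
      _ = F.ncard * N * m * Δ := by ring
      _ ≤ _ := Nat.mul_le_mul_right _ (Nat.mul_le_mul_right _ h3)
  omega

theorem ConnectedComponent.mem_supp_of_adj' {V : Type*} {F : SimpleGraph V}
    {c : F.ConnectedComponent} {u v : V} (hu : u ∈ c.supp) (h : F.Adj u v) : v ∈ c.supp := by
  rw [ConnectedComponent.mem_supp_iff] at hu ⊢
  rw [← hu]
  exact ConnectedComponent.sound h.symm.reachable

theorem ConnectedComponent.exists_adj_of_nontrivial {V : Type*} {F : SimpleGraph V}
    {c : F.ConnectedComponent} (hc : c.supp.Nontrivial) :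
    ∃ u v, u ∈ c.supp ∧ v ∈ c.supp ∧ F.Adj u v := by
  obtain ⟨u, hu, v, hv, huv⟩ := hc
  have hr : F.Reachable u v := by
    rw [ConnectedComponent.mem_supp_iff] at hu hv
    exact ConnectedComponent.exact (hu.trans hv.symm)
  obtain ⟨p⟩ := hr
  cases p with
  | nil => exact absurd rfl huv
  | cons h p => exact ⟨u, _, hu, ConnectedComponent.mem_supp_of_adj' hu h, h⟩

end SimpleGraph

open SimpleGraph

namespace ColouredGraph

variable {V : Type*}

/-- Two components are isomorphic as coloured graphs. -/
def CompEquiv (A : ColouredGraph V) (c d : A.graph.ConnectedComponent) : Prop :=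
  ∃ φ : c.supp ≃ d.supp, ∀ x y : c.supp,
    (A.red.Adj x y ↔ A.red.Adj (φ x) (φ y)) ∧ (A.blue.Adj x y ↔ A.blue.Adj (φ x) (φ y))

theorem CompEquiv.refl (A : ColouredGraph V) (c : A.graph.ConnectedComponent) :
    A.CompEquiv c c := ⟨Equiv.refl _, fun _ _ => ⟨Iff.rfl, Iff.rfl⟩⟩

theorem CompEquiv.symm {A : ColouredGraph V} {c d : A.graph.ConnectedComponent}
    (h : A.CompEquiv c d) : A.CompEquiv d c := by
  obtain ⟨φ, h⟩ := h
  refine ⟨φ.symm, fun x y => ?_⟩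
  have := h (φ.symm x) (φ.symm y)
  simp only [Equiv.apply_symm_apply] at this
  exact ⟨this.1.symm, this.2.symm⟩

theorem CompEquiv.trans {A : ColouredGraph V} {c d e : A.graph.ConnectedComponent}
    (h : A.CompEquiv c d) (h' : A.CompEquiv d e) : A.CompEquiv c e := by
  obtain ⟨φ, h⟩ := h
  obtain ⟨ψ, h'⟩ := h'
  exact ⟨φ.trans ψ, fun x y => ⟨(h x y).1.trans (h' _ _).1, (h x y).2.trans (h' _ _).2⟩⟩

/-- This replaces the arbitrary graphs `H` in (Q4) by the finitely many isomorphism classes of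
components. -/
theorem ComponentIso.iff_compEquiv {A : ColouredGraph V} {W : Type*} {H : ColouredGraph W}
    {c d : A.graph.ConnectedComponent} (h : A.ComponentIso H c) :
    A.ComponentIso H d ↔ A.CompEquiv c d := by
  obtain ⟨φ, h⟩ := h
  constructor
  · rintro ⟨ψ, h'⟩
    refine ⟨φ.trans ψ.symm, fun x y => ?_⟩
    have := h' (ψ.symm (φ x)) (ψ.symm (φ y))
    simp only [Equiv.apply_symm_apply] at this
    exact ⟨(h x y).1.trans this.1.symm, (h x y).2.trans this.2.symm⟩
  · rintro ⟨ψ, h'⟩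
    refine ⟨ψ.symm.trans φ, fun x y => ?_⟩
    have h1 := h (ψ.symm x) (ψ.symm y)
    have h2 := h' (ψ.symm x) (ψ.symm y)
    simp only [Equiv.apply_symm_apply] at h2
    exact ⟨h2.1.symm.trans h1.1, h2.2.symm.trans h1.2⟩

/-- The isomorphism class of a component. -/
def compClass (A : ColouredGraph V) (c : A.graph.ConnectedComponent) :
    Set A.graph.ConnectedComponent := {d | A.CompEquiv c d}

theorem compClass_eq_iff {A : ColouredGraph V} {c d : A.graph.ConnectedComponent} :
    A.compClass d = A.compClass c ↔ A.CompEquiv c d := by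
  constructor
  · intro h
    have : d ∈ A.compClass d := CompEquiv.refl A d
    rw [h] at this
    exact this
  · intro h
    ext e
    exact ⟨fun he => h.trans he, fun he => h.symm.trans he⟩

/-- Two components are close to each other in `G`. -/
def Close (A : ColouredGraph V) (G : SimpleGraph V) (c d : A.graph.ConnectedComponent) : Prop :=
  ∃ x ∈ c.supp, ∃ y ∈ d.supp, ∃ p : G.Walk x y, p.length ≤ 100

/-- Every close component contains a vertex of the ball of radius 100 around `c`. -/
theorem ncard_close_le [Finite V] {A : ColouredGraph V} {G : SimpleGraph V} (hG : G.IsCubic)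
    (c : A.graph.ConnectedComponent) :
    {d | A.Close G c d}.ncard ≤ c.supp.ncard * 4 ^ 100 := by
  refine le_trans ?_ (hG.ncard_nearSet_le c.supp 100)
  refine le_trans (Set.ncard_le_ncard (t := A.graph.connectedComponentMk '' G.nearSet c.supp 100)
    ?_ (Set.toFinite _)) (Set.ncard_image_le (Set.toFinite _))
  rintro d ⟨x, hx, y, hy, p, hp⟩
  exact ⟨y, ⟨x, hx, p, hp⟩, hy⟩

open Classical in
/-- The pieces given by separated components of an extendable subgraph. -/
noncomputable def pieces {A : ColouredGraph V} {G : SimpleGraph V} {s : ℝ}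
    (hA : Extendable G A s) [Finite V] (S : Set A.graph.ConnectedComponent)
    (hS : ∀ c ∈ S, ∀ d ∈ S, A.Close G c d → c = d) :
    Pieces G {c // c ∈ S ∧ c.supp.Nontrivial} where
  D i := i.1.supp
  A :=
    -- Edges of unselected components count as uncoloured.
    { Adj := fun u v => A.graph.Adj u v ∧ A.graph.connectedComponentMk u ∈ S
      symm := ⟨fun u v h => ⟨h.1.symm, by
        rw [← ConnectedComponent.sound h.1.reachable]; exact h.2⟩⟩
      loopless := ⟨fun v h => h.1.ne rfl⟩ }
  a e := decide (e ∈ A.red.edgeSet)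
  le := fun u v h => hA.le h.1
  adj_mem := by
    intro u v h
    have hv : v ∈ (A.graph.connectedComponentMk u).supp :=
      ConnectedComponent.mem_supp_of_adj' rfl h.1
    exact ⟨⟨A.graph.connectedComponentMk u, h.2, u, rfl, v, hv, h.1.ne⟩, rfl, hv⟩
  exists_adj := by
    rintro ⟨c, hc, hcn⟩
    obtain ⟨u, v, hu, hv, huv⟩ := ConnectedComponent.exists_adj_of_nontrivial hcn
    refine ⟨u, v, hu, hv, huv, ?_⟩
    rw [(ConnectedComponent.mem_supp_iff _ _).mp hu]
    exact hc
  deg := by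
    intro v x y hx hy hxy
    have h2 : 2 ≤ (A.graph.neighborSet v).ncard := by
      rw [← Set.ncard_pair hxy]
      refine Set.ncard_le_ncard ?_ (Set.toFinite _)
      intro z hz
      rcases hz with h | h <;> rw [h]
      · exact hx.1
      · exact hy.1
    obtain ⟨h1, h2⟩ := hA.degree v h2
    obtain ⟨r, hr⟩ := (Set.ncard_pos (Set.toFinite _)).mp h1
    obtain ⟨b, hb⟩ := (Set.ncard_pos (Set.toFinite _)).mp h2
    have hr : A.red.Adj v r := hr
    have hb : A.blue.Adj v b := hb
    refine ⟨r, b, ⟨Or.inl hr, hx.2⟩, ⟨Or.inr hb, hx.2⟩, ?_⟩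
    have h3 : ¬ A.red.Adj v b := fun h => (disjoint_iff_inf_le.mp A.disjoint) ⟨h, hb⟩
    simp [hr, h3]
  sep := by
    rintro ⟨c, hc, _⟩ ⟨d, hd, _⟩ x y hx hy p hp
    exact Subtype.ext (hS c hc d hd ⟨x, hx, y, hy, p, hp⟩)
  cyc := by
    rintro ⟨c, hc, hcn⟩ u p hp hX hmono
    -- A red and a blue edge of `A` on a cycle inside a selected component would contradict `hmono`,
    -- so (E3) applies.
    obtain ⟨x, y, z, hne, h1, h2, h3, h4⟩ := hA.cycle u p hp (by
      rintro ⟨x, y, x', y', hxy, hr, hxy', hb, -⟩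
      have hmem : ∀ {w}, w ∈ p.support → A.graph.connectedComponentMk w ∈ S := by
        intro w hw
        rw [(ConnectedComponent.mem_supp_iff _ _).mp (hX w hw)]
        exact hc
      have := hmono _ hxy _ hxy' ⟨Or.inl hr, hmem (p.fst_mem_support_of_mem_edges hxy)⟩
        ⟨Or.inr hb, hmem (p.fst_mem_support_of_mem_edges hxy')⟩
      have h3 : ¬ A.red.Adj x' y' := fun h => (disjoint_iff_inf_le.mp A.disjoint) ⟨h, hb⟩
      simp [hr, h3] at this)
    exact ⟨x, y, z, hne, h1, h2, fun h => h3 h.1, fun h => h4 h.1⟩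

end ColouredGraph

/-! ### Lengths, disjoint paths and stability of path counts. -/

namespace SimpleGraph

variable {V : Type*} {G : SimpleGraph V}

theorem Walk.IsPath.length_lt_ncard [Finite V] {F : SimpleGraph V} {u v : V} {p : F.Walk u v}
    (hp : p.IsPath) {S : Set V} (h : ∀ x ∈ p.support, x ∈ S) : p.length < S.ncard := by
  classical
  have h1 : p.support.toFinset.card = p.length + 1 := by
    rw [List.toFinset_card_of_nodup hp.support_nodup, Walk.length_support]
  have h2 : (p.support.toFinset : Set V).ncard ≤ S.ncard :=
    Set.ncard_le_ncard (fun x hx => h x (by simpa using hx)) (Set.toFinite _)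
  rw [Set.ncard_coe_finset] at h2
  omega

theorem IsPathComponent.length_eq {F : SimpleGraph V} {c : F.ConnectedComponent} {t t' : ℕ}
    (h : IsPathComponent F c t) (h' : IsPathComponent F c t') : t = t' := by
  have := IsPathComponent.ncard_supp h
  have := IsPathComponent.ncard_supp h'
  omega

namespace Pieces

variable {ι : Type*} (P : Pieces G ι) {col : Sym2 V → Bool}

/-- Long monochromatic paths stay close to a single piece. -/
theorem exists_region_of_isPath (hcol : G.Meets col P.guard) {c : Bool} {u v : V}
    {p : (G.mono col c).Walk u v} (hp : p.IsPath) (hl : 20 ≤ p.length) :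
    ∃ i, ∀ x ∈ p.support, x ∈ P.region i := by
  obtain ⟨i, hi, -⟩ := P.exists_region hcol (v := p.getVert) hl
    (fun k hk => p.adj_getVert_succ hk) (fun k hk h => by
      have := hp.getVert_injOn (by simp; omega) (by simp; omega) h
      omega)
  refine ⟨i, fun x hx => ?_⟩
  obtain ⟨k, rfl, hk⟩ := Walk.mem_support_iff_exists_getVert.mp hx
  exact hi k hk

variable [Finite V]

theorem length_lt_of_isPath (hcol : G.Meets col P.guard) {R : ℕ} (hR : 20 ≤ R)
    (hreg : ∀ i, (P.region i).ncard ≤ R) {c : Bool} {u v : V}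
    {p : (G.mono col c).Walk u v} (hp : p.IsPath) : p.length < R := by
  rcases lt_or_ge p.length 20 with h | h
  · omega
  · obtain ⟨i, hi⟩ := P.exists_region_of_isPath hcol hp h
    exact (hp.length_lt_ncard hi).trans_le (hreg i)

theorem exists_isPathComponent (hG : G.IsCubic) (hb : G.BothColours col)
    (hac : ∀ c, (G.mono col c).IsAcyclic) (hcol : G.Meets col P.guard) {R : ℕ} (hR : 20 ≤ R)
    (hreg : ∀ i, (P.region i).ncard ≤ R) {c : Bool} (d : (G.mono col c).ConnectedComponent) :
    ∃ t < R, IsPathComponent _ d t := by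
  obtain ⟨u, v, p, hp, hs⟩ := (hb.maxDegTwo hG c).exists_isPath_support_eq d
  exact ⟨p.length, P.length_lt_of_isPath hcol hR hreg hp, isPathComponent_of_isPath (hac c) hp hs⟩

/-- Long monochromatic paths meeting a common path of the other colour are close to the same
piece, so there are few of them. -/
theorem mul_le_of_disjoint_paths (hcol : G.Meets col P.guard) {R : ℕ}
    (hreg : ∀ i, (P.region i).ncard ≤ R) {c c' : Bool} {u v : V} {p : (G.mono col c).Walk u v}
    (hp : p.IsPath) {k M : ℕ} (hM : 20 ≤ M) {a b : Fin k → V}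
    (q : ∀ i, (G.mono col c').Walk (a i) (b i)) (hq : ∀ i, (q i).IsPath)
    (hqM : ∀ i, M ≤ (q i).length) (hpq : ∀ i, ∃ x ∈ p.support, x ∈ (q i).support)
    (hdis : ∀ i j, i ≠ j → (q i).support.Disjoint (q j).support) : k * M ≤ R := by
  classical
  rcases Nat.eq_zero_or_pos k with rfl | hk
  · simp
  choose r hr using fun i => P.exists_region_of_isPath hcol (hq i) (hM.trans (hqM i))
  choose x hxp hxq using hpq
  -- If `p` has fewer than 20 edges, its meeting points are too close together to belong to
  -- different regions; otherwise `p` itself stays in one region. Disjoint paths then compete for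
  -- the vertices of that region.
  obtain ⟨i₀, hi₀⟩ : ∃ i₀, ∀ j, r j = i₀ := by
    rcases lt_or_ge p.length 20 with hl | hl
    · refine ⟨r ⟨0, hk⟩, fun j => ?_⟩
      obtain ⟨s, hs, hsl⟩ := Walk.mem_support_iff_exists_getVert.mp (hxp j)
      obtain ⟨s', hs', hsl'⟩ := Walk.mem_support_iff_exists_getVert.mp (hxp ⟨0, hk⟩)
      have hw : ∃ w : G.Walk (x j) (x ⟨0, hk⟩), w.length ≤ 19 := by
        have hadj : ∀ k < p.length, G.Adj (p.getVert k) (p.getVert (k + 1)) :=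
          fun k hk => (p.adj_getVert_succ hk).1
        rw [← hs, ← hs']
        rcases le_total s s' with h | h
        · obtain ⟨w, hw⟩ := exists_walk_of_seq h (fun m _ _ => hadj m (by omega))
          exact ⟨w, by omega⟩
        · obtain ⟨w, hw⟩ := exists_walk_of_seq h (fun m _ _ => hadj m (by omega))
          exact ⟨w.reverse, by rw [Walk.length_reverse]; omega⟩
      obtain ⟨w, hw⟩ := hw
      exact P.eq_of_near (hr j _ (hxq j)) (hr _ _ (hxq _)) w (by omega)
    · obtain ⟨i, hi⟩ := P.exists_region_of_isPath hcol hp hl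
      exact ⟨i, fun j => P.eq_of_mem (hr j _ (hxq j)) (hi _ (hxp j)) (by omega)⟩
  let f : Fin k × Fin M → P.region i₀ := fun z =>
    ⟨(q z.1).getVert z.2, hi₀ z.1 ▸ hr z.1 _ ((q z.1).getVert_mem_support _)⟩
  have hf : Function.Injective f := by
    rintro ⟨i, m⟩ ⟨j, m'⟩ h
    have h : (q i).getVert m = (q j).getVert m' := congrArg Subtype.val h
    have hij : i = j := by
      by_contra hij
      exact hdis i j hij ((q i).getVert_mem_support m) (h ▸ (q j).getVert_mem_support m')
    subst hij
    have := (hq i).getVert_injOn (by have := hqM i; simp; omega) (by have := hqM i; simp; omega) h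
    simp [Fin.ext_iff, this]
  have h1 := Nat.card_le_card_of_injective f hf
  rw [Nat.card_coe_set_eq] at h1
  simp only [Nat.card_eq_fintype_card, Fintype.card_prod, Fintype.card_fin] at h1
  exact h1.trans (hreg i₀)

end Pieces

theorem mono_not (col : Sym2 V → Bool) (c : Bool) :
    G.mono (fun e => !col e) c = G.mono col !c := by
  ext u v
  simp [mono]

/-- Changing the colours of `k` edges has little effect on the path counts. -/
theorem abs_pathCount_sub_le [Finite V] {col col' : Sym2 V → Bool} {k : ℕ}
    (h : {e | e ∈ G.edgeSet ∧ col e ≠ col' e}.ncard ≤ k) (c : Bool) (t : ℕ) :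
    |(pathCount (G.mono col c) t : ℝ) - pathCount (G.mono col' c) t| ≤ 2 * k := by
  classical
  have := Fintype.ofFinite V
  set X : Set (Sym2 V) := {e | e ∈ G.edgeSet ∧ col e ≠ col' e} with hX
  -- Only components through an end point of a recoloured edge change; `k` edges have at most `2 *
  -- k` ends.
  set U : Set V := ⋃ e ∈ X, {x | x ∈ e} with hU
  have hUc : U.ncard ≤ k * 2 := by
    refine (ncard_biUnion_le X (fun e => {x | x ∈ e}) 2 fun e _ => ?_).trans
      (Nat.mul_le_mul_right _ h)
    induction e with
    | _ x y =>
      have : {z | z ∈ s(x, y)} = ({x, y} : Set V) := by ext; simp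
      rw [this]
      exact (Set.ncard_insert_le _ _).trans (by simp)
  have key : ∀ x, x ∉ U → ∀ y, (G.mono col c).Adj x y ↔ (G.mono col' c).Adj x y := by
    intro x hx y
    have hxy : G.Adj x y → col s(x, y) = col' s(x, y) := by
      intro hadj
      by_contra hne
      refine hx ?_
      simp only [hU, Set.mem_iUnion]
      exact ⟨s(x, y), ⟨hadj, hne⟩, by simp⟩
    constructor
    · rintro ⟨h1, h2⟩
      exact ⟨h1, (hxy h1) ▸ h2⟩
    · rintro ⟨h1, h2⟩
      exact ⟨h1, (hxy h1).symm ▸ h2⟩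
  have h1 := pathCount_le_add_ncard U key t
  have h2 := pathCount_le_add_ncard U (fun x hx y => (key x hx y).symm) t
  have h1' : (pathCount (G.mono col c) t : ℝ) ≤ pathCount (G.mono col' c) t + U.ncard := by
    exact_mod_cast h1
  have h2' : (pathCount (G.mono col' c) t : ℝ) ≤ pathCount (G.mono col c) t + U.ncard := by
    exact_mod_cast h2
  have h3 : (U.ncard : ℝ) ≤ k * 2 := by exact_mod_cast hUc
  rw [abs_le]
  constructor <;> linarith

end SimpleGraph

/-! ### The second moment argument. -/

namespace SimpleGraph

namespace Pieces

variable {V ι : Type*} {G : SimpleGraph V} (P : Pieces G ι)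

/-- A colouring with nearly balanced path counts in which many pieces of each kind keep their
colours. -/
theorem exists_colouring [Finite V] [Finite ι] (hG : G.IsCubic) (s D k : ℕ)
    (hs : ∀ i, (P.D i).ncard ≤ s) (hD : 2 ^ D * Nat.card V < 3 ^ D)
    (hk : (s * 3 + (2 * D + 1)) * 7 ^ 4 * (1 + s * 16 * 3) ≤ k) {β : Type*} (q : ι → β)
    (J : Finset β) (T m : ℕ) (hm : 0 < m) (hJ : ∀ b ∈ J, m ≤ {i | q i = b}.ncard) (t₀ : ℝ)
    (ht₀ : 0 < t₀)
    (hsum : T * ((Nat.card V * 3 : ℝ) * (4 * k) ^ 2 / t₀ ^ 2) + J.card * (16 / m : ℝ) < 1) :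
    ∃ col : Sym2 V → Bool, G.BothColours col ∧ (∀ c, (G.mono col c).IsAcyclic) ∧
      G.Meets col P.guard ∧
      (∀ t < T, |(pathCount (G.mono col true) t : ℝ) - pathCount (G.mono col false) t| ≤ t₀) ∧
      ∀ b ∈ J, (m / 4 : ℝ) ≤
        {i | q i = b ∧ ∀ x y, x ∈ P.D i → P.A.Adj x y → col s(x, y) = P.a s(x, y)}.ncard := by
  classical
  have := Fintype.ofFinite V
  have := Fintype.ofFinite ι
  obtain ⟨χ, B, hB, hχ, hodd, hrep, hlip⟩ := P.exists_random_colouring hG s D hs hD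
  let S : β → Finset ι := fun b => Finset.univ.filter fun i => q i = b
  have hS : ∀ b ∈ J, m ≤ (S b).card := by
    intro b hb
    refine (hJ b hb).trans (le_of_eq ?_)
    rw [Set.ncard_eq_toFinset_card']
    congr 1
    ext i; simp [S]
  let f₁ : ℕ → (Sym2 V → Bool) → ℝ := fun t ω =>
    (pathCount (G.mono (χ ω) true) t : ℝ) - pathCount (G.mono (χ ω) false) t
  let f₂ : β → (Sym2 V → Bool) → ℝ := fun b ω =>
    ∑ i ∈ S b, if ω (P.rep i) then (-1 : ℝ) else 1
  -- One bit changes at most `k` edges, hence each path count by at most `2 * k`, and their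
  -- difference by at most `4 * k`.
  let l₁ : Sym2 V → ℝ := fun e => if e ∈ B then 4 * k else 0
  let l₂ : β → Sym2 V → ℝ := fun b e => 2 * ((S b).filter fun i => P.rep i = e).card
  have hsum₁ : ∑ e, l₁ e ^ 2 ≤ (Nat.card V * 3 : ℝ) * (4 * k) ^ 2 := by
    have : ∀ e, l₁ e ^ 2 = if e ∈ B then (4 * k : ℝ) ^ 2 else 0 := by
      intro e
      by_cases he : e ∈ B <;> simp [l₁, he]
    simp only [this]
    rw [← Finset.sum_filter, Finset.sum_const, nsmul_eq_mul]
    refine mul_le_mul_of_nonneg_right ?_ (by positivity)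
    have : (Finset.univ.filter fun e => e ∈ B).card = B.ncard := by
      rw [Set.ncard_eq_toFinset_card']
      congr 1
      ext e; simp
    rw [this]
    exact_mod_cast hB
  have hsum₂ : ∀ b, ∑ e, l₂ b e ^ 2 ≤ 4 * (S b).card := by
    intro b
    have h1 : ∀ e, l₂ b e ^ 2 ≤ 4 * (((S b).filter fun i => P.rep i = e).card : ℝ) := by
      intro e
      have h1 : ((S b).filter fun i => P.rep i = e).card ≤ 1 := by
        rw [Finset.card_le_one]
        intro i hi j hj
        rw [Finset.mem_filter] at hi hj
        exact P.rep_injective (hi.2.trans hj.2.symm)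
      have h2 : (((S b).filter fun i => P.rep i = e).card : ℝ) ≤ 1 := by exact_mod_cast h1
      have h3 : (0 : ℝ) ≤ ((S b).filter fun i => P.rep i = e).card := by positivity
      simp only [l₂]
      nlinarith
    refine (Finset.sum_le_sum fun e _ => h1 e).trans (le_of_eq ?_)
    rw [← Finset.mul_sum]
    congr 1
    have := Finset.card_eq_sum_card_fiberwise (f := P.rep) (s := S b) (t := Finset.univ)
      (fun _ _ => Finset.mem_coe.mpr (Finset.mem_univ _))
    exact_mod_cast this.symm
  obtain ⟨ω, hω⟩ := exists_forall_abs_le_of_odd ((Finset.range T).disjSum J) (Sum.elim f₁ f₂)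
    -- A sum of signs of absolute value at most half the class size leaves at least a quarter of the
    -- class with its colours kept. The Chebyshev term of such a class is `4|S b| / (|S b|/2)² =
    -- 16/|S b| ≤ 16/m`.
    (Sum.elim (fun _ => l₁) l₂) (Sum.elim (fun _ => t₀) fun b => ((S b).card : ℝ) / 2)
    (by
      intro i hi
      rcases Finset.mem_disjSum.mp hi with ⟨t, -, rfl⟩ | ⟨b, hb, rfl⟩
      · exact ht₀
      · have : (0 : ℝ) < (S b).card := by exact_mod_cast hm.trans_le (hS b hb)
        simp only [Sum.elim_inr]
        positivity)
    (by
      intro i hi ω e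
      rcases Finset.mem_disjSum.mp hi with ⟨t, -, rfl⟩ | ⟨b, hb, rfl⟩
      · simp only [Sum.elim_inl, f₁, l₁]
        obtain ⟨h1, h2⟩ := hlip (Function.update ω e !ω e) ω e
          (fun b' hb' => Function.update_of_ne hb' _ _)
        split_ifs with he
        · have a1 := abs_pathCount_sub_le (h1.trans hk) true t
          have a2 := abs_pathCount_sub_le (h1.trans hk) false t
          rw [abs_le] at a1 a2 ⊢
          constructor <;> linarith [a1.1, a1.2, a2.1, a2.2]
        · have h3 := (Set.ncard_eq_zero (Set.toFinite _)).mpr (h2 he)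
          have a1 := abs_pathCount_sub_le h3.le true t
          have a2 := abs_pathCount_sub_le h3.le false t
          rw [abs_le] at a1 a2 ⊢
          push_cast at a1 a2
          constructor <;> linarith [a1.1, a1.2, a2.1, a2.2]
      · simp only [Sum.elim_inr, f₂, l₂]
        rw [← Finset.sum_sub_distrib]
        refine (Finset.abs_sum_le_sum_abs _ _).trans ?_
        rw [Finset.card_filter, Nat.cast_sum, Finset.mul_sum]
        refine Finset.sum_le_sum fun i _ => ?_
        by_cases hi : P.rep i = e
        · rw [hi]
          simp only [Function.update_self, if_true]
          cases ω e <;> norm_num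
        · simp [hi])
    (by
      intro i hi ω
      rcases Finset.mem_disjSum.mp hi with ⟨t, -, rfl⟩ | ⟨b, hb, rfl⟩
      · simp only [Sum.elim_inl, f₁]
        have : χ (fun b => !ω b) = fun e => !χ ω e := funext (hodd ω)
        rw [this, mono_not, mono_not]
        simp
      · simp only [Sum.elim_inr, f₂]
        rw [← Finset.sum_neg_distrib]
        refine Finset.sum_congr rfl fun i _ => ?_
        by_cases h : ω (P.rep i) = true <;> simp [h])
    (by
      rw [Finset.sum_disjSum]
      simp only [Sum.elim_inl, Sum.elim_inr]
      refine lt_of_le_of_lt (add_le_add ?_ ?_) hsum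
      · rw [Finset.sum_const, Finset.card_range, nsmul_eq_mul]
        gcongr
      · rw [← nsmul_eq_mul]
        refine Finset.sum_le_card_nsmul _ _ _ fun b hb => ?_
        have h0 : (0 : ℝ) < m := by exact_mod_cast hm
        have h1 : (m : ℝ) ≤ (S b).card := by exact_mod_cast hS b hb
        have h2 : (0 : ℝ) < (S b).card := h0.trans_le h1
        have h3 : 4 * ((S b).card : ℝ) / (((S b).card : ℝ) / 2) ^ 2 = 16 / ((S b).card : ℝ) := by
          rw [div_eq_div_iff (by positivity) h2.ne']
          ring
        have h4 : (16 : ℝ) / ((S b).card : ℝ) ≤ 16 / m :=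
          div_le_div_of_nonneg_left (by norm_num) h0 h1
        exact (div_le_div_of_nonneg_right (hsum₂ b) (by positivity)).trans (h3.le.trans h4))
  refine ⟨χ ω, (hχ ω).1, (hχ ω).2.1, (hχ ω).2.2, fun t ht => ?_, fun b hb => ?_⟩
  · exact hω (Sum.inl t) (by simpa using ht)
  · have h1 := hω (Sum.inr b) (by simpa using hb)
    simp only [Sum.elim_inr, f₂] at h1
    have h2 : ∑ i ∈ S b, (if ω (P.rep i) then (-1 : ℝ) else 1) =
        2 * ((S b).filter fun i => ω (P.rep i) = false).card - (S b).card := by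
      rw [Finset.card_filter, Finset.card_eq_sum_ones, Nat.cast_sum, Nat.cast_sum, Finset.mul_sum,
        ← Finset.sum_sub_distrib]
      refine Finset.sum_congr rfl fun i _ => ?_
      cases ω (P.rep i) <;> norm_num
    rw [h2, abs_le] at h1
    have h3 : (m : ℝ) ≤ (S b).card := by exact_mod_cast hS b hb
    have h4 : ((S b).filter fun i => ω (P.rep i) = false).card ≤
        {i | q i = b ∧ ∀ x y, x ∈ P.D i → P.A.Adj x y → χ ω s(x, y) = P.a s(x, y)}.ncard := by
      rw [← Set.ncard_coe_finset]
      refine Set.ncard_le_ncard ?_ (Set.toFinite _)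
      intro i hi
      simp only [Finset.coe_filter, S, Finset.mem_filter, Finset.mem_univ, true_and,
        Set.mem_ofPred_eq] at hi
      refine ⟨hi.1, fun x y hx hxy => ?_⟩
      rw [hrep ω i x y hx hxy, hi.2]
      simp
    have h5 : (((S b).filter fun i => ω (P.rep i) = false).card : ℝ) ≤
        {i | q i = b ∧ ∀ x y, x ∈ P.D i → P.A.Adj x y → χ ω s(x, y) = P.a s(x, y)}.ncard := by
      exact_mod_cast h4
    linarith [h1.1]

end Pieces

end SimpleGraph

/-! ### Numerical parameters. -/

open Filter in
theorem Real.eventually_mul_log_pow_lt_rpow (c : ℝ) (p : ℕ) {ε : ℝ} (hε : 0 < ε) :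
    ∀ᶠ n : ℕ in atTop, c * Real.log n ^ p < (n : ℝ) ^ ε := by
  have h := (isLittleO_log_rpow_rpow_atTop (p : ℝ) hε).comp_tendsto
    (tendsto_natCast_atTop_atTop (R := ℝ))
  have h1 := h.def (c := (|c| + 1)⁻¹) (by positivity)
  filter_upwards [h1, eventually_ge_atTop 2] with n hn h2
  have hn0 : (1 : ℝ) < n := by exact_mod_cast h2
  have hL : 0 < Real.log n := Real.log_pos hn0
  have hLp : 0 < Real.log n ^ p := by positivity
  have hnp : 0 < (n : ℝ) ^ ε := by positivity
  simp only [Function.comp, Real.rpow_natCast, Real.norm_eq_abs, abs_of_pos hLp,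
    abs_of_pos hnp] at hn
  rw [inv_mul_eq_div, le_div_iff₀ (by positivity)] at hn
  nlinarith [le_abs_self c]

/-- Because `e < (3/2)³`. Hence logarithmically many layers suffice in
`exists_identification_nonconstant`. -/
theorem Real.exp_lt_pow {L : ℝ} {D : ℕ} (h : 3 * L < D) : Real.exp L < (3 / 2 : ℝ) ^ D := by
  have h1 : Real.exp (1 / 3) < 3 / 2 := by
    refine lt_of_pow_lt_pow_left₀ 3 (by norm_num) ?_
    rw [← Real.exp_nat_mul]
    have := Real.exp_one_lt_d9
    norm_num
    linarith
  calc Real.exp L < Real.exp (D * (1 / 3)) := Real.exp_lt_exp.mpr (by linarith)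
    _ = Real.exp (1 / 3) ^ D := Real.exp_nat_mul _ _
    _ ≤ _ := by gcongr

set_option maxHeartbeats 1000000 in
/-- The numerical inequalities relating the sizes of the pieces to the order `n`. -/
theorem eventually_parameters (C : ℝ) : ∃ n₀ : ℕ, ∀ n ≥ n₀, ∃ s D k N m T R : ℕ,
    1 ≤ Real.log n ∧ C * √(Real.log n) < s + 1 ∧ 1 ≤ n ∧ 20 ≤ R ∧ (R : ℝ) ≤ Real.log n ∧ R ≤ T ∧
    s * 4 ^ 22 ≤ R ∧ 2 ^ D * n < 3 ^ D ∧
    (s * 3 + (2 * D + 1)) * 7 ^ 4 * (1 + s * 16 * 3) ≤ k ∧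
    n * m * ((s + 1) * 4 ^ 100) < N * N ∧ (N : ℝ) < (n : ℝ) ^ (0.99 : ℝ) + 1 ∧
    (n : ℝ) ^ (0.9 : ℝ) ≤ m / 4 ∧
    ∀ j : ℕ, j * N ≤ n →
      T * ((n * 3 : ℝ) * (4 * k) ^ 2 / ((n : ℝ) ^ (2 / 3 : ℝ)) ^ 2) + j * (16 / m : ℝ) < 1 := by
  obtain ⟨Q, hQ⟩ : ∃ Q : ℕ, 4 ^ 100 = Q := ⟨_, rfl⟩
  have hQ0 : 0 < Q := hQ ▸ by positivity
  rw [hQ]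
  clear hQ
  -- Replacing `C` by at least 1 allows lower-order terms to be absorbed into multiples of `c * L`.
  set c : ℝ := max C 1 with hc
  have hc1 : 1 ≤ c := le_max_right _ _
  set A : ℝ := 12 * 2401 * 49 * c ^ 2 with hA
  have ev := (Real.eventually_mul_log_pow_lt_rpow (10 * Q * c) 1 (ε := 0.08) (by norm_num)).and
    ((Real.eventually_mul_log_pow_lt_rpow (200 * A ^ 2) 5 (ε := 1 / 3) (by norm_num)).and
    ((Real.eventually_mul_log_pow_lt_rpow 8 0 (ε := 0.89) (by norm_num)).and
    ((Filter.tendsto_atTop.mp (Real.tendsto_log_atTop.comp (tendsto_natCast_atTop_atTop (R := ℝ)))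
      ((c * 4 ^ 22) ^ 2)).and (Filter.eventually_ge_atTop 1))))
  obtain ⟨n₀, hn₀⟩ := Filter.eventually_atTop.mp ev
  refine ⟨n₀, fun n hn => ?_⟩
  obtain ⟨e1, e2, e3, e4, e5⟩ := hn₀ n hn
  have hn1 : (1 : ℝ) ≤ n := by exact_mod_cast e5
  have hn0 : (0 : ℝ) < n := by linarith
  simp only [Function.comp] at e4
  set L := Real.log n with hL
  have hL20 : 4 ^ 22 ≤ L := by nlinarith
  have hL1 : 1 ≤ L := by linarith
  have hcL : L ≤ c * L := le_mul_of_one_le_left (by linarith) hc1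
  have hsq : √L * √L = L := Real.mul_self_sqrt (by linarith)
  have hsc : c * 4 ^ 22 ≤ √L := Real.le_sqrt_of_sq_le e4
  have hsq1 : 1 ≤ √L := by linarith
  have hsqL : √L ≤ L := by nlinarith
  have hs : (⌊c * √L⌋₊ : ℝ) ≤ c * √L := Nat.floor_le (by positivity)
  have hs' : c * √L < ⌊c * √L⌋₊ + 1 := Nat.lt_floor_add_one _
  set s := ⌊c * √L⌋₊
  have hsL : (s : ℝ) ≤ c * L := hs.trans (by gcongr)
  have hD : (⌊3 * L⌋₊ : ℝ) ≤ 3 * L := Nat.floor_le (by positivity)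
  have hD' : 3 * L < ⌊3 * L⌋₊ + 1 := Nat.lt_floor_add_one _
  set D := ⌊3 * L⌋₊
  have hT : (⌊L⌋₊ : ℝ) ≤ L := Nat.floor_le (by positivity)
  set k := (s * 3 + (2 * (D + 1) + 1)) * 7 ^ 4 * (1 + s * 16 * 3) with hk
  have hkL : (k : ℝ) ≤ A * L ^ 2 := by
    have h1 : ((s * 3 + (2 * (D + 1) + 1) : ℝ)) ≤ 12 * c * L := by linarith
    have h2 : (1 + s * 16 * 3 : ℝ) ≤ 49 * c * L := by linarith
    calc (k : ℝ) = (s * 3 + (2 * (D + 1) + 1)) * 7 ^ 4 * (1 + s * 16 * 3) := by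
          rw [hk]; push_cast; ring
      _ ≤ (12 * c * L) * 7 ^ 4 * (49 * c * L) := by gcongr
      _ = A * L ^ 2 := by rw [hA]; ring
  set x : ℝ := (n : ℝ) ^ (0.9 : ℝ) with hx
  have hx1 : 1 ≤ x := Real.one_le_rpow hn1 (by norm_num)
  have hm : 4 * x ≤ ⌈4 * x⌉₊ := Nat.le_ceil _
  have hm' : (⌈4 * x⌉₊ : ℝ) < 4 * x + 1 := Nat.ceil_lt_add_one (by positivity)
  set m := ⌈4 * x⌉₊
  set y : ℝ := (n : ℝ) ^ (0.99 : ℝ) with hy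
  have hy1 : 1 ≤ y := Real.one_le_rpow hn1 (by norm_num)
  have hN : y ≤ ⌈y⌉₊ := Nat.le_ceil _
  have hN' : (⌈y⌉₊ : ℝ) < y + 1 := Nat.ceil_lt_add_one (by positivity)
  set N := ⌈y⌉₊
  -- The exponents leave room: 2 · 0.99 = 1 + 0.9 + 0.08, and `n ^ 0.08` absorbs the logarithmic
  -- number of conflicts.
  have hyy : y * y = n * x * (n : ℝ) ^ (0.08 : ℝ) := by
    calc y * y = (n : ℝ) ^ ((1 : ℝ) + 0.9 + 0.08) := by
          rw [hy, ← Real.rpow_add hn0]; norm_num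
      _ = _ := by rw [Real.rpow_add hn0, Real.rpow_add hn0, Real.rpow_one]
  have hxy : x * y = n * (n : ℝ) ^ (0.89 : ℝ) := by
    calc x * y = (n : ℝ) ^ ((1 : ℝ) + 0.89) := by
          rw [hx, hy, ← Real.rpow_add hn0]; norm_num
      _ = _ := by rw [Real.rpow_add hn0, Real.rpow_one]
  have h23 : ((n : ℝ) ^ (2 / 3 : ℝ)) ^ 2 = n * (n : ℝ) ^ (1 / 3 : ℝ) := by
    calc ((n : ℝ) ^ (2 / 3 : ℝ)) ^ 2 = (n : ℝ) ^ ((1 : ℝ) + 1 / 3) := by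
          rw [← Real.rpow_natCast, ← Real.rpow_mul hn0.le]; norm_num
      _ = _ := by rw [Real.rpow_add hn0, Real.rpow_one]
  -- Regions have at most `s * 4 ^ 22 = O(√L)` vertices, below `R = ⌊L⌋` for large `n`; `T = R`
  -- lengths need balancing. The factor 4 in `m` pays for the quarter of the pieces that is
  -- guaranteed to be kept.
  refine ⟨s, D + 1, k, N, m, ⌊L⌋₊, ⌊L⌋₊, hL1, ?_, e5, ?_, hT, le_rfl, ?_, ?_, le_rfl, ?_, hN', ?_,
    ?_⟩
  · exact lt_of_le_of_lt (mul_le_mul_of_nonneg_right (le_max_left _ _) (by positivity)) hs'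
  · refine Nat.le_floor ?_
    push_cast
    linarith
  · refine Nat.le_floor ?_
    have : (s : ℝ) * 4 ^ 22 ≤ L := by
      calc (s : ℝ) * 4 ^ 22 ≤ c * √L * 4 ^ 22 := by gcongr
        _ = c * 4 ^ 22 * √L := by ring
        _ ≤ √L * √L := by gcongr
        _ = L := hsq
    push_cast
    linarith
  · have h1 : (n : ℝ) < (3 / 2 : ℝ) ^ (D + 1) := by
      rw [← Real.exp_log hn0]
      exact Real.exp_lt_pow (by push_cast; exact hD')
    have h2 : (2 : ℝ) ^ (D + 1) * n < 3 ^ (D + 1) := by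
      rwa [div_pow, lt_div_iff₀ (by positivity), mul_comm] at h1
    exact_mod_cast h2
  · have h1 : ((n * m * ((s + 1) * Q) : ℕ) : ℝ) < ((N * N : ℕ) : ℝ) := by
      push_cast
      calc (n : ℝ) * m * ((s + 1) * Q) ≤ n * (5 * x) * ((2 * c * L) * Q) := by
            gcongr
            · linarith
            · linarith
        _ = n * x * (10 * Q * c * L ^ 1) := by ring
        _ < n * x * (n : ℝ) ^ (0.08 : ℝ) := by gcongr
        _ = y * y := hyy.symm
        _ ≤ N * N := by gcongr
    exact_mod_cast h1
  · linarith
  · intro j hj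
    have hj : (j : ℝ) * N ≤ n := by exact_mod_cast hj
    have h1 : (⌊L⌋₊ : ℝ) * ((n * 3 : ℝ) * (4 * k) ^ 2 / ((n : ℝ) ^ (2 / 3 : ℝ)) ^ 2) ≤ 1 / 2 := by
      rw [h23, ← mul_div_assoc, div_le_iff₀ (by positivity)]
      calc (⌊L⌋₊ : ℝ) * ((n * 3 : ℝ) * (4 * k) ^ 2)
          ≤ L * ((n * 3 : ℝ) * (4 * (A * L ^ 2)) ^ 2) := by gcongr
        _ = n * (48 * A ^ 2 * L ^ 5) := by ring
        _ ≤ n * (1 / 2 * (200 * A ^ 2 * L ^ 5)) := by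
            have : 0 ≤ A ^ 2 * L ^ 5 := by positivity
            gcongr ?_ * ?_
            linarith
        _ ≤ n * (1 / 2 * (n : ℝ) ^ (1 / 3 : ℝ)) := by gcongr
        _ = _ := by ring
    have h2 : (j : ℝ) * (16 / m : ℝ) < 1 / 2 := by
      have hm0 : (0 : ℝ) < m := by linarith
      rw [← mul_div_assoc, div_lt_iff₀ hm0]
      by_contra! hcon
      have a1 : 4 * (x * y) ≤ m * N := by
        calc 4 * (x * y) = 4 * x * y := by ring
          _ ≤ _ := by gcongr
      have a2 : 1 / 2 * ((m : ℝ) * N) ≤ 16 * n := by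
        calc 1 / 2 * ((m : ℝ) * N) = 1 / 2 * m * N := by ring
          _ ≤ j * 16 * N := by gcongr
          _ = 16 * (j * N) := by ring
          _ ≤ _ := by gcongr
      rw [hxy] at a1
      have a3 : (n : ℝ) * 8 < n * (n : ℝ) ^ (0.89 : ℝ) := by
        gcongr
        simpa using e3
      linarith
    linarith

/-! ### Assembly. -/

open SimpleGraph

/-- The red-blue colouring of the edges of `G` given by `col`. -/
def SimpleGraph.colouredGraph {V : Type*} (G : SimpleGraph V) (col : Sym2 V → Bool) :
    ColouredGraph V where
  red := G.mono col true
  blue := G.mono col false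
  disjoint := by
    rw [disjoint_iff_inf_le]
    rintro u v ⟨h1, h2⟩
    exact Bool.noConfusion (h1.2.symm.trans h2.2)

theorem SimpleGraph.colouredGraph_graph {V : Type*} (G : SimpleGraph V) (col : Sym2 V → Bool) :
    (G.colouredGraph col).graph = G := by
  ext u v
  constructor
  · rintro (h | h)
    · exact h.1
    · exact h.1
  · intro h
    cases hc : col s(u, v)
    · exact Or.inr ⟨h, hc⟩
    · exact Or.inl ⟨h, hc⟩

namespace ColouredGraph

variable {V : Type*}

theorem CompEquiv.nontrivial_iff {A : ColouredGraph V} {c d : A.graph.ConnectedComponent}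
    (h : A.CompEquiv c d) : c.supp.Nontrivial ↔ d.supp.Nontrivial := by
  obtain ⟨φ, -⟩ := h
  rw [← Set.nontrivial_coe_sort, ← Set.nontrivial_coe_sort]
  exact φ.nontrivial_congr

theorem survives_of_not_nontrivial {A B : ColouredGraph V} {c : A.graph.ConnectedComponent}
    (hc : ¬ c.supp.Nontrivial) : A.Survives B c := by
  intro x hx y hy
  rw [Set.not_nontrivial_iff] at hc
  obtain rfl := hc hx hy
  exact ⟨fun h => absurd rfl h.ne, fun h => absurd rfl h.ne⟩

theorem survives_of_forall_pieces [Finite V] {A : ColouredGraph V} {G : SimpleGraph V} {C : ℝ}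
    (hA : Extendable G A C) {S : Set A.graph.ConnectedComponent}
    (hS : ∀ c ∈ S, ∀ d ∈ S, A.Close G c d → c = d) {col : Sym2 V → Bool}
    (i : {c // c ∈ S ∧ c.supp.Nontrivial})
    (h : ∀ x y, x ∈ (pieces hA S hS).D i → (pieces hA S hS).A.Adj x y →
      col s(x, y) = (pieces hA S hS).a s(x, y)) : A.Survives (G.colouredGraph col) i.1 := by
  classical
  intro x hx y _
  have hxS : A.graph.connectedComponentMk x ∈ S := by
    rw [(ConnectedComponent.mem_supp_iff _ _).mp hx]
    exact i.2.1
  constructor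
  · intro hr
    refine ⟨hA.le (Or.inl hr), (h x y hx ⟨Or.inl hr, hxS⟩).trans ?_⟩
    simp [pieces, hr]
  · intro hb
    refine ⟨hA.le (Or.inr hb), (h x y hx ⟨Or.inr hb, hxS⟩).trans ?_⟩
    have h3 : ¬ A.red.Adj x y := fun h => (disjoint_iff_inf_le.mp A.disjoint) ⟨h, hb⟩
    simp [pieces, h3]

end ColouredGraph

open ColouredGraph in
/-- Extending the colouring of an extendable subgraph, for suitable parameters. -/
theorem Extendable.exists_colouring {V : Type*} [Finite V] {G : SimpleGraph V} (hG : G.IsCubic)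
    {A : ColouredGraph V} {C : ℝ} (hA : Extendable G A C) {s D k N m T R : ℕ} {t₀ : ℝ}
    (hC : C < s + 1) (hR : 20 ≤ R) (hRT : R ≤ T) (hsR : s * 4 ^ 22 ≤ R)
    (hD : 2 ^ D * Nat.card V < 3 ^ D)
    (hk : (s * 3 + (2 * D + 1)) * 7 ^ 4 * (1 + s * 16 * 3) ≤ k)
    (hN : Nat.card V * m * ((s + 1) * 4 ^ 100) < N * N) (hm : 0 < m) (ht₀ : 0 < t₀)
    (hsum : ∀ j : ℕ, j * N ≤ Nat.card V →
      T * ((Nat.card V * 3 : ℝ) * (4 * k) ^ 2 / t₀ ^ 2) + j * (16 / m : ℝ) < 1) :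
    ∃ col : Sym2 V → Bool,
      (∀ c (d : (G.mono col c).ConnectedComponent), ∃ t < R, IsPathComponent _ d t) ∧
      (∀ c c' u v (p : (G.mono col c).Walk u v), p.IsPath → ∀ (j M : ℕ), 20 ≤ M →
        ∀ (a b : Fin j → V) (q : ∀ i, (G.mono col c').Walk (a i) (b i)), (∀ i, (q i).IsPath) →
        (∀ i, M ≤ (q i).length) → (∀ i, ∃ x ∈ p.support, x ∈ (q i).support) →
        (∀ i i', i ≠ i' → (q i).support.Disjoint (q i').support) → j * M ≤ R) ∧
      (∀ t, |(pathCount (G.mono col true) t : ℝ) - pathCount (G.mono col false) t| ≤ t₀) ∧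
      ∀ c₀, N ≤ {c | A.CompEquiv c₀ c}.ncard →
        (m / 4 : ℝ) ≤ {c | A.CompEquiv c₀ c ∧ A.Survives (G.colouredGraph col) c}.ncard ∨
        ∀ c, A.CompEquiv c₀ c → A.Survives (G.colouredGraph col) c := by
  classical
  have hsize : ∀ c : A.graph.ConnectedComponent, c.supp.Nontrivial → c.supp.ncard ≤ s := by
    intro c hc
    have h : (c.supp.ncard : ℝ) < s + 1 := (hA.size c hc).trans_lt hC
    have h : c.supp.ncard < s + 1 := by exact_mod_cast h
    omega
  have hcard : Nat.card A.graph.ConnectedComponent ≤ Nat.card V :=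
    Nat.card_le_card_of_surjective A.graph.connectedComponentMk Quot.mk_surjective
  obtain ⟨S, hS, hSm⟩ := exists_separated A.compClass (A.Close G)
    (fun c => by
      obtain ⟨x, hx⟩ := c.nonempty_supp
      exact ⟨x, hx, x, hx, Walk.nil, by simp⟩)
    (fun c d => by
      rintro ⟨x, hx, y, hy, p, hp⟩
      exact ⟨y, hy, x, hx, p.reverse, by rwa [Walk.length_reverse]⟩)
    m ((s + 1) * 4 ^ 100) N
    (fun c => by
      refine (ncard_close_le hG c).trans (Nat.mul_le_mul_right _ ?_)
      by_cases hc : c.supp.Nontrivial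
      · exact (hsize c hc).trans (Nat.le_succ _)
      · rw [Set.not_nontrivial_iff] at hc
        have := (Set.ncard_le_one_iff_subsingleton (s := c.supp)).mpr hc
        omega)
    (lt_of_le_of_lt (Nat.mul_le_mul_right _ (Nat.mul_le_mul_right _ hcard)) hN)
  have hclass : ∀ c₀, {c | A.compClass c = A.compClass c₀} = {c | A.CompEquiv c₀ c} := by
    intro c₀
    ext c
    exact compClass_eq_iff
  let P := pieces hA S hS
  -- Classes of isolated vertices are left out, since pieces must have an edge; such components
  -- survive vacuously.
  have hfin : {b | N ≤ {c | A.compClass c = b}.ncard ∧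
      ∃ c, A.compClass c = b ∧ c.supp.Nontrivial}.Finite := Set.toFinite _
  let J : Finset (Set A.graph.ConnectedComponent) := hfin.toFinset
  have hJN : J.card * N ≤ Nat.card V := by
    refine le_trans (Nat.mul_le_mul_right _ ?_) ((ncard_frequent_mul_le A.compClass N).trans hcard)
    rw [← Set.ncard_eq_toFinset_card _ hfin]
    exact Set.ncard_le_ncard (fun b hb => hb.1) (Set.toFinite _)
  obtain ⟨col, hb, hac, hcol, hbal, hsurv⟩ := P.exists_colouring hG s D k
    (fun i => hsize i.1 i.2.2) hD hk (fun i => A.compClass i.1) J T m hm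
    (by
      intro b hb
      rw [Set.Finite.mem_toFinset] at hb
      obtain ⟨hb, c₀, rfl, hc₀⟩ := hb
      refine (hSm _ hb).trans ?_
      rw [← Set.ncard_image_of_injective _ Subtype.val_injective]
      refine Set.ncard_le_ncard ?_ (Set.toFinite _)
      rintro c ⟨hcS, hc⟩
      exact ⟨⟨c, hcS, (compClass_eq_iff.mp hc).nontrivial_iff.mp hc₀⟩, hc, rfl⟩)
    t₀ ht₀ (hsum _ hJN)
  have hreg : ∀ i, (P.region i).ncard ≤ R := fun i =>
    (hG.ncard_nearSet_le _ _).trans ((Nat.mul_le_mul_right _ (hsize i.1 i.2.2)).trans hsR)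
  have hpath : ∀ c (d : (G.mono col c).ConnectedComponent), ∃ t < R, IsPathComponent _ d t :=
    fun c d => P.exists_isPathComponent hG hb hac hcol hR hreg d
  refine ⟨col, hpath, ?_, ?_, ?_⟩
  · intro c c' u v p hp j M hM a b q hq hqM hpq hdis
    exact P.mul_le_of_disjoint_paths hcol hreg hp hM q hq hqM hpq hdis
  · intro t
    rcases lt_or_ge t T with ht | ht
    · exact hbal t ht
    -- From length `T ≥ R` on, there are no path components at all.
    · have h0 : ∀ c, pathCount (G.mono col c) t = 0 := by
        intro c
        unfold pathCount
        rw [Set.ncard_eq_zero (Set.toFinite _), Set.eq_empty_iff_forall_notMem]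
        intro d hd
        obtain ⟨t', ht', hd'⟩ := hpath c d
        have := IsPathComponent.length_eq hd hd'
        omega
      rw [h0, h0]
      simpa using ht₀.le
  · intro c₀ hc₀
    by_cases hn : c₀.supp.Nontrivial
    · left
      have hb : A.compClass c₀ ∈ J := by
        rw [Set.Finite.mem_toFinset]
        refine ⟨?_, c₀, rfl, hn⟩
        rwa [hclass]
      refine (hsurv _ hb).trans ?_
      rw [Nat.cast_le, ← Set.ncard_image_of_injective _ Subtype.val_injective]
      refine Set.ncard_le_ncard ?_ (Set.toFinite _)
      rintro c ⟨i, ⟨hi, hcol⟩, rfl⟩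
      exact ⟨compClass_eq_iff.mp hi, survives_of_forall_pieces hA hS i hcol⟩
    · right
      intro c hc
      exact survives_of_not_nontrivial fun h => hn (hc.nontrivial_iff.mpr h)

theorem lemma3p2 :
    ∃ K : ℝ, ∀ C : ℝ, ∃ n₀ : ℕ, ∀ (V : Type*) [Fintype V] (G : SimpleGraph V) [DecidableRel G.Adj]
      (n : ℕ), n = Fintype.card V → n₀ ≤ n → G.IsRegularOfDegree 3 →
      ∀ G₀ : ColouredGraph V, Extendable G G₀ (C * √(Real.log n)) →
        ∃ χ : ColouredGraph V, χ.graph = G ∧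
          -- monochromatic components are paths of length `O(log n)`
          ((∀ c : χ.red.ConnectedComponent,
              ∃ t : ℕ, (t : ℝ) ≤ K * Real.log n ∧ IsPathComponent χ.red c t) ∧
            (∀ c : χ.blue.ConnectedComponent,
              ∃ t : ℕ, (t : ℝ) ≤ K * Real.log n ∧ IsPathComponent χ.blue c t)) ∧
          -- no short path meets many long paths of the other colour
          (NoSpider χ.red χ.blue (Real.log n ^ (2 / 3 : ℝ))
              (100 * √(Real.log n)) (100 * √(Real.log n)) ∧
            NoSpider χ.blue χ.red (Real.log n ^ (2 / 3 : ℝ))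
              (100 * √(Real.log n)) (100 * √(Real.log n))) ∧
          -- the path counts are almost balanced
          (∀ t : ℕ, 1 ≤ t →
            |(pathCount χ.red t : ℝ) - (pathCount χ.blue t : ℝ)| ≤ (n : ℝ) ^ (2 / 3 : ℝ)) ∧
          -- many components of each frequent isomorphism type survive
          (∀ (k : ℕ) (H : ColouredGraph (Fin k)),
            (n : ℝ) ^ (0.99 : ℝ) ≤ ({c | G₀.ComponentIso H c}.ncard : ℝ) →
            (n : ℝ) ^ (0.9 : ℝ) ≤ ({c | G₀.ComponentIso H c ∧ G₀.Survives χ c}.ncard : ℝ)) := by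
  -- The regions have at most `log n` vertices for large `n`, whatever `C` is, so `K = 1` works.
  refine ⟨1, fun C => ?_⟩
  obtain ⟨n₀, hn₀⟩ := eventually_parameters C
  refine ⟨n₀, fun V _ G _ n hn hnn hreg A hA => ?_⟩
  obtain ⟨s, D, k, N, m, T, R, hL, hC, hn1, hR, hRL, hRT, hsR, hD, hk, hN, hNn, hm, hsum⟩ :=
    hn₀ n hnn
  have hV : Nat.card V = n := by rw [hn, Nat.card_eq_fintype_card]
  have hnR : (1 : ℝ) ≤ n := by exact_mod_cast hn1
  have hn0 : (0 : ℝ) < n := by linarith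
  have hG : G.IsCubic := by
    intro v
    rw [Set.ncard_eq_toFinset_card', ← SimpleGraph.neighborFinset_def,
      SimpleGraph.card_neighborFinset_eq_degree]
    exact hreg v
  have hm0 : (0 : ℝ) < m := by
    have : (0 : ℝ) < (n : ℝ) ^ (0.9 : ℝ) := by positivity
    linarith
  obtain ⟨col, hpath, hspider, hbal, hsurv⟩ := hA.exists_colouring hG
    (t₀ := (n : ℝ) ^ (2 / 3 : ℝ)) hC hR hRT hsR (hV ▸ hD) hk (hV ▸ hN) (by exact_mod_cast hm0)
    (by positivity) (hV ▸ hsum)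
  have hQ1 : ∀ c (d : (G.mono col c).ConnectedComponent),
      ∃ t : ℕ, (t : ℝ) ≤ 1 * Real.log n ∧ IsPathComponent (G.mono col c) d t := by
    intro c d
    obtain ⟨t, ht, hd⟩ := hpath c d
    have : (t : ℝ) < R := by exact_mod_cast ht
    exact ⟨t, by linarith, hd⟩
  have hQ2 : ∀ c c', NoSpider (G.mono col c) (G.mono col c') (Real.log n ^ (2 / 3 : ℝ))
      (100 * √(Real.log n)) (100 * √(Real.log n)) := by
    rintro c c' ⟨u, v, p, j, a, b, q, hp, -, hj, hq, hdis⟩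
    have hsq : √(Real.log n) * √(Real.log n) = Real.log n := Real.mul_self_sqrt (by linarith)
    have hsq1 : 1 ≤ √(Real.log n) := Real.one_le_sqrt.mpr hL
    have hM := Nat.le_ceil (100 * √(Real.log n))
    set M := ⌈100 * √(Real.log n)⌉₊ with hMdef
    have hM20 : 20 ≤ M := by
      have : (20 : ℝ) ≤ M := by linarith
      exact_mod_cast this
    have h1 := hspider c c' u v p hp j M hM20 a b q (fun i => (hq i).1)
      (fun i => Nat.ceil_le.mpr (hq i).2.1) (fun i => (hq i).2.2) hdis
    have h2 : (j : ℝ) * M ≤ R := by exact_mod_cast h1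
    -- Such a family of paths would need `10⁴ log n` vertices in a region having at most `log n`.
    have h3 : (100 * √(Real.log n)) * (100 * √(Real.log n)) ≤ j * M := by gcongr
    nlinarith
  refine ⟨G.colouredGraph col, G.colouredGraph_graph col, ⟨hQ1 true, hQ1 false⟩,
    ⟨hQ2 true false, hQ2 false true⟩, fun t _ => hbal t, fun j H hH => ?_⟩
  have hpos : (0 : ℝ) < {c | A.ComponentIso H c}.ncard :=
    lt_of_lt_of_le (by positivity) hH
  obtain ⟨c₀, hc₀⟩ := (Set.ncard_pos (Set.toFinite _)).mp (Nat.cast_pos.mp hpos)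
  have hiff : ∀ c, A.ComponentIso H c ↔ A.CompEquiv c₀ c :=
    fun c => ColouredGraph.ComponentIso.iff_compEquiv hc₀
  simp only [hiff] at hH ⊢
  have hNc : N ≤ {c | A.CompEquiv c₀ c}.ncard := by
    have h : (N : ℝ) < {c | A.CompEquiv c₀ c}.ncard + 1 := by linarith
    have h : N < {c | A.CompEquiv c₀ c}.ncard + 1 := by exact_mod_cast h
    omega
  rcases hsurv c₀ hNc with h | h
  · exact hm.trans h
  · have heq : {c | A.CompEquiv c₀ c ∧ A.Survives (G.colouredGraph col) c} =
        {c | A.CompEquiv c₀ c} := by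
      ext c
      exact ⟨fun hc => hc.1, fun hc => ⟨hc, h c hc⟩⟩
    rw [heq]
    exact (Real.rpow_le_rpow_of_exponent_le hnR (by norm_num)).trans hH
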